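/- **Setting.** Let $\varphi:\mathbb R^2\to[0,\infty)$ be a crystalline anisotropy: convex, positively one-homogeneous, $c|x|\le\varphi(x)\le C|x|$ for some $0<c\le C$, and such that the Wulff shape $W=\{\varphi\le1\}$ is a polygon; its boundary segments are called facets. Let $\varphi^o(x)=\max_{y\in W}\langle x,y\rangle$, and let $\alpha>0$. A *closed polygonal curve* $\Gamma$ is a closed oriented curve, possibly with self-intersections, that runs consecutively through finitely many nondegenerate segments $S_1,\dots,S_n$ (indices modulo $n$); a cyclic relabelling of the segments gives the same curve. Let $\tau_i$ be the unit tangent of $S_i$, $\nu_i$ its counterclockwise rotation by $90^\circ$, and $\theta_i\in[0,2\pi)$ the angle from $\tau_i$ counterclockwise to $-\tau_{i-1}$. The curve is *admissible* if for all $i$ the vectors $\nu_{i-1}$ and $\nu_i$ are the outer unit normals of two different facets $F_{i-1},F_i$ of $W$ with a common vertex. Denote this vertex by $N_i$. The Cahn–Hoffman field of $\Gamma$ takes the value $N_i$ at the common vertex of $S_{i-1}$ and $S_i$ and is affine on each segment. Its tangential divergence on $S_i$ is the $\varphi$-curvature of $S_i$, and the *index* of $\Gamma$ is the signed number of its complete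 turns around $\partial W$. Put $c_i=1$ if $\theta_i,\theta_{i+1}>\pi$, $c_i=-1$ if $\theta_i,\theta_{i+1}<\pi$, and $c_i=0$ otherwise. A family $\{\Gamma(t)\}_{t\in[0,T)}$, $T\in(0,\infty]$, of closed polygonal curves is an *elastic flow* starting from an admissible $\Gamma^0=\bigcup_{i=1}^nS_i^0$ if every $\Gamma(t)$ is parallel to $\Gamma^0$ (it consists of consecutive segments $S_1(t),\dots,S_n(t)$ with the same unit normals $\nu_i$) and the signed heights $h_i(t)$ (the signed distance in the direction $\nu_i$ from the line through $S_i^0$ to the line through $S_i(t)$) belong to $C^0([0,T))\cap C^1(0,T)$, vanish at $t=0$, and satisfy in $(0,T)$ $$\frac{h_i'}{\varphi^o(\nu_i)}=-\frac{c_i|F_i|}{|S_i|}-\frac{\alpha}{|S_i|}\left(\frac{c_{i-1}^2\delta_{i-1}}{|S_{i-1}|^2\sin\theta_i}+\frac{c_i^2\delta_i(\cot\theta_i+\cot\theta_{i+1})}{|S_i|^2}+\frac{c_{i+1}^2\delta_{i+1}}{|S_{i+1}|^2\sin\theta_{i+1}}\right),\qquad\delta_j=|F_j|^2\varphi^o(\nu_j),$$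 where $|\cdot|$ denotes length and $S_j=S_j(t)$. It is *maximal* if it does not extend to an elastic flow on a longer interval. A family of closed curves is *Kuratowski continuous* if the sets of points of the curves depend continuously on $t$ in the sense of Kuratowski convergence and, since the set of points of a self-intersecting curve does not determine the curve, also the curves themselves depend continuously on $t$ with respect to uniform convergence up to orientation-preserving reparametrization. **Theorem (restart of the flow).** Let $\Gamma^0$ be an admissible closed polygonal curve consisting of $n$ segments. Then there exist a unique family $\{\Gamma(t)\}_{t\in[0,\infty)}$ of admissible closed polygonal curves with $\Gamma(0)=\Gamma^0$ and unique times $0=T_0<T_1<\dots<T_m<T_{m+1}=\infty$, where $0\le m<n$, such that * (a) $t\mapsto\Gamma(t)$ is Kuratowski continuous in $[0,\infty)$; * (b) for every $i\in\{0,\dots,m\}$ the family $\{\Gamma(t)\}_{t\in[T_i,T_{i+1})}$ is, after the translation of time by $T_i$, the unique maximal elastic flow starting from $\Gamma(T_i)$, and every elastic flow starting from $\Gamma(T_i)$ is a restriction of it; * (c) for every $i\in\{0,\dots,m-1\}$ there is at least one segment of $\Gamma(t)$, $t\in[T_i,T_{i+1})$, that has zero $\varphi$-curvature and whose length tends to $0$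 as $t\nearrow T_{i+1}$; * (d) for every $i\in\{0,\dots,m-1\}$ the lengths of the segments of $\Gamma(t)$ with nonzero $\varphi$-curvature are bounded away from $0$ for $t\in[T_i,T_{i+1})$; * (e) for every $t\ge0$ the index of $\Gamma(t)$ equals the index of $\Gamma^0$. The uniqueness of the family and of the times holds already among those that satisfy (a) and, on each interval $[T_i,T_{i+1})$, are a maximal elastic flow starting from $\Gamma(T_i)$. -/

import Mathlib

open Filter Topology

noncomputable section

/-- The Euclidean plane `ℝ²`. -/
abbrev Plane : Type := EuclideanSpace ℝ (Fin 2)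

/-- Counterclockwise rotation by 90 degrees. -/
def perp (v : Plane) : Plane := !₂[-(v 1), v 0]

/-- The oriented angle in `[0, 2π)` by which `a` has to be turned counterclockwise in order to point
in the direction of `b`. The complex number below is `conj a * b`, with `ℝ² = ℂ`. -/
def ccwAngle (a b : Plane) : ℝ :=
  if 0 ≤ Complex.arg ⟨inner ℝ a b, inner ℝ (perp a) b⟩ then
    Complex.arg ⟨inner ℝ a b, inner ℝ (perp a) b⟩
  else Complex.arg ⟨inner ℝ a b, inner ℝ (perp a) b⟩ + 2 * Real.pi

/-! ### Anisotropies -/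

/-- An anisotropy: a positively one-homogeneous convex function on the plane, comparable to the
Euclidean norm. -/
structure IsAnisotropy (φ : Plane → ℝ) : Prop where
  convex : ConvexOn ℝ Set.univ φ
  homogeneous : ∀ (r : ℝ) (x : Plane), 0 ≤ r → φ (r • x) = r * φ x
  bounds : ∃ c C : ℝ, 0 < c ∧ c ≤ C ∧ ∀ x : Plane, c * ‖x‖ ≤ φ x ∧ φ x ≤ C * ‖x‖

/-- The Wulff shape `{φ ≤ 1}`. -/
def wulff (φ : Plane → ℝ) : Set Plane := {x | φ x ≤ 1}

/-- The anisotropy is crystalline if its Wulff shape is a (convex) polygon. -/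
structure IsCrystalline (φ : Plane → ℝ) : Prop where
  anisotropy : IsAnisotropy φ
  polygon : ∃ s : Finset Plane, wulff φ = convexHull ℝ (s : Set Plane)

/-- The dual anisotropy `φᵒ(x) = max {⟨x, y⟩ : y ∈ W}`. -/
def dual (φ : Plane → ℝ) (x : Plane) : ℝ :=
  sSup ((fun y : Plane => inner ℝ x y) '' wulff φ)

/-- The face of the Wulff shape with outer normal `ν`. -/
def face (φ : Plane → ℝ) (ν : Plane) : Set Plane :=
  {y | y ∈ wulff φ ∧ inner ℝ ν y = dual φ ν}

/-- The unit vector `ν` is the outer unit normal of a facet, that is, of a nondegenerate boundary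
segment of the Wulff shape; the facet is then `face φ ν`. -/
def IsFacetNormal (φ : Plane → ℝ) (ν : Plane) : Prop :=
  ‖ν‖ = 1 ∧ (face φ ν).Nontrivial

/-- `ν₁` and `ν₂` are the outer unit normals of two different facets with a common vertex. -/
def AdjacentFacets (φ : Plane → ℝ) (ν₁ ν₂ : Plane) : Prop :=
  IsFacetNormal φ ν₁ ∧ IsFacetNormal φ ν₂ ∧ ν₁ ≠ ν₂ ∧ (face φ ν₁ ∩ face φ ν₂).Nonempty

/-- The length of the facet with normal `ν` (a segment, so that its length is its diameter). -/
def facetLength (φ : Plane → ℝ) (ν : Plane) : ℝ := Metric.diam (face φ ν)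

/-! ### Closed polygonal curves -/

/-- A closed oriented polygonal curve with `n` consecutive nondegenerate segments, possibly with
self-intersections. Its vertices are labelled by the integers, periodically with period `n`; the
segment `S i` goes from `vertex i` to `vertex (i + 1)`. -/
structure ClosedPolygon where
  n : ℕ
  n_pos : 0 < n
  vertex : ℤ → Plane
  periodic : ∀ i : ℤ, vertex (i + n) = vertex i
  nondegenerate : ∀ i : ℤ, vertex i ≠ vertex (i + 1)

namespace ClosedPolygon

/-- Two labelled polygons are the same closed curve if they differ by a shift of the labels. -/
def SameCurve (P Q : ClosedPolygon) : Prop :=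
  P.n = Q.n ∧ ∃ k : ℤ, ∀ i : ℤ, P.vertex i = Q.vertex (i + k)

/-- The set of points of the curve. -/
def trace (P : ClosedPolygon) : Set Plane :=
  ⋃ i : ℤ, segment ℝ (P.vertex i) (P.vertex (i + 1))

/-- The piecewise affine `n`-periodic parametrization, which is at `vertex i` at time `i`. -/
def path (P : ClosedPolygon) (x : ℝ) : Plane :=
  AffineMap.lineMap (P.vertex ⌊x⌋) (P.vertex (⌊x⌋ + 1)) (Int.fract x)

/-- The length of the segment `S i`. -/
def length (P : ClosedPolygon) (i : ℤ) : ℝ := dist (P.vertex i) (P.vertex (i + 1))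

/-- The unit tangent of the segment `S i`. -/
def tangent (P : ClosedPolygon) (i : ℤ) : Plane :=
  (P.length i)⁻¹ • (P.vertex (i + 1) - P.vertex i)

/-- The unit normal of the segment `S i`. -/
def normal (P : ClosedPolygon) (i : ℤ) : Plane := perp (P.tangent i)

/-- The angle `θ i` between `S (i - 1)` and `S i` at `vertex i`, measured on the side of the
normals: it is in `(0, π)` if the curve turns towards its normals at `vertex i`, and in `(π, 2π)`
if it turns away from them. -/
def angle (P : ClosedPolygon) (i : ℤ) : ℝ := ccwAngle (P.tangent i) (-P.tangent (i - 1))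

/-- The transition number of `S i`: `1` if the curve is convex around `S i` (as the Wulff shape with
its outer normals is), `-1` if it is concave around `S i`, and `0` otherwise. -/
def transition (P : ClosedPolygon) (i : ℤ) : ℝ :=
  if Real.pi < P.angle i ∧ Real.pi < P.angle (i + 1) then 1
  else if P.angle i < Real.pi ∧ P.angle (i + 1) < Real.pi then -1
  else 0

/-- Parallel polygons: the same number of segments, which are parallel with the same orientation. -/
def Parallel (P Q : ClosedPolygon) : Prop :=
  P.n = Q.n ∧ ∀ i : ℤ, P.normal i = Q.normal i

/-- The signed height from the segment `S i` of `P` to the segment `S i` of a polygon `Q` parallel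
to `P`: the oriented distance, along the normal, between the lines that contain them. -/
def signedHeight (P Q : ClosedPolygon) (i : ℤ) : ℝ :=
  inner ℝ (Q.vertex i - P.vertex i) (P.normal i)

/-- Admissibility: the normals of consecutive segments are the normals of two adjacent facets of
the Wulff shape. -/
def IsAdmissible (φ : Plane → ℝ) (P : ClosedPolygon) : Prop :=
  ∀ i : ℤ, AdjacentFacets φ (P.normal (i - 1)) (P.normal i)

/-- The value at `vertex i` of the minimal Cahn-Hoffman field of an admissible polygon: the common
vertex of the facets that correspond to `S (i - 1)` and `S i`. (The field is interpolated linearly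
along the segments.) -/
def cahnHoffman (φ : Plane → ℝ) (P : ClosedPolygon) (i : ℤ) : Plane :=
  Classical.epsilon fun y => y ∈ face φ (P.normal (i - 1)) ∩ face φ (P.normal i)

/-- The crystalline curvature on `S i`: the tangential divergence of the minimal Cahn-Hoffman
field. -/
def curvature (φ : Plane → ℝ) (P : ClosedPolygon) (i : ℤ) : ℝ :=
  inner ℝ (P.cahnHoffman φ (i + 1) - P.cahnHoffman φ i) (P.tangent i) / P.length i

/-- The angle in `(-π, π]` by which the Cahn-Hoffman field turns around the origin, positive if
counterclockwise, while it runs along `S i`. Its values along `S i` fill a facet or a single vertex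
of the Wulff shape, which has the origin in its interior. -/
def turning (φ : Plane → ℝ) (P : ClosedPolygon) (i : ℤ) : ℝ :=
  Complex.arg ⟨inner ℝ (P.cahnHoffman φ i) (P.cahnHoffman φ (i + 1)),
    inner ℝ (perp (P.cahnHoffman φ i)) (P.cahnHoffman φ (i + 1))⟩

/-- The index: the signed number of complete turns of the Cahn-Hoffman field around the boundary of
the Wulff shape. -/
def index (φ : Plane → ℝ) (P : ClosedPolygon) : ℝ :=
  (∑ i ∈ Finset.range P.n, P.turning φ (i : ℤ)) / (2 * Real.pi)

/-! ### The crystalline elastic flow -/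

/-- `δ i = H¹(F i)² φᵒ(ν i)`. -/
def delta (φ : Plane → ℝ) (P : ClosedPolygon) (i : ℤ) : ℝ :=
  facetLength φ (P.normal i) ^ 2 * dual φ (P.normal i)

/-- The normal velocity that the elastic flow prescribes for the segment `S i`. -/
def velocity (φ : Plane → ℝ) (α : ℝ) (P : ClosedPolygon) (i : ℤ) : ℝ :=
  dual φ (P.normal i) *
    (-(P.transition i * facetLength φ (P.normal i) / P.length i) -
      α / P.length i *
        (P.transition (i - 1) ^ 2 * P.delta φ (i - 1) /
            (P.length (i - 1) ^ 2 * Real.sin (P.angle i)) +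
          P.transition i ^ 2 * P.delta φ i *
            (Real.cot (P.angle i) + Real.cot (P.angle (i + 1))) / P.length i ^ 2 +
          P.transition (i + 1) ^ 2 * P.delta φ (i + 1) /
            (P.length (i + 1) ^ 2 * Real.sin (P.angle (i + 1)))))

/-- `Γ`, restricted to `[0, T)`, is a crystalline elastic flow starting from `Γ₀`. -/
structure IsElasticFlow (φ : Plane → ℝ) (α : ℝ) (Γ₀ : ClosedPolygon) (T : EReal)
    (Γ : ℝ → ClosedPolygon) : Prop where
  pos : 0 < T
  parallel : ∀ t : ℝ, 0 ≤ t → (t : EReal) < T → Parallel Γ₀ (Γ t)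
  continuousOn : ∀ i : ℤ,
    ContinuousOn (fun t => signedHeight Γ₀ (Γ t) i) {t : ℝ | 0 ≤ t ∧ (t : EReal) < T}
  contDiffOn : ∀ i : ℤ,
    ContDiffOn ℝ 1 (fun t => signedHeight Γ₀ (Γ t) i) {t : ℝ | 0 < t ∧ (t : EReal) < T}
  initial : ∀ i : ℤ, signedHeight Γ₀ (Γ 0) i = 0
  ode : ∀ (i : ℤ) (t : ℝ), 0 < t → (t : EReal) < T →
    HasDerivAt (fun s => signedHeight Γ₀ (Γ s) i) ((Γ t).velocity φ α i) t

/-- A maximal crystalline elastic flow: it cannot be extended to a longer time interval. -/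
def IsMaximalElasticFlow (φ : Plane → ℝ) (α : ℝ) (Γ₀ : ClosedPolygon) (T : EReal)
    (Γ : ℝ → ClosedPolygon) : Prop :=
  IsElasticFlow φ α Γ₀ T Γ ∧
    ∀ (T' : EReal) (Γ' : ℝ → ClosedPolygon), IsElasticFlow φ α Γ₀ T' Γ' →
      (∀ t : ℝ, 0 ≤ t → (t : EReal) < T → Γ' t = Γ t) → T' ≤ T

/-- The unique maximal flow: it is maximal, and every flow with the same initial curve is a
restriction of it. -/
def IsUniqueMaximalElasticFlow (φ : Plane → ℝ) (α : ℝ) (Γ₀ : ClosedPolygon) (T : EReal)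
    (Γ : ℝ → ClosedPolygon) : Prop :=
  IsMaximalElasticFlow φ α Γ₀ T Γ ∧
    ∀ (T' : EReal) (Γ' : ℝ → ClosedPolygon), IsElasticFlow φ α Γ₀ T' Γ' →
      T' ≤ T ∧ ∀ t : ℝ, 0 ≤ t → (t : EReal) < T' → Γ' t = Γ t

/-! ### Kuratowski continuity and restarted flows -/

/-- Kuratowski convergence of the sets `A t` to `B` along the filter `l`: `B` contains the upper
limit and is contained in the lower limit. -/
def KuratowskiTendsto (A : ℝ → Set Plane) (l : Filter ℝ) (B : Set Plane) : Prop :=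
  (∀ x : Plane, (∀ ε > 0, ∃ᶠ t in l, ∃ y ∈ A t, dist y x < ε) → x ∈ B) ∧
    ∀ x ∈ B, ∀ ε > 0, ∀ᶠ t in l, ∃ y ∈ A t, dist y x < ε

/-- `P` and `Q` have parametrizations as closed oriented curves with uniform distance less than
`ε`. The reparametrization `ρ` winds once around; it is allowed to be constant on intervals. -/
def UniformlyClose (ε : ℝ) (P Q : ClosedPolygon) : Prop :=
  ∃ ρ : ℝ → ℝ, Continuous ρ ∧ Monotone ρ ∧ (∀ x, ρ (x + P.n) = ρ x + Q.n) ∧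
    ∀ x, dist (P.path x) (Q.path (ρ x)) < ε

/-- Kuratowski continuity in `[0, ∞)` of a family of closed curves: the sets of points of the
curves depend continuously on time in the sense of Kuratowski and, as the set of points of a curve
with self-intersections does not determine the order in which the curve runs through it, so do
the curves themselves, up to reparametrization. -/
def KuratowskiContinuous (Γ : ℝ → ClosedPolygon) : Prop :=
  ∀ s : ℝ, 0 ≤ s →
    KuratowskiTendsto (fun t => (Γ t).trace) (𝓝[Set.Ici 0] s) (Γ s).trace ∧
      ∀ ε > 0, ∀ᶠ t in 𝓝[Set.Ici 0] s, UniformlyClose ε (Γ t) (Γ s)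

/-- `Γ` is a Kuratowski continuous family of admissible closed curves in `[0, ∞)` that starts from
`Γ₀`, with `0 = T 0 < T 1 < ... < T m < T (m + 1) = ∞`, and `Γ` is, up to the translation of time,
a maximal elastic flow starting from `Γ (T i)` on each of the intervals `[T i, T (i + 1))`. -/
structure IsRestartedFlow (φ : Plane → ℝ) (α : ℝ) (Γ₀ : ClosedPolygon) (m : ℕ) (T : ℕ → EReal)
    (Γ : ℝ → ClosedPolygon) : Prop where
  time_zero : T 0 = 0
  time_lt : ∀ i ≤ m, T i < T (i + 1)
  time_last : T (m + 1) = ⊤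
  initial : SameCurve (Γ 0) Γ₀
  admissible : ∀ t : ℝ, 0 ≤ t → (Γ t).IsAdmissible φ
  continuous : KuratowskiContinuous Γ
  maximal : ∀ i ≤ m, IsMaximalElasticFlow φ α (Γ (T i).toReal) (T (i + 1) - T i)
    (fun s => Γ ((T i).toReal + s))

end ClosedPolygon

end

/-!
The elastic flow is an ordinary differential equation for the signed heights. A polygon parallel to
`P` is determined by its heights `h` relative to `P`, and its lengths are `|S i| - A h i` with the
operator `A = P.lengthLoss`, which is symmetric on periodic sequences. The right-hand side is a smooth
function of the heights as long as the lengths are positive, so that there is a unique maximal flow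
(`exists_isUniqueMaximalElasticFlow`), and at a finite maximal time not all heights can converge with
positive limit lengths.

The differences of the Cahn-Hoffman field are `A` applied to `φᵒ(ν i)`. With the symmetry of `A`, the
flow is therefore the gradient flow of the energy `∑ (φᵒ(ν i) |S i| + α c i ^ 2 δ i / |S i|)`
(`IsAdmissible.hasDerivAt_energy`). Since the energy does not increase, the segments of nonzero
curvature cannot become short, and since the dissipation is integrable in time, their heights
converge. Where the curvature vanishes, the neighbours of `S i` are parallel, so that the length of
`S i` depends on their two heights only, and the part of their velocities that the energy does not
control shortens `S i`. As the length is positive, its total variation is finite, and the length of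
`S i` and the heights of its neighbours converge (`IsElasticFlow.exists_tendsto_of_transition_eq_zero`).
Hence at a finite maximal time some segment of zero curvature vanishes
(`IsUniqueMaximalElasticFlow.exists_tendsto_length_zero`).

The only heights that may fail to converge belong to vanishing segments between non-vanishing ones,
and they have no influence on the limit. In a run of vanishing segments the normals alternate between
two values, so that its two non-vanishing neighbours are either parallel, and merge into one segment, or
have the normals of adjacent facets. The limit is thus an admissible polygon with fewer segments
(`IsUniqueMaximalElasticFlow.exists_limit_polygon`). It has the same index, because along the merged
segments the Cahn-Hoffman field stays in one facet, which lies in an open half plane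
(`IsMerging.index_eq`). Restarting the flow from the limit, one needs fewer than `n` restarts
(`IsAdmissible.exists_restartedFlow`).

For the uniqueness (`IsRestartedFlow.unique`), the maximal flows agree up to labels as long as their
initial curves do, and so do their limits at the next restarting time: uniform limits up to
reparametrization are unique among polygons whose angles are different from `π`
(`sameCurve_of_uniformlyClose`), because the reparametrizations have a limit point by compactness,
which maps corners to corners.
-/

noncomputable section

/-! ### Maximal solutions of autonomous differential equations -/

section AutonomousODE

variable {E : Type*} [NormedAddCommGroup E] [NormedSpace ℝ E]

/-- `x`, restricted to `[0, T)`, solves `x' = V x` with values in `U`, starting from `x₀`. At the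
time `0` only continuity is required. -/
structure IsForwardSolution (V : E → E) (U : Set E) (x₀ : E) (T : EReal) (x : ℝ → E) : Prop where
  pos : 0 < T
  initial : x 0 = x₀
  continuousOn : ContinuousOn x {t : ℝ | 0 ≤ t ∧ (t : EReal) < T}
  mem : ∀ t : ℝ, 0 ≤ t → (t : EReal) < T → x t ∈ U
  deriv : ∀ t : ℝ, 0 < t → (t : EReal) < T → HasDerivAt x (V (x t)) t

variable {V : E → E} {U : Set E} {x₀ : E} {T T' : EReal} {x y : ℝ → E}

lemma IsForwardSolution.hasDerivWithinAt_Ici (hV : ∀ z ∈ U, ContDiffAt ℝ 1 V z)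
    (hx : IsForwardSolution V U x₀ T x) {t : ℝ} (h0 : 0 ≤ t) (hT : (t : EReal) < T) :
    HasDerivWithinAt x (V (x t)) (Set.Ici t) t := by
  rcases h0.eq_or_lt with rfl | h0
  · obtain ⟨r, hr0, hrT⟩ := EReal.lt_iff_exists_real_btwn.1 hT
    have hr0' : (0 : ℝ) < r := by exact_mod_cast hr0
    have hlt : ∀ s ∈ Set.Ioo 0 r, (s : EReal) < T := fun s hs =>
      lt_trans (by exact_mod_cast hs.2) hrT
    have hcont : ContinuousWithinAt x (Set.Ioo 0 r) 0 :=
      (hx.continuousOn 0 ⟨le_rfl, hT⟩).mono fun s hs => ⟨hs.1.le, hlt s hs⟩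
    have hmem : Set.Ioo 0 r ∈ 𝓝[>] (0 : ℝ) := Ioo_mem_nhdsGT hr0'
    refine hasDerivWithinAt_Ici_of_tendsto_deriv
      (fun s hs => (hx.deriv s hs.1 (hlt s hs)).differentiableAt.differentiableWithinAt)
      hcont hmem ?_
    have h1 : Tendsto (fun s => V (x s)) (𝓝[>] 0) (𝓝 (V (x 0))) := by
      have := (hV _ (hx.mem 0 le_rfl hT)).continuousAt.tendsto.comp hcont.tendsto
      rwa [nhdsWithin_Ioo_eq_nhdsGT hr0'] at this
    refine h1.congr' ?_
    filter_upwards [hmem] with s hs using (hx.deriv s hs.1 (hlt s hs)).deriv.symm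
  · exact (hx.deriv t h0 hT).hasDerivWithinAt

lemma IsForwardSolution.eqOn (hV : ∀ z ∈ U, ContDiffAt ℝ 1 V z)
    (hx : IsForwardSolution V U x₀ T x) (hy : IsForwardSolution V U x₀ T' y)
    {t : ℝ} (h0 : 0 ≤ t) (hT : (t : EReal) < T) (hT' : (t : EReal) < T') : x t = y t := by
  have hlt : ∀ s ∈ Set.Icc 0 t, (s : EReal) < T := fun s hs =>
    lt_of_le_of_lt (by exact_mod_cast hs.2) hT
  have hlt' : ∀ s ∈ Set.Icc 0 t, (s : EReal) < T' := fun s hs =>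
    lt_of_le_of_lt (by exact_mod_cast hs.2) hT'
  have hxc : ContinuousOn x (Set.Icc 0 t) := hx.continuousOn.mono fun s hs => ⟨hs.1, hlt s hs⟩
  have hyc : ContinuousOn y (Set.Icc 0 t) := hy.continuousOn.mono fun s hs => ⟨hs.1, hlt' s hs⟩
  -- `V` is Lipschitz on the compact set swept by the two solutions.
  set K : Set E := x '' Set.Icc 0 t ∪ y '' Set.Icc 0 t with hK
  have hKc : IsCompact K := (isCompact_Icc.image_of_continuousOn hxc).union
    (isCompact_Icc.image_of_continuousOn hyc)
  have hKU : K ⊆ U := by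
    rintro z (⟨s, hs, rfl⟩ | ⟨s, hs, rfl⟩)
    exacts [hx.mem s hs.1 (hlt s hs), hy.mem s hs.1 (hlt' s hs)]
  obtain ⟨L, hL⟩ := LocallyLipschitzOn.exists_lipschitzOnWith_of_compact (f := V) hKc (by
    intro z hz
    obtain ⟨L, s, hs, hl⟩ := (hV z (hKU hz)).exists_lipschitzOnWith
    exact ⟨L, s, mem_nhdsWithin_of_mem_nhds hs, hl⟩)
  have hsub : Set.Ico 0 t ⊆ Set.Icc 0 t := Set.Ico_subset_Icc_self
  exact ODE_solution_unique_of_mem_Icc_right (v := fun _ => V) (s := fun _ => K) (K := L)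
    (fun _ _ => hL) hxc
    (fun s hs => hx.hasDerivWithinAt_Ici hV hs.1 (hlt s (hsub hs)))
    (fun s hs => Or.inl ⟨s, hsub hs, rfl⟩) hyc
    (fun s hs => hy.hasDerivWithinAt_Ici hV hs.1 (hlt' s (hsub hs)))
    (fun s hs => Or.inr ⟨s, hsub hs, rfl⟩) (hx.initial.trans hy.initial.symm) ⟨h0, le_rfl⟩

lemma exists_local_solution [CompleteSpace E] (hU : IsOpen U) {z : E} (hz : z ∈ U)
    (hV : ∀ z ∈ U, ContDiffAt ℝ 1 V z) (t₀ : ℝ) :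
    ∃ ε > 0, ∃ y : ℝ → E, y t₀ = z ∧ ∀ t ∈ Set.Ioo (t₀ - ε) (t₀ + ε),
      y t ∈ U ∧ HasDerivAt y (V (y t)) t := by
  obtain ⟨y, hy0, ε, hε, hy⟩ :=
    (hV z hz).exists_forall_mem_closedBall_exists_eq_forall_mem_Ioo_hasDerivAt₀ t₀
  have hc : ContinuousAt y t₀ := (hy t₀ ⟨by linarith, by linarith⟩).continuousAt
  have := hc.preimage_mem_nhds (hU.mem_nhds (by rw [hy0]; exact hz))
  obtain ⟨δ, hδ, hb⟩ := Metric.mem_nhds_iff.1 this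
  refine ⟨min ε δ, lt_min hε hδ, y, hy0, fun t ht => ⟨hb ?_, hy t ?_⟩⟩
  · rw [Real.ball_eq_Ioo]
    exact ⟨by linarith [ht.1, min_le_right ε δ], by linarith [ht.2, min_le_right ε δ]⟩
  · exact ⟨by linarith [ht.1, min_le_left ε δ], by linarith [ht.2, min_le_left ε δ]⟩

/-- The solution on the union of all intervals of existence. -/
lemma exists_maximal_solution [CompleteSpace E] (hU : IsOpen U) (hx₀ : x₀ ∈ U)
    (hV : ∀ z ∈ U, ContDiffAt ℝ 1 V z) :
    ∃ T x, IsForwardSolution V U x₀ T x ∧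
      ∀ T' x', IsForwardSolution V U x₀ T' x' → T' ≤ T := by
  set S : Set EReal := {T | ∃ x, IsForwardSolution V U x₀ T x}
  have hlocal : ∃ T ∈ S, 0 < T := by
    obtain ⟨ε, hε, y, hy0, hy⟩ := exists_local_solution hU hx₀ hV 0
    have h : ∀ t : ℝ, 0 ≤ t → (t : EReal) < ε → t ∈ Set.Ioo (0 - ε) (0 + ε) := fun t h0 ht =>
      ⟨by linarith, by simpa using (by exact_mod_cast ht : t < ε)⟩
    refine ⟨ε, ⟨y, ⟨by exact_mod_cast hε, hy0, fun t ht => ?_, fun t h0 ht => (hy t (h t h0 ht)).1,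
      fun t h0 ht => (hy t (h t h0.le ht)).2⟩⟩, by exact_mod_cast hε⟩
    exact (hy t (h t ht.1 ht.2)).2.continuousAt.continuousWithinAt
  have hex : ∀ t : ℝ, (t : EReal) < sSup S → ∃ T x,
      (t : EReal) < T ∧ IsForwardSolution V U x₀ T x :=
    fun t ht => by
      obtain ⟨T, ⟨x, hx⟩, hT⟩ := lt_sSup_iff.1 ht
      exact ⟨T, x, hT, hx⟩
  classical
  set z : ℝ → E := fun t => if h : (t : EReal) < sSup S then (hex t h).choose_spec.choose t else x₀
  -- Locally, `z` is one of the solutions.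
  have hz : ∀ T x, IsForwardSolution V U x₀ T x → ∀ t : ℝ, 0 ≤ t → (t : EReal) < T → z t = x t := by
    intro T x hx t h0 hT
    have h : (t : EReal) < sSup S := hT.trans_le (le_sSup ⟨x, hx⟩)
    obtain ⟨h1, h2⟩ := (hex t h).choose_spec.choose_spec
    simp only [z, h, dite_true]
    exact h2.eqOn hV hx h0 h1 hT
  refine ⟨sSup S, z, ⟨?_, ?_, ?_, ?_, ?_⟩, fun T' x' h => le_sSup ⟨x', h⟩⟩
  · obtain ⟨T, hT, h0⟩ := hlocal
    exact h0.trans_le (le_sSup hT)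
  · obtain ⟨T, ⟨x, hx⟩, h0⟩ := hlocal
    rw [hz T x hx 0 le_rfl (by exact_mod_cast h0), hx.initial]
  · rintro t ⟨h0, ht⟩
    obtain ⟨T, x, hT, hx⟩ := hex t ht
    have hc := hx.continuousOn t ⟨h0, hT⟩
    have hopen : {s : ℝ | (s : EReal) < T} ∈ 𝓝 t :=
      (isOpen_lt continuous_coe_real_ereal continuous_const).mem_nhds hT
    refine (hc.congr (fun s hs => hz T x hx s hs.1 hs.2) (hz T x hx t h0 hT)).mono_of_mem_nhdsWithin
      ?_
    filter_upwards [self_mem_nhdsWithin, mem_nhdsWithin_of_mem_nhds hopen] with s hs hs'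
      using ⟨hs.1, hs'⟩
  · intro t h0 ht
    obtain ⟨T, x, hT, hx⟩ := hex t ht
    rw [hz T x hx t h0 hT]
    exact hx.mem t h0 hT
  · intro t h0 ht
    obtain ⟨T, x, hT, hx⟩ := hex t ht
    rw [hz T x hx t h0.le hT]
    refine (hx.deriv t h0 hT).congr_of_eventuallyEq ?_
    filter_upwards [(isOpen_lt continuous_coe_real_ereal continuous_const).mem_nhds hT,
      Ioi_mem_nhds h0] with s hs hs' using hz T x hx s hs'.le hs

/-- A solution that converges inside `U` can be continued. -/
lemma IsForwardSolution.exists_extension [CompleteSpace E] (hU : IsOpen U)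
    (hV : ∀ z ∈ U, ContDiffAt ℝ 1 V z) {T : ℝ} (hx : IsForwardSolution V U x₀ T x) {z : E}
    (hz : z ∈ U) (hlim : Tendsto x (𝓝[<] T) (𝓝 z)) :
    ∃ T' : ℝ, T < T' ∧ ∃ y, IsForwardSolution V U x₀ T' y := by
  obtain ⟨ε, hε, y, hy0, hy⟩ := exists_local_solution hU hz hV T
  have hT : 0 < T := by exact_mod_cast hx.pos
  set w : ℝ → E := fun t => if t < T then x t else y t
  have hwx : ∀ t, t < T → w t = x t := fun t h => if_pos h
  have hwy : ∀ t, T ≤ t → w t = y t := fun t h => if_neg h.not_gt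
  have hlt : ∀ t, t < T → (t : EReal) < (T : EReal) := fun t h => by exact_mod_cast h
  have hder : ∀ t : ℝ, 0 < t → t < T + ε → HasDerivAt w (V (w t)) t := by
    intro t h0 ht
    rcases lt_trichotomy t T with h | h | h
    · rw [hwx t h]
      refine (hx.deriv t h0 (hlt t h)).congr_of_eventuallyEq ?_
      filter_upwards [Iio_mem_nhds h] with s hs using hwx s hs
    · subst h
      rw [hwy t le_rfl]
      have hright : HasDerivWithinAt w (V (y t)) (Set.Ici t) t :=
        (hy t ⟨by linarith, by linarith⟩).2.hasDerivWithinAt.congr (fun s hs => hwy s hs)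
          (hwy t le_rfl)
      -- The left derivative is the limit of the derivative.
      have hleft : HasDerivWithinAt w (V (y t)) (Set.Iic t) t := by
        have hmem : Set.Ioo 0 t ∈ 𝓝[<] t := Ioo_mem_nhdsLT h0
        have heq : ∀ s ∈ Set.Ioo 0 t, w =ᶠ[𝓝 s] x := fun s hs => by
          filter_upwards [Iio_mem_nhds hs.2] with r hr using hwx r hr
        refine hasDerivWithinAt_Iic_of_tendsto_deriv (s := Set.Ioo 0 t) (fun s hs => ?_) ?_ hmem ?_
        · exact ((hx.deriv s hs.1 (hlt s hs.2)).congr_of_eventuallyEq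
            (heq s hs)).differentiableAt.differentiableWithinAt
        · rw [ContinuousWithinAt, hwy t le_rfl, hy0, nhdsWithin_Ioo_eq_nhdsLT h0]
          refine hlim.congr' ?_
          filter_upwards [self_mem_nhdsWithin] with s hs using (hwx s hs).symm
        · rw [hy0]
          refine ((hV z hz).continuousAt.tendsto.comp hlim).congr' ?_
          filter_upwards [hmem] with s hs
          rw [(heq s hs).deriv_eq, (hx.deriv s hs.1 (hlt s hs.2)).deriv]
          rfl
      have := hleft.union hright
      rwa [Set.Iic_union_Ici, hasDerivWithinAt_univ] at this
    · rw [hwy t h.le]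
      refine (hy t ⟨by linarith, ht⟩).2.congr_of_eventuallyEq ?_
      filter_upwards [Ioi_mem_nhds h] with s hs using hwy s (le_of_lt hs)
  refine ⟨T + ε, by linarith, w, ⟨?_, ?_, ?_, ?_, ?_⟩⟩
  · exact_mod_cast (by linarith : 0 < T + ε)
  · rw [hwx 0 hT, hx.initial]
  · rintro t ⟨h0, ht⟩
    have ht' : t < T + ε := by exact_mod_cast ht
    rcases h0.eq_or_lt with rfl | h0
    · have hc := hx.continuousOn 0 ⟨le_rfl, hlt 0 hT⟩
      refine (hc.congr_of_eventuallyEq (g := w) ?_ (hwx 0 hT)).mono_of_mem_nhdsWithin ?_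
      · filter_upwards [self_mem_nhdsWithin] with s hs using hwx s (by exact_mod_cast hs.2)
      · filter_upwards [self_mem_nhdsWithin,
          mem_nhdsWithin_of_mem_nhds (Iio_mem_nhds hT)] with s hs hs'
          using ⟨hs.1, hlt s hs'⟩
    · exact (hder t h0 ht').continuousAt.continuousWithinAt
  · intro t h0 ht
    rcases lt_or_ge t T with h | h
    · rw [hwx t h]; exact hx.mem t h0 (hlt t h)
    · rw [hwy t h]; exact (hy t ⟨by linarith, by exact_mod_cast ht⟩).1
  · exact fun t h0 ht => hder t h0 (by exact_mod_cast ht)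

end AutonomousODE

/-- Bounded variation in differential form: if `|f'| ≤ -M'` and `M` is bounded below, then `f`
converges. -/
lemma exists_tendsto_of_abs_deriv_le {a b : ℝ} (hab : a < b) {f M f' M' : ℝ → ℝ}
    (hf : ∀ t ∈ Set.Ioo a b, HasDerivAt f (f' t) t) (hM : ∀ t ∈ Set.Ioo a b, HasDerivAt M (M' t) t)
    (hle : ∀ t ∈ Set.Ioo a b, |f' t| ≤ -M' t) {m : ℝ} (hm : ∀ t ∈ Set.Ioo a b, m ≤ M t) :
    ∃ l, Tendsto f (𝓝[<] b) (𝓝 l) := by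
  have key : ∀ g g' : ℝ → ℝ, (∀ t ∈ Set.Ioo a b, HasDerivAt g (g' t) t) →
      (∀ t ∈ Set.Ioo a b, g' t ≤ 0) → AntitoneOn g (Set.Ioo a b) := fun g g' h h' =>
    antitoneOn_of_deriv_nonpos (convex_Ioo a b)
      (fun t ht => (h t ht).continuousAt.continuousWithinAt)
      (fun t ht => (h t (interior_subset ht)).differentiableAt.differentiableWithinAt)
      (fun t ht => by rw [(h t (interior_subset ht)).deriv]; exact h' t (interior_subset ht))
  have h1 : AntitoneOn (M + f) (Set.Ioo a b) := key (M + f) _ (fun t ht => (hM t ht).add (hf t ht))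
    fun t ht => by linarith [hle t ht, le_abs_self (f' t)]
  have h2 : AntitoneOn (M - f) (Set.Ioo a b) := key (M - f) _ (fun t ht => (hM t ht).sub (hf t ht))
    fun t ht => by linarith [hle t ht, neg_abs_le (f' t)]
  set c := (a + b) / 2 with hc
  have hcm : c ∈ Set.Ioo a b := ⟨by linarith, by linarith⟩
  have conv : ∀ g : ℝ → ℝ, AntitoneOn g (Set.Ioo a b) → (∃ B, ∀ t ∈ Set.Ico c b, B ≤ g t) →
      ∃ l, Tendsto g (𝓝[<] b) (𝓝 l) := by
    rintro g hg ⟨B, hB⟩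
    -- Extended by its value at `c`, the function is antitone on `(-∞, b)`.
    have hanti : AntitoneOn (fun t => g (max t c)) (Set.Iio b) := fun s hs t ht hst =>
      hg ⟨lt_max_of_lt_right hcm.1, max_lt hs hcm.2⟩ ⟨lt_max_of_lt_right hcm.1, max_lt ht hcm.2⟩
        (max_le_max_right c hst)
    have := hanti.tendsto_nhdsLT (x := b) ⟨B, by
      rintro _ ⟨t, ht, rfl⟩
      exact hB _ ⟨le_max_right _ _, max_lt ht hcm.2⟩⟩
    refine ⟨_, this.congr' ?_⟩
    filter_upwards [Ioo_mem_nhdsLT hcm.2] with t ht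
    rw [max_eq_left ht.1.le]
  have hsub : ∀ t ∈ Set.Ico c b, t ∈ Set.Ioo a b := fun t ht => ⟨hcm.1.trans_le ht.1, ht.2⟩
  obtain ⟨l₁, hl₁⟩ := conv (M + f) h1 ⟨2 * m - (M - f) c, fun t ht => by
    have := h2 hcm (hsub t ht) ht.1
    have := hm t (hsub t ht)
    simp only [Pi.sub_apply, Pi.add_apply] at *
    linarith⟩
  obtain ⟨l₂, hl₂⟩ := conv (M - f) h2 ⟨2 * m - (M + f) c, fun t ht => by
    have := h1 hcm (hsub t ht) ht.1
    have := hm t (hsub t ht)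
    simp only [Pi.sub_apply, Pi.add_apply] at *
    linarith⟩
  refine ⟨(l₁ - l₂) / 2, ((hl₁.sub hl₂).div_const 2).congr fun t => ?_⟩
  simp only [Pi.sub_apply, Pi.add_apply]
  ring

/-! ### Angles and frames in the plane -/

section PlaneGeometry

lemma plane_ext {v w : Plane} (h0 : v 0 = w 0) (h1 : v 1 = w 1) : v = w := by
  ext i; fin_cases i <;> assumption

lemma inner_plane (v w : Plane) : inner ℝ v w = v 0 * w 0 + v 1 * w 1 := by
  simp [PiLp.inner_apply, Fin.sum_univ_two, mul_comm]

@[simp] lemma perp_apply_zero (v : Plane) : perp v 0 = -(v 1) := rfl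

@[simp] lemma perp_apply_one (v : Plane) : perp v 1 = v 0 := rfl

lemma norm_eq_one_iff_coord (v : Plane) : ‖v‖ = 1 ↔ v 0 ^ 2 + v 1 ^ 2 = 1 := by
  rw [← sq_eq_sq₀ (norm_nonneg v) zero_le_one, ← real_inner_self_eq_norm_sq, inner_plane]
  constructor <;> intro h <;> linarith

@[simp] lemma norm_perp (v : Plane) : ‖perp v‖ = ‖v‖ := by
  rw [← sq_eq_sq₀ (norm_nonneg _) (norm_nonneg _), ← real_inner_self_eq_norm_sq,
    ← real_inner_self_eq_norm_sq, inner_plane, inner_plane]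
  simp; ring

lemma perp_injective : Function.Injective perp := fun v w h =>
  plane_ext (by simpa using congrArg (fun u : Plane => u 1) h)
    (by simpa using congrArg (fun u : Plane => u 0) h)

/-- Expansion of a vector in the orthonormal frame `(τ, perp τ)`. -/
lemma eq_smul_add_smul_perp {τ : Plane} (hτ : ‖τ‖ = 1) (v : Plane) :
    v = inner ℝ τ v • τ + inner ℝ (perp τ) v • perp τ := by
  rw [norm_eq_one_iff_coord] at hτ
  apply plane_ext <;> simp [inner_plane] <;> linear_combination (-(v _)) * hτ

lemma norm_complex_inner {a b : Plane} (ha : ‖a‖ = 1) (hb : ‖b‖ = 1) :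
    ‖(⟨inner ℝ a b, inner ℝ (perp a) b⟩ : ℂ)‖ = 1 := by
  rw [norm_eq_one_iff_coord] at ha hb
  rw [← sq_eq_sq₀ (norm_nonneg _) zero_le_one, Complex.sq_norm, Complex.normSq_apply]
  simp only [inner_plane, perp_apply_zero, perp_apply_one]
  linear_combination (b 0 ^ 2 + b 1 ^ 2) * ha + hb

lemma cos_ccwAngle {a b : Plane} (ha : ‖a‖ = 1) (hb : ‖b‖ = 1) :
    Real.cos (ccwAngle a b) = inner ℝ a b := by
  have h := norm_complex_inner ha hb
  have h0 : (⟨inner ℝ a b, inner ℝ (perp a) b⟩ : ℂ) ≠ 0 := by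
    intro h'; rw [h', norm_zero] at h; exact zero_ne_one h
  unfold ccwAngle
  split_ifs
  · rw [Complex.cos_arg h0, h, div_one]
  · rw [Real.cos_add_two_pi, Complex.cos_arg h0, h, div_one]

lemma sin_ccwAngle {a b : Plane} (ha : ‖a‖ = 1) (hb : ‖b‖ = 1) :
    Real.sin (ccwAngle a b) = inner ℝ (perp a) b := by
  have h := norm_complex_inner ha hb
  unfold ccwAngle
  split_ifs
  · rw [Complex.sin_arg, h, div_one]
  · rw [Real.sin_add_two_pi, Complex.sin_arg, h, div_one]

lemma ccwAngle_nonneg (a b : Plane) : 0 ≤ ccwAngle a b := by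
  unfold ccwAngle
  split_ifs with h
  · exact h
  · have := Complex.neg_pi_lt_arg ⟨inner ℝ a b, inner ℝ (perp a) b⟩
    linarith [Real.pi_pos]

lemma ccwAngle_lt_two_pi (a b : Plane) : ccwAngle a b < 2 * Real.pi := by
  unfold ccwAngle
  split_ifs with h
  · have := Complex.arg_le_pi ⟨inner ℝ a b, inner ℝ (perp a) b⟩
    linarith [Real.pi_pos]
  · linarith [not_le.1 h]

lemma pi_lt_ccwAngle_iff {a b : Plane} :
    Real.pi < ccwAngle a b ↔ Real.sin (ccwAngle a b) < 0 := by
  constructor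
  · intro h'
    have := Real.sin_pos_of_pos_of_lt_pi (x := ccwAngle a b - Real.pi) (by linarith)
      (by linarith [ccwAngle_lt_two_pi a b])
    rw [Real.sin_sub_pi] at this
    linarith
  · intro h'
    by_contra hle
    exact absurd (Real.sin_nonneg_of_nonneg_of_le_pi (ccwAngle_nonneg a b) (not_lt.1 hle)) h'.not_ge

lemma ccwAngle_lt_pi_iff {a b : Plane} (h : Real.sin (ccwAngle a b) ≠ 0) :
    ccwAngle a b < Real.pi ↔ 0 < Real.sin (ccwAngle a b) := by
  have hpi : ccwAngle a b ≠ Real.pi := fun h' => h (by rw [h', Real.sin_pi])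
  rw [← not_le, hpi.symm.le_iff_lt, pi_lt_ccwAngle_iff, not_lt]
  exact h.symm.le_iff_lt

end PlaneGeometry

/-! ### Faces of the Wulff shape -/

section Wulff

variable {φ : Plane → ℝ}

lemma IsAnisotropy.isBounded_wulff (hφ : IsAnisotropy φ) : Bornology.IsBounded (wulff φ) := by
  obtain ⟨c, C, hc, -, h⟩ := hφ.bounds
  refine (Metric.isBounded_iff_subset_closedBall 0).2 ⟨1 / c, fun y hy => ?_⟩
  rw [mem_closedBall_zero_iff, le_div_iff₀ hc, mul_comm]
  exact (h y).1.trans hy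

lemma IsAnisotropy.inner_le_dual (hφ : IsAnisotropy φ) (ν : Plane) {y : Plane} (hy : y ∈ wulff φ) :
    inner ℝ ν y ≤ dual φ ν := by
  obtain ⟨r, hr⟩ := hφ.isBounded_wulff.exists_norm_le
  refine le_csSup ⟨‖ν‖ * r, ?_⟩ ⟨y, hy, rfl⟩
  rintro _ ⟨z, hz, rfl⟩
  exact (real_inner_le_norm ν z).trans (mul_le_mul_of_nonneg_left (hr z hz) (norm_nonneg ν))

lemma IsAnisotropy.dual_pos (hφ : IsAnisotropy φ) {ν : Plane} (hν : ‖ν‖ = 1) : 0 < dual φ ν := by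
  obtain ⟨c, C, hc, hcC, h⟩ := hφ.bounds
  have hC : 0 < C := hc.trans_le hcC
  have hy : C⁻¹ • ν ∈ wulff φ := by
    change φ (C⁻¹ • ν) ≤ 1
    rw [hφ.homogeneous _ _ (inv_nonneg.2 hC.le), inv_mul_le_iff₀ hC]
    simpa [hν] using (h ν).2
  refine lt_of_lt_of_le ?_ (hφ.inner_le_dual ν hy)
  rw [real_inner_smul_right, real_inner_self_eq_norm_sq, hν]
  positivity

lemma isBounded_face (hφ : IsAnisotropy φ) (ν : Plane) : Bornology.IsBounded (face φ ν) :=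
  hφ.isBounded_wulff.subset fun _ h => h.1

lemma IsFacetNormal.facetLength_pos (hφ : IsAnisotropy φ) {ν : Plane} (h : IsFacetNormal φ ν) :
    0 < facetLength φ ν := by
  obtain ⟨x, hx, y, hy, hxy⟩ := h.2
  exact (dist_pos.2 hxy).trans_le (Metric.dist_le_diam_of_mem (isBounded_face hφ ν) hx hy)

lemma AdjacentFacets.ne_neg (hφ : IsAnisotropy φ) {ν₁ ν₂ : Plane} (h : AdjacentFacets φ ν₁ ν₂) :
    ν₁ ≠ -ν₂ := by
  rintro rfl
  obtain ⟨y, hy₁, hy₂⟩ := h.2.2.2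
  have h₁ := hφ.dual_pos h.1.1
  have h₂ := hφ.dual_pos h.2.1.1
  rw [← hy₁.2, inner_neg_left] at h₁
  rw [← hy₂.2] at h₂
  linarith

end Wulff

namespace ClosedPolygon

/-! ### Frames along a closed polygon -/

section Frames

variable (P : ClosedPolygon) (i : ℤ)

lemma length_pos : 0 < P.length i := dist_pos.2 (P.nondegenerate i)

lemma vertex_succ : P.vertex (i + 1) = P.vertex i + P.length i • P.tangent i := by
  rw [tangent, smul_smul, mul_inv_cancel₀ (P.length_pos i).ne', one_smul]; abel

@[simp] lemma norm_tangent : ‖P.tangent i‖ = 1 := by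
  rw [tangent, norm_smul, norm_inv, Real.norm_of_nonneg (P.length_pos i).le, length,
    dist_eq_norm', inv_mul_cancel₀]
  exact norm_ne_zero_iff.2 (sub_ne_zero.2 (P.nondegenerate i).symm)

@[simp] lemma norm_normal : ‖P.normal i‖ = 1 := by simp [normal]

lemma length_periodic : P.length (i + P.n) = P.length i := by
  rw [length, length, P.periodic, add_right_comm, P.periodic]

lemma tangent_periodic : P.tangent (i + P.n) = P.tangent i := by
  rw [tangent, tangent, length_periodic, P.periodic, add_right_comm, P.periodic]

lemma normal_periodic : P.normal (i + P.n) = P.normal i := by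
  rw [normal, normal, tangent_periodic]

lemma angle_periodic : P.angle (i + P.n) = P.angle i := by
  rw [angle, angle, tangent_periodic, add_sub_right_comm, tangent_periodic]

lemma transition_periodic : P.transition (i + P.n) = P.transition i := by
  rw [transition, transition, angle_periodic, add_right_comm, angle_periodic]

lemma cos_angle : Real.cos (P.angle i) = -inner ℝ (P.tangent i) (P.tangent (i - 1)) := by
  rw [angle, cos_ccwAngle (by simp) (by simp), inner_neg_right]

lemma sin_angle : Real.sin (P.angle i) = -inner ℝ (P.normal i) (P.tangent (i - 1)) := by
  rw [angle, sin_ccwAngle (by simp) (by simp), inner_neg_right, normal]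

lemma inner_tangent_tangent : inner ℝ (P.tangent i) (P.tangent i) = 1 := by
  rw [real_inner_self_eq_norm_sq, norm_tangent, one_pow]

lemma inner_normal_normal : inner ℝ (P.normal i) (P.normal i) = 1 := by
  rw [real_inner_self_eq_norm_sq, norm_normal, one_pow]

lemma inner_tangent_normal : inner ℝ (P.tangent i) (P.normal i) = 0 := by
  rw [inner_plane, normal, perp_apply_zero, perp_apply_one]; ring

lemma inner_normal_tangent : inner ℝ (P.normal i) (P.tangent i) = 0 := by
  rw [real_inner_comm, inner_tangent_normal]

lemma eq_tangent_add_normal (v : Plane) :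
    v = inner ℝ (P.tangent i) v • P.tangent i + inner ℝ (P.normal i) v • P.normal i :=
  eq_smul_add_smul_perp (P.norm_tangent i) v

lemma tangent_pred : P.tangent (i - 1) =
    -Real.cos (P.angle i) • P.tangent i - Real.sin (P.angle i) • P.normal i := by
  have h := P.eq_tangent_add_normal i (P.tangent (i - 1))
  rw [cos_angle, sin_angle, neg_neg, neg_smul, sub_neg_eq_add]
  exact h

lemma normal_pred : P.normal (i - 1) =
    Real.sin (P.angle i) • P.tangent i - Real.cos (P.angle i) • P.normal i := by
  have h := P.tangent_pred i
  rw [normal, normal, h]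
  apply plane_ext
  · simp [normal]
  · simp [normal]; ring

lemma normal_eq_of_pred : P.normal i =
    -Real.cos (P.angle i) • P.normal (i - 1) - Real.sin (P.angle i) • P.tangent (i - 1) := by
  have h := Real.sin_sq_add_cos_sq (P.angle i)
  rw [P.tangent_pred i, P.normal_pred i]
  apply plane_ext <;> simp <;> linear_combination (-(P.normal i _)) * h

lemma tangent_eq_of_pred : P.tangent i =
    -Real.cos (P.angle i) • P.tangent (i - 1) + Real.sin (P.angle i) • P.normal (i - 1) := by
  have h := Real.sin_sq_add_cos_sq (P.angle i)
  rw [P.tangent_pred i, P.normal_pred i]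
  apply plane_ext <;> simp <;> linear_combination (-(P.tangent i _)) * h

lemma normal_succ : P.normal (i + 1) =
    -Real.cos (P.angle (i + 1)) • P.normal i - Real.sin (P.angle (i + 1)) • P.tangent i := by
  simpa using P.normal_eq_of_pred (i + 1)

lemma tangent_succ : P.tangent (i + 1) =
    -Real.cos (P.angle (i + 1)) • P.tangent i + Real.sin (P.angle (i + 1)) • P.normal i := by
  simpa using P.tangent_eq_of_pred (i + 1)

end Frames

/-! ### Admissible polygons: curvature and transition numbers -/

section Admissible

variable {φ : Plane → ℝ} {P : ClosedPolygon}

lemma IsAdmissible.isFacetNormal (hP : P.IsAdmissible φ) (i : ℤ) : IsFacetNormal φ (P.normal i) :=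
  (hP i).2.1

lemma IsAdmissible.facetLength_pos (hφ : IsAnisotropy φ) (hP : P.IsAdmissible φ) (i : ℤ) :
    0 < facetLength φ (P.normal i) := (hP.isFacetNormal i).facetLength_pos hφ

lemma dual_normal_pos (hφ : IsAnisotropy φ) (P : ClosedPolygon) (i : ℤ) :
    0 < dual φ (P.normal i) := hφ.dual_pos (P.norm_normal i)

lemma IsAdmissible.sin_ne_zero (hφ : IsAnisotropy φ) (hP : P.IsAdmissible φ) (i : ℤ) :
    Real.sin (P.angle i) ≠ 0 := by
  intro hs
  have h := Real.sin_sq_add_cos_sq (P.angle i)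
  have hν := P.normal_pred i
  rw [hs, zero_smul, zero_sub] at hν
  rw [hs] at h
  rcases sq_eq_one_iff.1 (by linarith : Real.cos (P.angle i) ^ 2 = 1) with hc | hc
  · rw [hc, one_smul] at hν
    exact (hP i).ne_neg hφ hν
  · rw [hc, neg_smul, one_smul, neg_neg] at hν
    exact (hP i).2.2.1 hν

lemma transition_eq (hs : ∀ i, Real.sin (P.angle i) ≠ 0) (i : ℤ) : P.transition i =
    if Real.sin (P.angle i) < 0 ∧ Real.sin (P.angle (i + 1)) < 0 then 1
    else if 0 < Real.sin (P.angle i) ∧ 0 < Real.sin (P.angle (i + 1)) then -1 else 0 := by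
  have h1 : ∀ i, Real.pi < P.angle i ↔ Real.sin (P.angle i) < 0 := fun i =>
    pi_lt_ccwAngle_iff
  have h2 : ∀ i, P.angle i < Real.pi ↔ 0 < Real.sin (P.angle i) := fun i =>
    ccwAngle_lt_pi_iff (hs i)
  simp only [transition, h1, h2]

lemma IsAdmissible.cahnHoffman_mem (hP : P.IsAdmissible φ) (i : ℤ) :
    P.cahnHoffman φ i ∈ face φ (P.normal (i - 1)) ∩ face φ (P.normal i) :=
  Classical.epsilon_spec (hP i).2.2.2

/-- A point of the facet of `S i`, in terms of its abscissa along the facet. -/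
lemma eq_of_mem_face {i : ℤ} {x y : Plane}
    (hx : x ∈ face φ (P.normal i)) (hy : y ∈ face φ (P.normal i)) :
    y - x = inner ℝ (P.tangent i) (y - x) • P.tangent i := by
  have h := P.eq_tangent_add_normal i (y - x)
  rw [inner_sub_right (P.normal i), hy.2, hx.2, sub_self, zero_smul, add_zero] at h
  exact h

/-- The facet of `S i` lies to one side of its endpoint `N i`. -/
lemma IsAdmissible.inner_sub_cahnHoffman_mul_sin_nonpos (hφ : IsAnisotropy φ)
    (hP : P.IsAdmissible φ) {i : ℤ} {y : Plane} (hy : y ∈ face φ (P.normal i)) :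
    inner ℝ (P.tangent i) (y - P.cahnHoffman φ i) * Real.sin (P.angle i) ≤ 0 := by
  obtain ⟨h1, h2⟩ := hP.cahnHoffman_mem i
  have h : inner ℝ (P.normal (i - 1)) (y - P.cahnHoffman φ i) ≤ 0 := by
    rw [inner_sub_right, h1.2, sub_nonpos]
    exact hφ.inner_le_dual _ hy.1
  rw [eq_of_mem_face h2 hy, P.normal_pred i, real_inner_smul_right, inner_sub_left,
    real_inner_smul_left, real_inner_smul_left, inner_tangent_tangent, inner_normal_tangent] at h
  linarith

/-- The facet of `S i` lies to one side of its endpoint `N (i + 1)`. -/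
lemma IsAdmissible.inner_sub_cahnHoffman_succ_mul_sin_nonneg (hφ : IsAnisotropy φ)
    (hP : P.IsAdmissible φ) {i : ℤ} {y : Plane} (hy : y ∈ face φ (P.normal i)) :
    0 ≤ inner ℝ (P.tangent i) (y - P.cahnHoffman φ (i + 1)) * Real.sin (P.angle (i + 1)) := by
  obtain ⟨h2, h1⟩ := hP.cahnHoffman_mem (i + 1)
  rw [add_sub_cancel_right] at h2
  have h : inner ℝ (P.normal (i + 1)) (y - P.cahnHoffman φ (i + 1)) ≤ 0 := by
    rw [inner_sub_right, h1.2, sub_nonpos]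
    exact hφ.inner_le_dual _ hy.1
  rw [eq_of_mem_face h2 hy, P.normal_succ i, real_inner_smul_right, inner_sub_left,
    real_inner_smul_left, real_inner_smul_left, inner_tangent_tangent, inner_normal_tangent] at h
  linarith

lemma IsAdmissible.cahnHoffman_succ_mem (hP : P.IsAdmissible φ) (i : ℤ) :
    P.cahnHoffman φ (i + 1) ∈ face φ (P.normal i) := by
  simpa using (hP.cahnHoffman_mem (i + 1)).1

/-- The Cahn-Hoffman field runs along the facet of `S i` forwards, backwards or not at all,
according to the transition number. -/
lemma IsAdmissible.cahnHoffman_succ_sub (hφ : IsAnisotropy φ) (hP : P.IsAdmissible φ) (i : ℤ) :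
    P.cahnHoffman φ (i + 1) - P.cahnHoffman φ i =
      (P.transition i * facetLength φ (P.normal i)) • P.tangent i := by
  have hs := hP.sin_ne_zero hφ
  have hN := (hP.cahnHoffman_mem i).2
  have hN' := hP.cahnHoffman_succ_mem i
  set N := P.cahnHoffman φ i with hNdef
  set N' := P.cahnHoffman φ (i + 1) with hNdef'
  have h1 : ∀ y ∈ face φ (P.normal i), inner ℝ (P.tangent i) (y - N) * Real.sin (P.angle i) ≤ 0 :=
    fun y hy => hP.inner_sub_cahnHoffman_mul_sin_nonpos hφ hy
  have h2 : ∀ y ∈ face φ (P.normal i),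
      0 ≤ inner ℝ (P.tangent i) (y - N') * Real.sin (P.angle (i + 1)) :=
    fun y hy => hP.inner_sub_cahnHoffman_succ_mul_sin_nonneg hφ hy
  have hneg : inner ℝ (P.tangent i) (N - N') = -inner ℝ (P.tangent i) (N' - N) := by
    rw [← inner_neg_right, neg_sub]
  -- The facet is between its extreme points, so that its diameter is their distance.
  have hdiam : (∀ y ∈ face φ (P.normal i), ∀ z ∈ face φ (P.normal i),
      |inner ℝ (P.tangent i) (y - z)| ≤ |inner ℝ (P.tangent i) (N' - N)|) →
      facetLength φ (P.normal i) = |inner ℝ (P.tangent i) (N' - N)| := by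
    intro h
    have hd : ∀ y ∈ face φ (P.normal i), ∀ z ∈ face φ (P.normal i),
        dist y z = |inner ℝ (P.tangent i) (y - z)| := fun y hy z hz => by
      rw [dist_eq_norm, eq_of_mem_face hz hy, norm_smul, norm_tangent, mul_one, Real.norm_eq_abs,
        real_inner_smul_right, inner_tangent_tangent, mul_one]
    apply le_antisymm
    · exact Metric.diam_le_of_forall_dist_le (abs_nonneg _) fun y hy z hz => by
        rw [hd y hy z hz]; exact h y hy z hz
    · rw [← hd N' hN' N hN]
      exact Metric.dist_le_diam_of_mem (isBounded_face hφ _) hN' hN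
  have hsplit : ∀ y z, inner ℝ (P.tangent i) (y - z) =
      inner ℝ (P.tangent i) (y - N) - inner ℝ (P.tangent i) (z - N) := fun y z => by
    rw [← inner_sub_right]; congr 1; abel
  have hsplit' : ∀ y, inner ℝ (P.tangent i) (y - N) =
      inner ℝ (P.tangent i) (y - N') + inner ℝ (P.tangent i) (N' - N) := fun y => by
    rw [← inner_add_right]; congr 1; abel
  rw [eq_of_mem_face hN hN', transition_eq hs]
  congr 1
  split_ifs with hc hc'
  · have k1 : ∀ y ∈ face φ (P.normal i), 0 ≤ inner ℝ (P.tangent i) (y - N) := fun y hy =>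
      nonneg_of_mul_nonpos_left (h1 y hy) hc.1
    have k2 : ∀ y ∈ face φ (P.normal i), inner ℝ (P.tangent i) (y - N') ≤ 0 := fun y hy => by
      by_contra h; exact absurd (h2 y hy) (mul_neg_of_pos_of_neg (not_le.1 h) hc.2).not_ge
    rw [hdiam fun y hy z hz => ?_, abs_of_nonneg (k1 N' hN'), one_mul]
    rw [abs_of_nonneg (k1 N' hN'), hsplit, abs_le]
    constructor <;> linarith [k1 y hy, k1 z hz, k2 y hy, k2 z hz, hsplit' y, hsplit' z]
  · have k1 : ∀ y ∈ face φ (P.normal i), inner ℝ (P.tangent i) (y - N) ≤ 0 := fun y hy => by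
      by_contra h; exact absurd (h1 y hy) (mul_pos (not_le.1 h) hc'.1).not_ge
    have k2 : ∀ y ∈ face φ (P.normal i), 0 ≤ inner ℝ (P.tangent i) (y - N') := fun y hy =>
      nonneg_of_mul_nonneg_left (h2 y hy) hc'.2
    rw [hdiam fun y hy z hz => ?_, abs_of_nonpos (k1 N' hN')]
    · ring
    rw [abs_of_nonpos (k1 N' hN'), hsplit, abs_le]
    constructor <;> linarith [k1 y hy, k1 z hz, k2 y hy, k2 z hz, hsplit' y, hsplit' z]
  · rw [zero_mul]
    have a1 := h1 N' hN'
    have a2 := h2 N hN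
    rw [hneg] at a2
    rcases (hs i).lt_or_gt with h | h <;> rcases (hs (i + 1)).lt_or_gt with h' | h'
    · exact (hc ⟨h, h'⟩).elim
    · nlinarith
    · nlinarith
    · exact (hc' ⟨h, h'⟩).elim

lemma IsAdmissible.cahnHoffman_succ_eq_iff (hφ : IsAnisotropy φ) (hP : P.IsAdmissible φ) (i : ℤ) :
    P.cahnHoffman φ (i + 1) = P.cahnHoffman φ i ↔ P.transition i = 0 := by
  rw [← sub_eq_zero, hP.cahnHoffman_succ_sub hφ, smul_eq_zero, mul_eq_zero]
  simp [(hP.facetLength_pos hφ i).ne', ← norm_eq_zero (a := P.tangent i)]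

lemma IsAdmissible.curvature_eq (hφ : IsAnisotropy φ) (hP : P.IsAdmissible φ) (i : ℤ) :
    P.curvature φ i = P.transition i * facetLength φ (P.normal i) / P.length i := by
  rw [curvature, hP.cahnHoffman_succ_sub hφ, real_inner_smul_left, inner_tangent_tangent, mul_one]

lemma IsAdmissible.curvature_eq_zero_iff (hφ : IsAnisotropy φ) (hP : P.IsAdmissible φ) (i : ℤ) :
    P.curvature φ i = 0 ↔ P.transition i = 0 := by
  rw [hP.curvature_eq hφ, div_eq_zero_iff, mul_eq_zero]
  simp [(hP.facetLength_pos hφ i).ne', (P.length_pos i).ne']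

lemma sin_mul_sin_neg_of_transition_eq_zero (hs : ∀ i, Real.sin (P.angle i) ≠ 0) {i : ℤ}
    (h : P.transition i = 0) : Real.sin (P.angle i) * Real.sin (P.angle (i + 1)) < 0 := by
  rw [transition_eq hs] at h
  rcases (hs i).lt_or_gt with h1 | h1 <;> rcases (hs (i + 1)).lt_or_gt with h2 | h2
  · simp [h1, h2] at h
  · exact mul_neg_of_neg_of_pos h1 h2
  · exact mul_neg_of_pos_of_neg h1 h2
  · simp [h1, h2, h1.not_gt] at h

/-- At a segment of zero curvature the three facets `F (i - 1)`, `F i`, `F (i + 1)` meet in the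
vertex `N i`, and `F (i - 1)`, `F (i + 1)` are on the same side of `F i`. By convexity they are equal. -/
lemma IsAdmissible.angle_succ_of_transition_eq_zero (hφ : IsAnisotropy φ) (hP : P.IsAdmissible φ)
    {i : ℤ} (h : P.transition i = 0) :
    Real.sin (P.angle (i + 1)) = -Real.sin (P.angle i) ∧
      Real.cos (P.angle (i + 1)) = Real.cos (P.angle i) := by
  have hs := hP.sin_ne_zero hφ
  have hss := sin_mul_sin_neg_of_transition_eq_zero hs h
  have hN := hP.cahnHoffman_mem i
  have hN' := (hP.cahnHoffman_mem (i + 1)).2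
  rw [(hP.cahnHoffman_succ_eq_iff hφ i).2 h] at hN'
  set N := P.cahnHoffman φ i
  obtain ⟨y, hy, hyN⟩ := (hP.isFacetNormal (i - 1)).2.exists_ne N
  obtain ⟨z, hz, hzN⟩ := (hP.isFacetNormal (i + 1)).2.exists_ne N
  have ey := eq_of_mem_face hN.1 hy
  have ez := eq_of_mem_face hN' hz
  set a := inner ℝ (P.tangent (i - 1)) (y - N)
  set b := inner ℝ (P.tangent (i + 1)) (z - N)
  have ha : a ≠ 0 := by
    rintro h0; rw [h0, zero_smul, sub_eq_zero] at ey; exact hyN ey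
  have hb : b ≠ 0 := by
    rintro h0; rw [h0, zero_smul, sub_eq_zero] at ez; exact hzN ez
  have hle : ∀ ν x, x ∈ wulff φ → N ∈ face φ ν → inner ℝ ν (x - N) ≤ 0 := fun ν x hx hNν => by
    rw [inner_sub_right, hNν.2, sub_nonpos]; exact hφ.inner_le_dual _ hx
  have h1 := hle _ _ hy.1 hN.2
  have h2 := hle _ _ hz.1 hN.2
  have h3 := hle _ _ hy.1 hN'
  have h4 := hle _ _ hz.1 hN.1
  rw [ey, real_inner_smul_right] at h1 h3
  rw [ez, real_inner_smul_right] at h2 h4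
  rw [P.normal_succ, P.tangent_pred] at h3
  rw [P.normal_pred, P.tangent_succ] at h4
  rw [P.tangent_pred] at h1
  rw [P.tangent_succ] at h2
  simp only [inner_sub_left, inner_sub_right, inner_add_right, real_inner_smul_left,
    real_inner_smul_right, inner_tangent_tangent, inner_tangent_normal, inner_normal_tangent,
    inner_normal_normal] at h1 h2 h3 h4
  have p := Real.sin_sq_add_cos_sq (P.angle i)
  have q := Real.sin_sq_add_cos_sq (P.angle (i + 1))
  have hsi := hs i
  have hsi' := hs (i + 1)
  set s := Real.sin (P.angle i)
  set s' := Real.sin (P.angle (i + 1))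
  set k := Real.cos (P.angle i)
  set k' := Real.cos (P.angle (i + 1))
  have hX : k * s' + s * k' = 0 := by
    have h1' : 0 ≤ a * s := by linarith
    have h2' : b * s' ≤ 0 := by linarith
    have h3' : a * (k * s' + s * k') ≤ 0 := by linarith
    have h4' : 0 ≤ b * (k * s' + s * k') := by linarith
    have hab : 0 < a * b := by
      have hs1 : 0 < a * s := lt_of_le_of_ne h1' (mul_ne_zero ha hsi).symm
      have hs2 : b * s' < 0 := lt_of_le_of_ne h2' (mul_ne_zero hb hsi')
      have : 0 < (a * b) * (-(s * s')) := by nlinarith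
      exact (pos_iff_pos_of_mul_pos this).2 (by linarith)
    by_contra hne
    have h5 : (a * b) * (k * s' + s * k') ^ 2 ≤ 0 := by nlinarith
    exact absurd h5 (mul_pos hab (by positivity)).not_ge
  have hsq : (s' - s) * (s' + s) = 0 := by
    linear_combination (k * s' - s * k') * hX - s' ^ 2 * p + s ^ 2 * q
  have hs'' : s' = -s := by
    rcases mul_eq_zero.1 hsq with h | h
    · rw [sub_eq_zero.1 h] at hss; exact absurd hss (mul_self_nonneg s).not_gt
    · linarith
  refine ⟨hs'', ?_⟩
  rw [hs''] at hX
  exact mul_left_cancel₀ hsi (by linarith)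

lemma IsAdmissible.normal_succ_eq_normal_pred (hφ : IsAnisotropy φ) (hP : P.IsAdmissible φ) {i : ℤ}
    (h : P.transition i = 0) : P.normal (i + 1) = P.normal (i - 1) := by
  obtain ⟨h1, h2⟩ := hP.angle_succ_of_transition_eq_zero hφ h
  rw [P.normal_succ, P.normal_pred, h1, h2, neg_smul, neg_smul]
  abel

end Admissible

end ClosedPolygon

namespace ClosedPolygon

/-! ### Parallel polygons in terms of signed heights -/

section Heights

/-- The displacement of `vertex i` when the segments of `P` are moved by the signed heights `h`. -/
def heightDisp (P : ClosedPolygon) (h : ℤ → ℝ) (i : ℤ) : Plane :=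
  h i • P.normal i +
    ((h (i - 1) + Real.cos (P.angle i) * h i) / Real.sin (P.angle i)) • P.tangent i

/-- The length that the segment `S i` loses when the segments of `P` are moved by the signed heights
`h`. As an operator on periodic sequences it is symmetric. -/
def lengthLoss (P : ClosedPolygon) (h : ℤ → ℝ) (i : ℤ) : ℝ :=
  h (i - 1) / Real.sin (P.angle i) +
    (Real.cot (P.angle i) + Real.cot (P.angle (i + 1))) * h i +
    h (i + 1) / Real.sin (P.angle (i + 1))

variable {P Q : ClosedPolygon} {h : ℤ → ℝ}

lemma heightDisp_succ (hs : ∀ i, Real.sin (P.angle i) ≠ 0) (i : ℤ) : P.heightDisp h (i + 1) =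
    h i • P.normal i - ((h (i + 1) + Real.cos (P.angle (i + 1)) * h i) /
      Real.sin (P.angle (i + 1))) • P.tangent i := by
  have p := Real.sin_sq_add_cos_sq (P.angle (i + 1))
  have hs' := hs (i + 1)
  rw [heightDisp, P.normal_succ, P.tangent_succ, add_sub_cancel_right]
  apply plane_ext <;> simp <;> field_simp <;>
    linear_combination (-(h (i + 1) * P.tangent i _)) * p

lemma heightDisp_succ_sub (hs : ∀ i, Real.sin (P.angle i) ≠ 0) (i : ℤ) :
    P.heightDisp h (i + 1) - P.heightDisp h i = -P.lengthLoss h i • P.tangent i := by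
  have hs1 := hs i
  have hs' := hs (i + 1)
  rw [heightDisp_succ hs, heightDisp, lengthLoss, Real.cot_eq_cos_div_sin,
    Real.cot_eq_cos_div_sin]
  apply plane_ext <;> simp <;> field_simp <;> ring

lemma eq_heightDisp (hs : ∀ i, Real.sin (P.angle i) ≠ 0) {i : ℤ} {w : Plane}
    (h1 : inner ℝ (P.normal i) w = h i) (h2 : inner ℝ (P.normal (i - 1)) w = h (i - 1)) :
    w = P.heightDisp h i := by
  have hs1 := hs i
  have hw := P.eq_tangent_add_normal i w
  rw [P.normal_pred, inner_sub_left, real_inner_smul_left, real_inner_smul_left, h1] at h2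
  have ht : inner ℝ (P.tangent i) w =
      (h (i - 1) + Real.cos (P.angle i) * h i) / Real.sin (P.angle i) := by
    rw [eq_div_iff hs1]; linarith
  rw [heightDisp, ← ht, ← h1, add_comm]
  exact hw

lemma heightDisp_periodic (hh : ∀ i, h (i + P.n) = h i) (i : ℤ) :
    P.heightDisp h (i + P.n) = P.heightDisp h i := by
  rw [heightDisp, heightDisp, normal_periodic, tangent_periodic, angle_periodic, hh,
    add_sub_right_comm, hh]

lemma lengthLoss_periodic (hh : ∀ i, h (i + P.n) = h i) (i : ℤ) :
    P.lengthLoss h (i + P.n) = P.lengthLoss h i := by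
  rw [lengthLoss, lengthLoss, angle_periodic, add_right_comm i _ 1, angle_periodic, hh, hh,
    add_sub_right_comm, hh]

lemma inner_normal_heightDisp (i : ℤ) : inner ℝ (P.normal i) (P.heightDisp h i) = h i := by
  rw [heightDisp, inner_add_right, real_inner_smul_right, real_inner_smul_right,
    inner_normal_normal, inner_normal_tangent]
  ring

/-- The polygon obtained from `P` by moving its segments by the signed heights `h`. -/
def ofHeights (P : ClosedPolygon) (hs : ∀ i, Real.sin (P.angle i) ≠ 0) (h : ℤ → ℝ)
    (hh : ∀ i, h (i + P.n) = h i) (hpos : ∀ i, 0 < P.length i - P.lengthLoss h i) :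
    ClosedPolygon where
  n := P.n
  n_pos := P.n_pos
  vertex i := P.vertex i + P.heightDisp h i
  periodic i := by rw [P.periodic, heightDisp_periodic hh]
  nondegenerate i := by
    intro heq
    have h1 : (P.length i - P.lengthLoss h i) • P.tangent i = 0 := by
      have := P.heightDisp_succ_sub (h := h) hs i
      rw [sub_smul, sub_eq_add_neg, ← neg_smul, ← this, ← sub_eq_zero.2 heq.symm, P.vertex_succ]
      abel
    rcases smul_eq_zero.1 h1 with h2 | h2
    · exact (hpos i).ne' h2
    · have := P.norm_tangent i
      rw [h2, norm_zero] at this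
      exact zero_ne_one this

section OfHeights

variable (hs : ∀ i, Real.sin (P.angle i) ≠ 0) (hh : ∀ i, h (i + P.n) = h i)
  (hpos : ∀ i, 0 < P.length i - P.lengthLoss h i)

lemma ofHeights_vertex_succ (i : ℤ) : (P.ofHeights hs h hh hpos).vertex (i + 1) =
    (P.ofHeights hs h hh hpos).vertex i + (P.length i - P.lengthLoss h i) • P.tangent i := by
  have := P.heightDisp_succ_sub (h := h) hs i
  change P.vertex (i + 1) + P.heightDisp h (i + 1) = P.vertex i + P.heightDisp h i + _
  rw [sub_eq_iff_eq_add.1 this, P.vertex_succ, sub_smul, neg_smul]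
  abel

lemma tangent_eq_of_vertex_succ {Q : ClosedPolygon} {i : ℤ} {l : ℝ} {τ : Plane} (hl : 0 < l)
    (hτ : ‖τ‖ = 1) (hQ : Q.vertex (i + 1) = Q.vertex i + l • τ) :
    Q.tangent i = τ ∧ Q.length i = l := by
  have hlen : Q.length i = l := by
    rw [length, hQ, dist_self_add_right, norm_smul, hτ, mul_one, Real.norm_of_nonneg hl.le]
  exact ⟨by rw [tangent, hlen, hQ, add_sub_cancel_left, smul_smul, inv_mul_cancel₀ hl.ne',
    one_smul], hlen⟩

lemma parallel_ofHeights : Parallel P (P.ofHeights hs h hh hpos) :=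
  ⟨rfl, fun i => congrArg perp (tangent_eq_of_vertex_succ (hpos i) (P.norm_tangent i)
    (ofHeights_vertex_succ hs hh hpos i)).1.symm⟩

lemma signedHeight_ofHeights (i : ℤ) : signedHeight P (P.ofHeights hs h hh hpos) i = h i := by
  have : (P.ofHeights hs h hh hpos).vertex i - P.vertex i = P.heightDisp h i := by
    change P.vertex i + P.heightDisp h i - P.vertex i = _
    abel
  rw [signedHeight, this, real_inner_comm, inner_normal_heightDisp]

end OfHeights

lemma Parallel.tangent_eq (hPQ : Parallel P Q) (i : ℤ) : P.tangent i = Q.tangent i :=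
  perp_injective (hPQ.2 i)

lemma Parallel.angle_eq (hPQ : Parallel P Q) (i : ℤ) : P.angle i = Q.angle i := by
  rw [angle, angle, hPQ.tangent_eq, hPQ.tangent_eq]

lemma Parallel.transition_eq (hPQ : Parallel P Q) (i : ℤ) : P.transition i = Q.transition i := by
  rw [transition, transition, hPQ.angle_eq, hPQ.angle_eq]

lemma Parallel.isAdmissible {φ : Plane → ℝ} (hPQ : Parallel P Q) (hP : P.IsAdmissible φ) :
    Q.IsAdmissible φ := fun i => by rw [← hPQ.2, ← hPQ.2]; exact hP i

lemma Parallel.cahnHoffman_eq (φ : Plane → ℝ) (hPQ : Parallel P Q) (i : ℤ) :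
    P.cahnHoffman φ i = Q.cahnHoffman φ i := by
  rw [cahnHoffman, cahnHoffman, hPQ.2, hPQ.2]

lemma Parallel.index_eq (φ : Plane → ℝ) (hPQ : Parallel P Q) : P.index φ = Q.index φ := by
  simp only [index, turning, hPQ.1, hPQ.cahnHoffman_eq φ]

lemma Parallel.signedHeight_periodic (hPQ : Parallel P Q) (i : ℤ) :
    signedHeight P Q (i + P.n) = signedHeight P Q i := by
  rw [signedHeight, signedHeight, P.periodic, P.normal_periodic, hPQ.1, Q.periodic]

lemma Parallel.vertex_eq (hs : ∀ i, Real.sin (P.angle i) ≠ 0) (hPQ : Parallel P Q) (i : ℤ) :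
    Q.vertex i = P.vertex i + P.heightDisp (signedHeight P Q) i := by
  rw [← sub_eq_iff_eq_add']
  refine eq_heightDisp hs (real_inner_comm _ _) ?_
  have h1 := P.vertex_succ (i - 1)
  have h2 := Q.vertex_succ (i - 1)
  rw [sub_add_cancel] at h1 h2
  rw [signedHeight, real_inner_comm, h1, h2, ← hPQ.tangent_eq, add_sub_add_comm, ← sub_smul,
    inner_add_left, real_inner_smul_left, inner_tangent_normal, mul_zero, add_zero]

lemma Parallel.length_eq (hs : ∀ i, Real.sin (P.angle i) ≠ 0) (hPQ : Parallel P Q) (i : ℤ) :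
    Q.length i = P.length i - P.lengthLoss (signedHeight P Q) i := by
  have h1 := Q.vertex_succ i
  rw [hPQ.vertex_eq hs, hPQ.vertex_eq hs, P.vertex_succ, ← hPQ.tangent_eq,
    sub_eq_iff_eq_add.1 (P.heightDisp_succ_sub hs i)] at h1
  have h2 : Q.length i • P.tangent i =
      (P.length i - P.lengthLoss (signedHeight P Q) i) • P.tangent i := by
    rw [sub_smul, sub_eq_add_neg, ← neg_smul]
    refine add_left_cancel (a := P.vertex i + P.heightDisp (signedHeight P Q) i) ?_
    rw [← h1]; abel
  have h3 := congrArg (fun v => inner ℝ v (P.tangent i)) h2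
  simpa only [real_inner_smul_left, inner_tangent_tangent, mul_one] using h3

lemma ext_of_vertex (hn : P.n = Q.n) (hv : ∀ i, P.vertex i = Q.vertex i) : P = Q := by
  cases P; cases Q
  obtain rfl : _ = _ := hn
  obtain rfl := funext hv
  rfl

lemma Parallel.eq_of_signedHeight_eq (hs : ∀ i, Real.sin (P.angle i) ≠ 0) {R : ClosedPolygon}
    (hPQ : Parallel P Q) (hPR : Parallel P R)
    (h : ∀ i, signedHeight P Q i = signedHeight P R i) : Q = R :=
  ext_of_vertex (hPQ.1.symm.trans hPR.1) fun i => by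
    rw [hPQ.vertex_eq hs, hPR.vertex_eq hs, funext h]

end Heights

/-! ### The velocity of the flow and the dissipation of the energy -/

section Velocity

variable {φ : Plane → ℝ} {α : ℝ} {P Q : ClosedPolygon}

/-- The bending density `c i ^ 2 * δ i / |S i| ^ 2` for segments with the directions of `P` and the
lengths `L`. -/
def bending (P : ClosedPolygon) (φ : Plane → ℝ) (L : ℤ → ℝ) (i : ℤ) : ℝ :=
  P.transition i ^ 2 * P.delta φ i / L i ^ 2

/-- The velocity of the elastic flow for segments with the directions of `P` and the lengths `L`. -/
def speed (P : ClosedPolygon) (φ : Plane → ℝ) (α : ℝ) (L : ℤ → ℝ) (i : ℤ) : ℝ :=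
  -(dual φ (P.normal i) / L i * (P.transition i * facetLength φ (P.normal i) +
    α * P.lengthLoss (P.bending φ L) i))

lemma Parallel.velocity_eq (hPQ : Parallel P Q) (i : ℤ) :
    Q.velocity φ α i = P.speed φ α Q.length i := by
  simp only [velocity, speed, lengthLoss, bending, delta, hPQ.transition_eq, hPQ.angle_eq, hPQ.2]
  ring

lemma delta_periodic (i : ℤ) : P.delta φ (i + P.n) = P.delta φ i := by
  rw [delta, delta, normal_periodic]

lemma bending_periodic {L : ℤ → ℝ} (hL : ∀ i, L (i + P.n) = L i) (i : ℤ) :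
    P.bending φ L (i + P.n) = P.bending φ L i := by
  rw [bending, bending, transition_periodic, delta_periodic, hL]

lemma speed_periodic {L : ℤ → ℝ} (hL : ∀ i, L (i + P.n) = L i) (i : ℤ) :
    P.speed φ α L (i + P.n) = P.speed φ α L i := by
  rw [speed, speed, transition_periodic, normal_periodic, hL,
    lengthLoss_periodic (bending_periodic hL)]

/-- The Cahn-Hoffman field consists of the displacements of the vertices for the heights `φᵒ(ν i)`,
so that its differences are given by the loss of length for these heights. -/
lemma IsAdmissible.lengthLoss_dual (hφ : IsAnisotropy φ) (hP : P.IsAdmissible φ) (i : ℤ) :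
    P.lengthLoss (fun j => dual φ (P.normal j)) i =
      -(P.transition i * facetLength φ (P.normal i)) := by
  have hs := hP.sin_ne_zero hφ
  have hN : ∀ i, P.cahnHoffman φ i = P.heightDisp (fun j => dual φ (P.normal j)) i := fun i =>
    eq_heightDisp hs (hP.cahnHoffman_mem i).2.2 (hP.cahnHoffman_mem i).1.2
  have h := hP.cahnHoffman_succ_sub hφ i
  rw [hN, hN, heightDisp_succ_sub hs] at h
  have h3 := congrArg (fun v => inner ℝ v (P.tangent i)) h
  simp only [real_inner_smul_left, inner_tangent_tangent, mul_one] at h3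
  linarith

lemma sum_range_periodic_succ {M : Type*} [AddCommMonoid M] {n : ℕ} {a : ℤ → M}
    (ha : ∀ i, a (i + n) = a i) :
    ∑ i ∈ Finset.range n, a ((i : ℤ) + 1) = ∑ i ∈ Finset.range n, a (i : ℤ) := by
  cases n with
  | zero => simp
  | succ n =>
    have h0 := ha 0
    rw [zero_add] at h0
    rw [Finset.sum_range_succ' (fun i : ℕ => a (i : ℤ)), Finset.sum_range_succ]
    push_cast at h0 ⊢
    rw [h0]

lemma sum_mul_lengthLoss_comm {f g : ℤ → ℝ} (hf : ∀ i, f (i + P.n) = f i)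
    (hg : ∀ i, g (i + P.n) = g i) :
    ∑ i ∈ Finset.range P.n, f (i : ℤ) * P.lengthLoss g (i : ℤ) =
      ∑ i ∈ Finset.range P.n, g (i : ℤ) * P.lengthLoss f (i : ℤ) := by
  have ha := sum_range_periodic_succ (n := P.n)
    (a := fun i => f i * g (i - 1) / Real.sin (P.angle i)) (fun i => by
      rw [hf, angle_periodic, add_sub_right_comm, hg])
  have hb := sum_range_periodic_succ (n := P.n)
    (a := fun i => g i * f (i - 1) / Real.sin (P.angle i)) (fun i => by
      rw [hg, angle_periodic, add_sub_right_comm, hf])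
  have hl : ∀ f g : ℤ → ℝ, ∑ i ∈ Finset.range P.n, f (i : ℤ) * P.lengthLoss g (i : ℤ) =
      ∑ i ∈ Finset.range P.n, f i * g (i - 1) / Real.sin (P.angle i) +
      (∑ i ∈ Finset.range P.n, g ((i : ℤ) + 1) * f ((i : ℤ) + 1 - 1) /
        Real.sin (P.angle ((i : ℤ) + 1)) +
      ∑ i ∈ Finset.range P.n, f i * g i * (Real.cot (P.angle i) + Real.cot (P.angle (i + 1)))) := by
    intro f g
    rw [← Finset.sum_add_distrib, ← Finset.sum_add_distrib]
    refine Finset.sum_congr rfl fun i _ => ?_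
    rw [lengthLoss, add_sub_cancel_right]; ring
  rw [hl f g, hl g f, hb, ha]
  have : ∀ i : ℕ, f (i : ℤ) * g i * (Real.cot (P.angle i) + Real.cot (P.angle (i + 1))) =
    g (i : ℤ) * f i * (Real.cot (P.angle i) + Real.cot (P.angle (i + 1))) := fun i => by ring
  simp only [this]
  ring

/-- The elastic energy `∑ (φᵒ(ν i) |S i| + α c i ^ 2 δ i / |S i|)`, a Lyapunov function of the
flow. -/
def energy (P : ClosedPolygon) (φ : Plane → ℝ) (α : ℝ) (L : ℤ → ℝ) : ℝ :=
  ∑ i ∈ Finset.range P.n,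
    (dual φ (P.normal i) * L i + α * (P.transition i ^ 2 * P.delta φ i / L i))

lemma hasDerivAt_lengthLoss {h : ℤ → ℝ → ℝ} {v : ℤ → ℝ} {t : ℝ}
    (hv : ∀ i, HasDerivAt (h i) (v i) t) (i : ℤ) :
    HasDerivAt (fun s => P.lengthLoss (fun j => h j s) i) (P.lengthLoss v i) t :=
  (((hv _).div_const _).add ((hv _).const_mul _)).add ((hv _).div_const _)

/-- The flow is the gradient flow of the energy with respect to the metric
`∑ |S i| v i ^ 2 / φᵒ(ν i)`. -/
lemma IsAdmissible.hasDerivAt_energy (hφ : IsAnisotropy φ) (hP : P.IsAdmissible φ)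
    {L : ℤ → ℝ → ℝ} {v : ℤ → ℝ} {t : ℝ} (hLpos : ∀ i, 0 < L i t)
    (hLper : ∀ i, L (i + P.n) t = L i t)
    (hv : ∀ i, v i = P.speed φ α (fun j => L j t) i)
    (hL : ∀ i, HasDerivAt (L i) (-P.lengthLoss v i) t) :
    HasDerivAt (fun s => P.energy φ α (fun j => L j s))
      (-∑ i ∈ Finset.range P.n, L i t * v i ^ 2 / dual φ (P.normal i)) t := by
  have h1 : HasDerivAt (fun s => P.energy φ α (fun j => L j s)) (∑ i ∈ Finset.range P.n,
      (dual φ (P.normal i) * -P.lengthLoss v i +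
        α * ((0 * L i t - P.transition i ^ 2 * P.delta φ i * -P.lengthLoss v i) /
          L i t ^ 2))) t := by
    refine HasDerivAt.fun_sum fun i _ => ((hL i).const_mul _).add (HasDerivAt.const_mul α ?_)
    exact (hasDerivAt_const t _).div (hL i) (hLpos i).ne'
  convert h1 using 1
  set q := P.bending φ (fun j => L j t) with hq
  have hqper : ∀ i, q (i + P.n) = q i := bending_periodic hLper
  have hvper : ∀ i, v (i + P.n) = v i := fun i => by rw [hv, hv]; exact speed_periodic hLper i
  have hdper : ∀ i, dual φ (P.normal (i + P.n)) = dual φ (P.normal i) := fun i => by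
    rw [normal_periodic]
  have e1 := sum_mul_lengthLoss_comm (P := P) (f := fun i => dual φ (P.normal i)) hdper hvper
  have e2 := sum_mul_lengthLoss_comm (P := P) hqper hvper
  calc -∑ i ∈ Finset.range P.n, L i t * v i ^ 2 / dual φ (P.normal i)
      = -(∑ i ∈ Finset.range P.n, v i * P.lengthLoss (fun j => dual φ (P.normal j)) i) +
        α * ∑ i ∈ Finset.range P.n, v i * P.lengthLoss q i := by
        rw [Finset.mul_sum, ← Finset.sum_neg_distrib, ← Finset.sum_neg_distrib,
          ← Finset.sum_add_distrib]
        refine Finset.sum_congr rfl fun i _ => ?_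
        rw [hP.lengthLoss_dual hφ]
        have hd := (dual_normal_pos hφ P i).ne'
        have hl := (hLpos i).ne'
        have hvi : L i t * v i = -(dual φ (P.normal i) *
            (P.transition i * facetLength φ (P.normal i) + α * P.lengthLoss q i)) := by
          rw [hv i, speed, ← hq]; field_simp
        rw [pow_two, ← mul_assoc, hvi]
        field_simp
    _ = _ := by
        rw [← e1, ← e2, Finset.mul_sum, ← Finset.sum_neg_distrib, ← Finset.sum_add_distrib]
        refine Finset.sum_congr rfl fun i _ => ?_
        rw [hq, bending]; ring

end Velocity

end ClosedPolygon

/-! ### The flow as an ordinary differential equation for the heights -/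

lemma apply_zmod_val_of_periodic {β : Type*} {n : ℕ} [NeZero n] {f : ℤ → β}
    (hf : ∀ i, f (i + n) = f i) (i : ℤ) : f (((i : ZMod n).val : ℕ) : ℤ) = f i := by
  have hp : Function.Periodic f (n : ℤ) := hf
  have h := (hp.int_mul (i / n)) (i % n)
  rw [Int.cast_id] at h
  rw [ZMod.val_intCast, ← h, mul_comm, Int.emod_add_mul_ediv]

/-- A sequence indexed by `ℤ/n`, as a periodic sequence. -/
def periodicExt {n : ℕ} (x : ZMod n → ℝ) (i : ℤ) : ℝ := x i

lemma periodicExt_periodic {n : ℕ} (x : ZMod n → ℝ) (i : ℤ) :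
    periodicExt x (i + n) = periodicExt x i := by simp [periodicExt]

lemma periodicExt_val {n : ℕ} [NeZero n] {f : ℤ → ℝ} (hf : ∀ i, f (i + n) = f i) :
    periodicExt (fun j : ZMod n => f (j.val : ℤ)) = f :=
  funext fun i => apply_zmod_val_of_periodic hf i

namespace ClosedPolygon

instance (P : ClosedPolygon) : NeZero P.n := ⟨P.n_pos.ne'⟩

/-- The lengths of the segments of `P` after they have been moved by the heights `x`. -/
def movedLength (P : ClosedPolygon) (x : ZMod P.n → ℝ) (i : ℤ) : ℝ :=
  P.length i - P.lengthLoss (periodicExt x) i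

/-- The vector field of the elastic flow in the space of heights. -/
def heightField (P : ClosedPolygon) (φ : Plane → ℝ) (α : ℝ) (x : ZMod P.n → ℝ) : ZMod P.n → ℝ :=
  fun j => P.speed φ α (P.movedLength x) (j.val : ℤ)

/-- The heights for which all segments keep their orientation and do not degenerate. -/
def heightDomain (P : ClosedPolygon) : Set (ZMod P.n → ℝ) := {x | ∀ i, 0 < P.movedLength x i}

variable {φ : Plane → ℝ} {α : ℝ} {P : ClosedPolygon}

lemma movedLength_periodic (x : ZMod P.n → ℝ) (i : ℤ) :
    P.movedLength x (i + P.n) = P.movedLength x i := by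
  rw [movedLength, movedLength, length_periodic, lengthLoss_periodic (periodicExt_periodic x)]

lemma contDiff_movedLength (P : ClosedPolygon) (i : ℤ) :
    ContDiff ℝ 1 (fun x => P.movedLength x i) := by
  unfold movedLength lengthLoss periodicExt
  fun_prop

lemma isOpen_heightDomain (P : ClosedPolygon) : IsOpen P.heightDomain := by
  have : P.heightDomain = ⋂ j : ZMod P.n, {x | 0 < P.movedLength x (j.val : ℤ)} := by
    ext x
    simp only [heightDomain, Set.mem_ofPred_eq, Set.mem_iInter]
    exact ⟨fun h j => h _, fun h i => by
      rw [← apply_zmod_val_of_periodic (movedLength_periodic x) i]; exact h _⟩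
  rw [this]
  exact isOpen_iInter_of_finite fun j =>
    isOpen_lt continuous_const (P.contDiff_movedLength _).continuous

lemma contDiffAt_heightField (P : ClosedPolygon) (φ : Plane → ℝ) (α : ℝ) :
    ∀ x ∈ P.heightDomain, ContDiffAt ℝ 1 (P.heightField φ α) x := by
  intro x hx
  refine contDiffAt_pi.2 fun j => ?_
  have hL : ∀ i, ContDiffAt ℝ 1 (fun x => P.movedLength x i) x := fun i =>
    (P.contDiff_movedLength i).contDiffAt
  have hq : ∀ i, ContDiffAt ℝ 1 (fun x => P.bending φ (P.movedLength x) i) x := fun i =>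
    contDiffAt_const.div ((hL i).pow 2) (pow_ne_zero 2 (hx i).ne')
  exact ((contDiffAt_const.div (hL _) (hx _).ne').mul (contDiffAt_const.add (contDiffAt_const.mul
    ((((hq _).div_const _).add (contDiffAt_const.mul (hq _))).add ((hq _).div_const _))))).neg

section FlowODE

variable {T : EReal} {Γ : ℝ → ClosedPolygon}

lemma Parallel.movedLength_signedHeight (hs : ∀ i, Real.sin (P.angle i) ≠ 0)
    {Q : ClosedPolygon} (hPQ : Parallel P Q) :
    P.movedLength (fun j => signedHeight P Q (j.val : ℤ)) = Q.length := by
  funext i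
  rw [movedLength, periodicExt_val hPQ.signedHeight_periodic, hPQ.length_eq hs]

lemma IsElasticFlow.isForwardSolution (hs : ∀ i, Real.sin (P.angle i) ≠ 0)
    (hΓ : IsElasticFlow φ α P T Γ) :
    IsForwardSolution (P.heightField φ α) P.heightDomain 0 T
      (fun t j => signedHeight P (Γ t) (j.val : ℤ)) where
  pos := hΓ.pos
  initial := funext fun j => hΓ.initial _
  continuousOn := continuousOn_pi.2 fun j => hΓ.continuousOn _
  mem t h0 hT i := by
    rw [(hΓ.parallel t h0 hT).movedLength_signedHeight hs]
    exact (Γ t).length_pos i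
  deriv t h0 hT := hasDerivAt_pi.2 fun j => by
    have hp := hΓ.parallel t h0.le hT
    have := hΓ.ode (j.val : ℤ) t h0 hT
    rwa [hp.velocity_eq, ← hp.movedLength_signedHeight hs] at this

/-- The family of polygons with the heights `x t`. -/
def flowOfHeights (P : ClosedPolygon) (hs : ∀ i, Real.sin (P.angle i) ≠ 0)
    (x : ℝ → ZMod P.n → ℝ) (t : ℝ) : ClosedPolygon :=
  haveI := Classical.dec (x t ∈ P.heightDomain)
  if h : x t ∈ P.heightDomain then P.ofHeights hs (periodicExt (x t)) (periodicExt_periodic _) h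
  else P

lemma isOpen_setOf_coe_lt (T : EReal) : IsOpen {t : ℝ | 0 < t ∧ (t : EReal) < T} :=
  isOpen_Ioi.inter (isOpen_lt continuous_coe_real_ereal continuous_const)

lemma isElasticFlow_flowOfHeights (hs : ∀ i, Real.sin (P.angle i) ≠ 0)
    {x : ℝ → ZMod P.n → ℝ}
    (hx : IsForwardSolution (P.heightField φ α) P.heightDomain 0 T x) :
    IsElasticFlow φ α P T (P.flowOfHeights hs x) := by
  have hpar : ∀ t : ℝ, 0 ≤ t → (t : EReal) < T → Parallel P (P.flowOfHeights hs x t) := by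
    intro t h0 hT
    rw [flowOfHeights, dif_pos (hx.mem t h0 hT)]
    exact parallel_ofHeights hs _ _
  have hsh : ∀ t : ℝ, 0 ≤ t → (t : EReal) < T → ∀ i : ℤ,
      signedHeight P (P.flowOfHeights hs x t) i = x t (i : ZMod P.n) := by
    intro t h0 hT i
    rw [flowOfHeights, dif_pos (hx.mem t h0 hT)]
    exact signedHeight_ofHeights hs _ _ i
  have hode : ∀ (i : ℤ) (t : ℝ), 0 < t → (t : EReal) < T →
      HasDerivAt (fun s => signedHeight P (P.flowOfHeights hs x s) i)
        (P.heightField φ α (x t) i) t := by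
    intro i t h0 hT
    refine (hasDerivAt_pi.1 (hx.deriv t h0 hT) (i : ZMod P.n)).congr_of_eventuallyEq ?_
    filter_upwards [(isOpen_setOf_coe_lt T).mem_nhds ⟨h0, hT⟩] with s hs'
      using hsh s hs'.1.le hs'.2 i
  have hcont : ∀ j, ContinuousOn (fun t => x t j) {t : ℝ | 0 ≤ t ∧ (t : EReal) < T} :=
    continuousOn_pi.1 hx.continuousOn
  refine ⟨hx.pos, hpar, fun i => ?_, fun i => ?_, fun i => ?_, fun i t h0 hT => ?_⟩
  · exact (hcont _).congr fun t ht => hsh t ht.1 ht.2 i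
  · rw [show (1 : WithTop ℕ∞) = 0 + 1 from rfl,
      contDiffOn_succ_iff_deriv_of_isOpen (isOpen_setOf_coe_lt T)]
    refine ⟨fun t ht => (hode i t ht.1 ht.2).differentiableAt.differentiableWithinAt, by simp, ?_⟩
    rw [contDiffOn_zero]
    refine ContinuousOn.congr (f := fun t => P.heightField φ α (x t) i) ?_
      fun t ht => (hode i t ht.1 ht.2).deriv
    refine continuousOn_pi.1 (fun t ht => ?_) (i : ZMod P.n)
    exact ((P.contDiffAt_heightField φ α _ (hx.mem t ht.1.le ht.2)).continuousAt.comp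
      (hx.deriv t ht.1 ht.2).continuousAt).continuousWithinAt
  · rw [hsh 0 le_rfl (by exact_mod_cast hx.pos), hx.initial]; rfl
  · convert hode i t h0 hT using 1
    have hp := hpar t h0.le hT
    have hx' : x t = fun j => signedHeight P (P.flowOfHeights hs x t) (j.val : ℤ) :=
      funext fun j => by rw [hsh t h0.le hT]; simp
    have hmoved : P.movedLength (x t) = (P.flowOfHeights hs x t).length := by
      rw [← hp.movedLength_signedHeight hs, ← hx']
    rw [hp.velocity_eq, heightField, apply_zmod_val_of_periodic
      (speed_periodic (movedLength_periodic (x t))), hmoved]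

lemma IsElasticFlow.eq (hs : ∀ i, Real.sin (P.angle i) ≠ 0)
    {T' : EReal} {Γ' : ℝ → ClosedPolygon} (hΓ : IsElasticFlow φ α P T Γ)
    (hΓ' : IsElasticFlow φ α P T' Γ') {t : ℝ} (h0 : 0 ≤ t) (hT : (t : EReal) < T)
    (hT' : (t : EReal) < T') : Γ' t = Γ t := by
  have h := (hΓ'.isForwardSolution hs).eqOn (P.contDiffAt_heightField φ α)
    (hΓ.isForwardSolution hs) h0 hT' hT
  have hp := hΓ.parallel t h0 hT
  have hp' := hΓ'.parallel t h0 hT'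
  refine hp'.eq_of_signedHeight_eq hs hp fun i => ?_
  rw [← apply_zmod_val_of_periodic hp.signedHeight_periodic,
    ← apply_zmod_val_of_periodic hp'.signedHeight_periodic]
  exact congrFun h (i : ZMod P.n)

lemma IsElasticFlow.apply_zero (hs : ∀ i, Real.sin (P.angle i) ≠ 0)
    (hΓ : IsElasticFlow φ α P T Γ) : Γ 0 = P :=
  (hΓ.parallel 0 le_rfl (by exact_mod_cast hΓ.pos)).eq_of_signedHeight_eq hs ⟨rfl, fun _ => rfl⟩
    fun i => by rw [hΓ.initial, signedHeight, sub_self, inner_zero_left]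

lemma exists_isUniqueMaximalElasticFlow (φ : Plane → ℝ) (α : ℝ)
    (hs : ∀ i, Real.sin (P.angle i) ≠ 0) :
    ∃ T Γ, IsUniqueMaximalElasticFlow φ α P T Γ := by
  have h0 : (0 : ZMod P.n → ℝ) ∈ P.heightDomain := fun i => by
    have : P.lengthLoss (periodicExt (0 : ZMod P.n → ℝ)) i = 0 := by
      simp [lengthLoss, periodicExt]
    rw [movedLength, this, sub_zero]
    exact P.length_pos i
  obtain ⟨T, x, hx, hmax⟩ := exists_maximal_solution P.isOpen_heightDomain h0
    (P.contDiffAt_heightField φ α)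
  have hflow := isElasticFlow_flowOfHeights hs hx
  have hle : ∀ T' Γ', IsElasticFlow φ α P T' Γ' → T' ≤ T := fun T' Γ' h =>
    hmax T' _ (h.isForwardSolution hs)
  exact ⟨T, _, ⟨hflow, fun T' Γ' h _ => hle T' Γ' h⟩, fun T' Γ' h => ⟨hle T' Γ' h,
    fun t ht0 ht => hflow.eq hs h ht0 (ht.trans_le (hle T' Γ' h)) ht⟩⟩

/-- A maximal flow with all heights convergent has to lose a segment. -/
lemma IsUniqueMaximalElasticFlow.exists_tendsto_length_nonpos
    (hs : ∀ i, Real.sin (P.angle i) ≠ 0) {T : ℝ}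
    (hΓ : IsUniqueMaximalElasticFlow φ α P T Γ) {l : ℤ → ℝ}
    (hl : ∀ i, Tendsto (fun t => signedHeight P (Γ t) i) (𝓝[<] T) (𝓝 (l i))) :
    ∃ i, ∃ a ≤ 0, Tendsto (fun t => (Γ t).length i) (𝓝[<] T) (𝓝 a) := by
  have hflow := hΓ.1.1
  have hT : 0 < T := by exact_mod_cast hflow.pos
  have hsol := hflow.isForwardSolution hs
  have hlim : Tendsto (fun t (j : ZMod P.n) => signedHeight P (Γ t) (j.val : ℤ)) (𝓝[<] T)
      (𝓝 fun j => l (j.val : ℤ)) := tendsto_pi_nhds.2 fun j => hl _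
  have hnot : (fun j : ZMod P.n => l (j.val : ℤ)) ∉ P.heightDomain := by
    intro hmem
    obtain ⟨T', hT', y, hy⟩ := hsol.exists_extension P.isOpen_heightDomain
      (P.contDiffAt_heightField φ α) hmem hlim
    have := (hΓ.2 T' _ (isElasticFlow_flowOfHeights hs hy)).1
    exact absurd hT' (not_lt.2 (by exact_mod_cast this))
  simp only [heightDomain, Set.mem_ofPred_eq, not_forall, not_lt] at hnot
  obtain ⟨i, hi⟩ := hnot
  refine ⟨i, _, hi, ?_⟩
  refine (((P.contDiff_movedLength i).continuous.tendsto _).comp hlim).congr' ?_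
  filter_upwards [Ioo_mem_nhdsLT hT] with t ht
  exact congrFun ((hflow.parallel t ht.1.le (by exact_mod_cast ht.2)).movedLength_signedHeight hs) i

end FlowODE

end ClosedPolygon

/-! ### Energy estimates and the behaviour at the end of a maximal flow -/

lemma exists_forall_le_of_periodic {n : ℕ} [NeZero n] {f : ℤ → ℝ} (hf : ∀ i, f (i + n) = f i) :
    ∃ C, ∀ i, f i ≤ C := by
  obtain ⟨j, hj⟩ := Finite.exists_max (fun j : ZMod n => f (j.val : ℤ))
  exact ⟨_, fun i => by rw [← apply_zmod_val_of_periodic hf i]; exact hj i⟩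

lemma exists_pos_forall_le_of_periodic {n : ℕ} [NeZero n] {f : ℤ → ℝ} (hf : ∀ i, f (i + n) = f i)
    (hpos : ∀ i, 0 < f i) : ∃ d > 0, ∀ i, d ≤ f i := by
  obtain ⟨j, hj⟩ := Finite.exists_min (fun j : ZMod n => f (j.val : ℤ))
  exact ⟨_, hpos _, fun i => by rw [← apply_zmod_val_of_periodic hf i]; exact hj i⟩

namespace ClosedPolygon

variable {φ : Plane → ℝ} {α : ℝ} {P : ClosedPolygon}

lemma transition_sq_eq_one {i : ℤ} (h : P.transition i ≠ 0) : P.transition i ^ 2 = 1 := by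
  unfold transition at h ⊢
  split_ifs at h ⊢ <;> simp_all

lemma IsAdmissible.delta_pos (hφ : IsAnisotropy φ) (hP : P.IsAdmissible φ) (i : ℤ) :
    0 < P.delta φ i :=
  mul_pos (pow_pos (hP.facetLength_pos hφ i) 2) (dual_normal_pos hφ P i)

lemma bending_eq_zero {L : ℤ → ℝ} {i : ℤ} (h : P.transition i = 0) : P.bending φ L i = 0 := by
  simp [bending, h]

lemma IsAdmissible.bending_nonneg (hφ : IsAnisotropy φ) (hP : P.IsAdmissible φ)
    (L : ℤ → ℝ) (i : ℤ) : 0 ≤ P.bending φ L i :=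
  div_nonneg (mul_nonneg (sq_nonneg _) (hP.delta_pos hφ i).le) (sq_nonneg _)

lemma IsAdmissible.energy_term_nonneg (hφ : IsAnisotropy φ) (hP : P.IsAdmissible φ) (hα : 0 < α)
    {L : ℤ → ℝ} (hL : ∀ i, 0 < L i) (i : ℤ) :
    0 ≤ dual φ (P.normal i) * L i + α * (P.transition i ^ 2 * P.delta φ i / L i) := by
  have h1 := dual_normal_pos hφ P i
  have h2 := hP.delta_pos hφ i
  have h3 := hL i
  positivity

lemma IsAdmissible.energy_nonneg (hφ : IsAnisotropy φ) (hP : P.IsAdmissible φ) (hα : 0 < α)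
    {L : ℤ → ℝ} (hL : ∀ i, 0 < L i) : 0 ≤ P.energy φ α L :=
  Finset.sum_nonneg fun i _ => hP.energy_term_nonneg hφ hα hL i

/-- The operator `lengthLoss` at a segment of zero curvature, where the two cotangents cancel. -/
lemma IsAdmissible.lengthLoss_of_transition_eq_zero (hφ : IsAnisotropy φ) (hP : P.IsAdmissible φ)
    {i : ℤ} (h : P.transition i = 0) (f : ℤ → ℝ) :
    P.lengthLoss f i = (f (i - 1) - f (i + 1)) / Real.sin (P.angle i) := by
  obtain ⟨h1, h2⟩ := hP.angle_succ_of_transition_eq_zero hφ h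
  rw [lengthLoss, Real.cot_eq_cos_div_sin, Real.cot_eq_cos_div_sin, h1, h2]
  ring

lemma IsAdmissible.speed_of_transition_eq_zero (hφ : IsAnisotropy φ) (hP : P.IsAdmissible φ)
    {i : ℤ} (h : P.transition i = 0) (L : ℤ → ℝ) :
    P.speed φ α L i = -(dual φ (P.normal i) / L i * (α *
      ((P.bending φ L (i - 1) - P.bending φ L (i + 1)) / Real.sin (P.angle i)))) := by
  rw [speed, hP.lengthLoss_of_transition_eq_zero hφ h, h, zero_mul, zero_add]

section Flow

variable {T : EReal} {Γ : ℝ → ClosedPolygon}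

/-- The dissipation of the energy per time. -/
def dissipation (P : ClosedPolygon) (φ : Plane → ℝ) (α : ℝ) (L : ℤ → ℝ) : ℝ :=
  ∑ i ∈ Finset.range P.n, L i * P.speed φ α L i ^ 2 / dual φ (P.normal i)

lemma IsElasticFlow.hasDerivAt_signedHeight (hΓ : IsElasticFlow φ α P T Γ) {t : ℝ}
    (h0 : 0 < t) (hT : (t : EReal) < T) (i : ℤ) :
    HasDerivAt (fun s => signedHeight P (Γ s) i) (P.speed φ α (Γ t).length i) t := by
  rw [← (hΓ.parallel t h0.le hT).velocity_eq]
  exact hΓ.ode i t h0 hT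

lemma IsElasticFlow.length_eqOn (hs : ∀ i, Real.sin (P.angle i) ≠ 0)
    (hΓ : IsElasticFlow φ α P T Γ) (i : ℤ) {t : ℝ} (h0 : 0 ≤ t) (hT : (t : EReal) < T) :
    (Γ t).length i = P.length i - P.lengthLoss (fun j => signedHeight P (Γ t) j) i :=
  (hΓ.parallel t h0 hT).length_eq hs i

lemma IsElasticFlow.hasDerivAt_length (hs : ∀ i, Real.sin (P.angle i) ≠ 0)
    (hΓ : IsElasticFlow φ α P T Γ) {t : ℝ} (h0 : 0 < t) (hT : (t : EReal) < T) (i : ℤ) :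
    HasDerivAt (fun s => (Γ s).length i)
      (-P.lengthLoss (fun j => P.speed φ α (Γ t).length j) i) t := by
  have h := ((hasDerivAt_lengthLoss (P := P)
    (fun j => hΓ.hasDerivAt_signedHeight h0 hT j) i).const_sub (P.length i))
  refine h.congr_of_eventuallyEq ?_
  filter_upwards [(isOpen_setOf_coe_lt T).mem_nhds ⟨h0, hT⟩] with s hs'
    using hΓ.length_eqOn hs i hs'.1.le hs'.2

lemma IsElasticFlow.continuousOn_length (hs : ∀ i, Real.sin (P.angle i) ≠ 0)
    (hΓ : IsElasticFlow φ α P T Γ) (i : ℤ) :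
    ContinuousOn (fun t => (Γ t).length i) {t : ℝ | 0 ≤ t ∧ (t : EReal) < T} := by
  have hc := hΓ.continuousOn
  refine ContinuousOn.congr (f := fun t =>
    P.length i - P.lengthLoss (fun j => signedHeight P (Γ t) j) i) ?_
    fun t ht => hΓ.length_eqOn hs i ht.1 ht.2
  exact continuousOn_const.sub ((((hc _).div_const _).add (continuousOn_const.mul (hc _))).add
    ((hc _).div_const _))

lemma IsElasticFlow.hasDerivAt_energy (hφ : IsAnisotropy φ) (hP : P.IsAdmissible φ)
    (hΓ : IsElasticFlow φ α P T Γ) {t : ℝ} (h0 : 0 < t) (hT : (t : EReal) < T) :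
    HasDerivAt (fun s => P.energy φ α (Γ s).length) (-P.dissipation φ α (Γ t).length) t := by
  have hp := hΓ.parallel t h0.le hT
  exact hP.hasDerivAt_energy hφ (L := fun i s => (Γ s).length i) (fun i => (Γ t).length_pos i)
    (fun i => by simp only [hp.1]; exact (Γ t).length_periodic i) (fun i => rfl)
    (fun i => hΓ.hasDerivAt_length (hP.sin_ne_zero hφ) h0 hT i)

lemma dissipation_nonneg (hφ : IsAnisotropy φ) {L : ℤ → ℝ} (hL : ∀ i, 0 < L i) :
    0 ≤ P.dissipation φ α L :=
  Finset.sum_nonneg fun i _ => by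
    have h1 := dual_normal_pos hφ P i
    have h3 := hL i
    positivity

lemma IsElasticFlow.energy_le (hφ : IsAnisotropy φ) (hP : P.IsAdmissible φ)
    (hΓ : IsElasticFlow φ α P T Γ) {t : ℝ} (h0 : 0 ≤ t) (hT : (t : EReal) < T) :
    P.energy φ α (Γ t).length ≤ P.energy φ α (Γ 0).length := by
  have hlt : ∀ s ∈ Set.Icc 0 t, (s : EReal) < T := fun s hs =>
    lt_of_le_of_lt (by exact_mod_cast hs.2) hT
  have hint : ∀ s ∈ interior (Set.Icc 0 t), 0 < s ∧ (s : EReal) < T := fun s hs => by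
    rw [interior_Icc] at hs
    exact ⟨hs.1, hlt s ⟨hs.1.le, hs.2.le⟩⟩
  refine antitoneOn_of_deriv_nonpos (f := fun s => P.energy φ α (Γ s).length) (convex_Icc 0 t) ?_ ?_
    ?_ ⟨le_rfl, h0⟩ ⟨h0, le_rfl⟩ h0
  · have hL : ∀ i, ContinuousOn (fun s => (Γ s).length i) (Set.Icc 0 t) := fun i =>
      (hΓ.continuousOn_length (hP.sin_ne_zero hφ) i).mono fun s hs => ⟨hs.1, hlt s hs⟩
    exact continuousOn_finsetSum _ fun i _ => (continuousOn_const.mul (hL i)).add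
      (continuousOn_const.mul (continuousOn_const.div (hL i) fun s _ => ((Γ s).length_pos i).ne'))
  · exact fun s hs => (hΓ.hasDerivAt_energy hφ hP (hint s hs).1
      (hint s hs).2).differentiableAt.differentiableWithinAt
  · intro s hs
    rw [(hΓ.hasDerivAt_energy hφ hP (hint s hs).1 (hint s hs).2).deriv, neg_nonpos]
    exact dissipation_nonneg hφ fun i => (Γ s).length_pos i

/-- The energy prevents segments of nonzero curvature from vanishing. -/
lemma IsElasticFlow.exists_forall_le_length (hφ : IsAnisotropy φ) (hα : 0 < α)
    (hP : P.IsAdmissible φ) (hΓ : IsElasticFlow φ α P T Γ) :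
    ∃ d > 0, ∀ t : ℝ, 0 ≤ t → (t : EReal) < T → ∀ i, P.transition i ≠ 0 → d ≤ (Γ t).length i := by
  set E₀ := P.energy φ α (Γ 0).length with hE₀
  have hE₀' : 0 ≤ E₀ := hP.energy_nonneg hφ hα (Γ 0).length_pos
  obtain ⟨d, hd, hdle⟩ := exists_pos_forall_le_of_periodic (n := P.n) (f := P.delta φ)
    delta_periodic (hP.delta_pos hφ)
  refine ⟨α * d / (E₀ + 1), by positivity, fun t h0 hT i hi => ?_⟩
  have hp := hΓ.parallel t h0 hT
  have hper : ∀ i, (Γ t).length (i + P.n) = (Γ t).length i := fun i => by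
    rw [hp.1]; exact (Γ t).length_periodic i
  have hterm := Finset.single_le_sum (s := Finset.range P.n)
    (f := fun j : ℕ => dual φ (P.normal j) * (Γ t).length j +
      α * (P.transition j ^ 2 * P.delta φ j / (Γ t).length j))
    (fun j _ => hP.energy_term_nonneg hφ hα (Γ t).length_pos (j : ℤ))
    (Finset.mem_range.2 (ZMod.val_lt (i : ZMod P.n)))
  rw [apply_zmod_val_of_periodic (f := fun i => dual φ (P.normal i) * (Γ t).length i +
    α * (P.transition i ^ 2 * P.delta φ i / (Γ t).length i)) (fun i => by
      simp only [normal_periodic, hper, transition_periodic, delta_periodic]),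
    transition_sq_eq_one hi, one_mul] at hterm
  have hle := hterm.trans (hΓ.energy_le hφ hP h0 hT)
  have hL := (Γ t).length_pos i
  have h1 := mul_pos (dual_normal_pos hφ P i) hL
  have h2 : α * P.delta φ i / (Γ t).length i ≤ E₀ := by rw [mul_div_assoc]; linarith
  rw [div_le_iff₀ hL] at h2
  rw [div_le_iff₀ (by positivity)]
  nlinarith [mul_le_mul_of_nonneg_left (hdle i) hα.le]

/-- The lengths of the segments of nonzero curvature are bounded below, so that the dissipation
bounds the squares of their velocities. In particular these velocities are integrable in time. -/
lemma IsElasticFlow.exists_abs_speed_le (hφ : IsAnisotropy φ) (hα : 0 < α)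
    (hP : P.IsAdmissible φ) (hΓ : IsElasticFlow φ α P T Γ) :
    ∃ C ≥ 0, ∀ t : ℝ, 0 ≤ t → (t : EReal) < T → ∀ i, P.transition i ≠ 0 →
      |P.speed φ α (Γ t).length i| ≤ 1 + C * P.dissipation φ α (Γ t).length := by
  obtain ⟨d, hd, hdle⟩ := hΓ.exists_forall_le_length hφ hα hP
  obtain ⟨B, hB⟩ := exists_forall_le_of_periodic (n := P.n) (f := fun i => dual φ (P.normal i))
    (fun i => by rw [normal_periodic])
  have hB0 : 0 < B := (dual_normal_pos hφ P 0).trans_le (hB 0)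
  refine ⟨B / d, by positivity, fun t h0 hT i hi => ?_⟩
  have hp := hΓ.parallel t h0 hT
  set L := (Γ t).length with hLdef
  have hL : ∀ i, 0 < L i := (Γ t).length_pos
  have hper : ∀ i, L (i + P.n) = L i := fun i => by
    rw [hp.1]; exact (Γ t).length_periodic i
  have hterm := Finset.single_le_sum (s := Finset.range P.n)
    (f := fun j : ℕ => L j * P.speed φ α L j ^ 2 / dual φ (P.normal j))
    (fun j _ => div_nonneg (mul_nonneg (hL _).le (sq_nonneg _)) (dual_normal_pos hφ P _).le)
    (Finset.mem_range.2 (ZMod.val_lt (i : ZMod P.n)))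
  rw [apply_zmod_val_of_periodic (f := fun i => L i * P.speed φ α L i ^ 2 / dual φ (P.normal i))
    (fun i => by simp only [normal_periodic, hper, speed_periodic hper])] at hterm
  change _ ≤ P.dissipation φ α L at hterm
  set D := P.dissipation φ α L
  set v := P.speed φ α L i
  have hdual := dual_normal_pos hφ P i
  have h1 : d * v ^ 2 ≤ B * D := by
    rw [div_le_iff₀ hdual] at hterm
    have hD : 0 ≤ D := dissipation_nonneg hφ hL
    nlinarith [mul_le_mul_of_nonneg_right (hdle t h0 hT i hi) (sq_nonneg v),
      mul_le_mul_of_nonneg_left (hB i) hD]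
  have h2 : v ^ 2 ≤ B / d * D := by
    rw [div_mul_eq_mul_div, le_div_iff₀ hd]; linarith
  have h3 : |v| ≤ 1 + v ^ 2 := by
    rw [abs_le]; constructor <;> nlinarith [sq_nonneg (v - 1), sq_nonneg (v + 1)]
  linarith

end Flow

section FiniteTime

variable {T : ℝ} {Γ : ℝ → ClosedPolygon}

lemma IsElasticFlow.exists_tendsto_signedHeight_of_ne (hφ : IsAnisotropy φ) (hα : 0 < α)
    (hP : P.IsAdmissible φ) (hΓ : IsElasticFlow φ α P T Γ) {i : ℤ} (hi : P.transition i ≠ 0) :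
    ∃ l, Tendsto (fun t => signedHeight P (Γ t) i) (𝓝[<] T) (𝓝 l) := by
  have hT : 0 < T := by exact_mod_cast hΓ.pos
  obtain ⟨C, hC, hCle⟩ := hΓ.exists_abs_speed_le hφ hα hP
  have hlt : ∀ t ∈ Set.Ioo 0 T, (t : EReal) < (T : EReal) := fun t ht => by exact_mod_cast ht.2
  refine exists_tendsto_of_abs_deriv_le hT
    (M := fun t => C * P.energy φ α (Γ t).length - t) (m := -T)
    (fun t ht => hΓ.hasDerivAt_signedHeight ht.1 (hlt t ht) i)
    (fun t ht => ((hΓ.hasDerivAt_energy hφ hP ht.1 (hlt t ht)).const_mul C).sub (hasDerivAt_id t))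
    (fun t ht => ?_) (fun t ht => ?_)
  · linarith [hCle t ht.1.le (hlt t ht) i hi]
  · have := mul_nonneg hC (hP.energy_nonneg hφ hα (Γ t).length_pos)
    linarith [ht.2]

/-- At a segment `S i` of zero curvature, the neighbours can only move towards each other in an
uncontrolled way: a neighbour of nonzero curvature is controlled by the energy, and the velocity of
a neighbour of zero curvature has the sign that shortens `S i`. As the length of `S i` is positive,
the total variations of the length and of the heights of the neighbours are bounded. -/
lemma IsElasticFlow.exists_tendsto_of_transition_eq_zero (hφ : IsAnisotropy φ) (hα : 0 < α)
    (hP : P.IsAdmissible φ) (hΓ : IsElasticFlow φ α P T Γ) {i : ℤ} (hi : P.transition i = 0) :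
    (∃ l, Tendsto (fun t => (Γ t).length i) (𝓝[<] T) (𝓝 l)) ∧
      (∃ l, Tendsto (fun t => signedHeight P (Γ t) (i - 1)) (𝓝[<] T) (𝓝 l)) ∧
      (∃ l, Tendsto (fun t => signedHeight P (Γ t) (i + 1)) (𝓝[<] T) (𝓝 l)) := by
  have hT : 0 < T := by exact_mod_cast hΓ.pos
  have hs := hP.sin_ne_zero hφ
  obtain ⟨C, hC, hCle⟩ := hΓ.exists_abs_speed_le hφ hα hP
  have hlt : ∀ t ∈ Set.Ioo 0 T, (t : EReal) < (T : EReal) := fun t ht => by exact_mod_cast ht.2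
  set s := Real.sin (P.angle i) with hsdef
  have hs0 : 0 < |s| := abs_pos.2 (hs i)
  have hsucc := (hP.angle_succ_of_transition_eq_zero hφ hi).1
  set v : ℝ → ℤ → ℝ := fun t => P.speed φ α (Γ t).length with hv
  set B : ℝ → ℝ := fun t => (1 + C * P.dissipation φ α (Γ t).length) / |s| with hBdef
  have hB0 : ∀ t, 0 ≤ B t := fun t => by
    have := dissipation_nonneg (P := P) (α := α) hφ (Γ t).length_pos
    positivity
  have hquot : ∀ t ∈ Set.Ioo 0 T, ∀ j, P.transition j ≠ 0 → |v t j / s| ≤ B t := by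
    intro t ht j hj
    rw [abs_div]
    exact div_le_div_of_nonneg_right (hCle t ht.1.le (hlt t ht) j hj) hs0.le
  have hcoef : ∀ t j, 0 ≤ dual φ (P.normal j) / (Γ t).length j * α := fun t j => by
    have h1 := dual_normal_pos hφ P j
    have h3 := (Γ t).length_pos j
    positivity
  have hsq : 0 < s ^ 2 := by have := hs i; positivity
  have hX : ∀ t ∈ Set.Ioo 0 T, -(v t (i - 1) / s) ≤ B t := by
    intro t ht
    by_cases hj : P.transition (i - 1) = 0
    · have h1 := (hP.angle_succ_of_transition_eq_zero hφ hj).1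
      rw [sub_add_cancel] at h1
      have hq := hP.bending_nonneg hφ (Γ t).length (i - 1 - 1)
      have h2 : -(v t (i - 1) / s) = -(dual φ (P.normal (i - 1)) / (Γ t).length (i - 1) * α *
          P.bending φ (Γ t).length (i - 1 - 1) / s ^ 2) := by
        rw [hv]
        simp only
        rw [hP.speed_of_transition_eq_zero hφ hj, sub_add_cancel, bending_eq_zero hi, sub_zero,
          ← neg_eq_iff_eq_neg.2 h1, ← hsdef]
        have := hs i
        field_simp
      rw [h2]
      exact (neg_nonpos.2 (div_nonneg (mul_nonneg (hcoef t _) hq) hsq.le)).trans (hB0 t)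
    · exact (neg_le_abs _).trans (hquot t ht _ hj)
  have hY : ∀ t ∈ Set.Ioo 0 T, v t (i + 1) / s ≤ B t := by
    intro t ht
    by_cases hj : P.transition (i + 1) = 0
    · have hq := hP.bending_nonneg hφ (Γ t).length (i + 1 + 1)
      have h2 : v t (i + 1) / s = -(dual φ (P.normal (i + 1)) / (Γ t).length (i + 1) * α *
          P.bending φ (Γ t).length (i + 1 + 1) / s ^ 2) := by
        rw [hv]
        simp only
        rw [hP.speed_of_transition_eq_zero hφ hj, add_sub_cancel_right, bending_eq_zero hi,
          zero_sub, hsucc, ← hsdef]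
        have := hs i
        field_simp
      rw [h2]
      exact (neg_nonpos.2 (div_nonneg (mul_nonneg (hcoef t _) hq) hsq.le)).trans (hB0 t)
    · exact (le_abs_self _).trans (hquot t ht _ hj)
  have hL : ∀ t ∈ Set.Ioo 0 T,
      HasDerivAt (fun t => (Γ t).length i) (-(v t (i - 1) / s) + v t (i + 1) / s) t := by
    intro t ht
    convert hΓ.hasDerivAt_length hs ht.1 (hlt t ht) i using 1
    rw [hP.lengthLoss_of_transition_eq_zero hφ hi]
    ring
  have hM : ∀ t ∈ Set.Ioo 0 T, HasDerivAt
      (fun t => (Γ t).length i + 4 * ((C * P.energy φ α (Γ t).length - t) / |s|))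
      (-(v t (i - 1) / s) + v t (i + 1) / s - 4 * B t) t := by
    intro t ht
    refine ((hL t ht).add (((((hΓ.hasDerivAt_energy hφ hP ht.1 (hlt t ht)).const_mul C).sub
      (hasDerivAt_id t)).div_const |s|).const_mul 4)).congr_deriv ?_
    rw [hBdef]
    ring
  have hm : ∀ t ∈ Set.Ioo 0 T, 4 * ((0 - T) / |s|) ≤
      (Γ t).length i + 4 * ((C * P.energy φ α (Γ t).length - t) / |s|) := by
    intro t ht
    have h1 := mul_nonneg hC (hP.energy_nonneg hφ hα (Γ t).length_pos)
    have h2 : (0 - T) / |s| ≤ (C * P.energy φ α (Γ t).length - t) / |s| :=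
      div_le_div_of_nonneg_right (by linarith [ht.2]) hs0.le
    linarith [(Γ t).length_pos i]
  have hneigh : ∀ j, (∀ t ∈ Set.Ioo 0 T, |v t j / s| ≤
      -(-(v t (i - 1) / s) + v t (i + 1) / s - 4 * B t)) →
      ∃ l, Tendsto (fun t => signedHeight P (Γ t) j) (𝓝[<] T) (𝓝 l) := by
    intro j hj
    obtain ⟨l, hl⟩ := exists_tendsto_of_abs_deriv_le hT
      (fun t ht => (hΓ.hasDerivAt_signedHeight ht.1 (hlt t ht) j).div_const s) hM hj hm
    exact ⟨l * s, (hl.mul_const s).congr fun t => div_mul_cancel₀ _ (hs i)⟩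
  refine ⟨exists_tendsto_of_abs_deriv_le hT hL hM (fun t ht => ?_) hm,
    hneigh _ fun t ht => ?_, hneigh _ fun t ht => ?_⟩ <;>
  · have h1 := hX t ht
    have h2 := hY t ht
    have h3 := hB0 t
    rw [abs_le]
    constructor <;> linarith

lemma IsElasticFlow.exists_tendsto_signedHeight_of_length_pos (hφ : IsAnisotropy φ) (hα : 0 < α)
    (hP : P.IsAdmissible φ) (hΓ : IsElasticFlow φ α P T Γ) {i : ℤ} (hi : P.transition i = 0)
    {l : ℝ} (hl : 0 < l) (hlim : Tendsto (fun t => (Γ t).length i) (𝓝[<] T) (𝓝 l)) :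
    ∃ l, Tendsto (fun t => signedHeight P (Γ t) i) (𝓝[<] T) (𝓝 l) := by
  have hT : 0 < T := by exact_mod_cast hΓ.pos
  obtain ⟨d, hd, hdle⟩ := hΓ.exists_forall_le_length hφ hα hP
  have hev := (hlim.eventually (lt_mem_nhds (half_lt_self hl))).and (Ioo_mem_nhdsLT hT)
  obtain ⟨a, haT, ha⟩ := mem_nhdsLT_iff_exists_Ioo_subset.1 hev
  have haT' : a < T := haT
  have hlt : ∀ t ∈ Set.Ioo a T, (t : EReal) < (T : EReal) := fun t ht => by exact_mod_cast ht.2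
  have hq : ∀ t ∈ Set.Ioo a T, ∀ j, P.bending φ (Γ t).length j ≤ P.delta φ j / d ^ 2 := by
    intro t ht j
    have hδ := hP.delta_pos hφ j
    by_cases hj : P.transition j = 0
    · rw [bending_eq_zero hj]; positivity
    · rw [bending, transition_sq_eq_one hj, one_mul]
      exact div_le_div_of_nonneg_left hδ.le (by positivity)
        (pow_le_pow_left₀ hd.le (hdle t (ha ht).2.1.le (hlt t ht) j hj) 2)
  have hdual := dual_normal_pos hφ P i
  set Q := P.delta φ (i - 1) / d ^ 2 + P.delta φ (i + 1) / d ^ 2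
  set K := dual φ (P.normal i) / (l / 2) * (α * (Q / |Real.sin (P.angle i)|))
  refine exists_tendsto_of_abs_deriv_le haT' (M := fun t => -(K * t)) (m := -(K * T))
    (fun t ht => hΓ.hasDerivAt_signedHeight (ha ht).2.1 (hlt t ht) i)
    (fun t ht => ((hasDerivAt_id t).const_mul K).neg) (fun t ht => ?_) (fun t ht => ?_)
  · have hLt : l / 2 < (Γ t).length i := (ha ht).1
    have hL := (Γ t).length_pos i
    have hb : ∀ j, 0 ≤ P.bending φ (Γ t).length j := hP.bending_nonneg hφ _
    have hQ : |P.bending φ (Γ t).length (i - 1) - P.bending φ (Γ t).length (i + 1)| ≤ Q := by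
      have h1 := hq t ht (i - 1)
      have h2 := hq t ht (i + 1)
      rw [abs_le]
      constructor <;> linarith [hb (i - 1), hb (i + 1)]
    rw [hP.speed_of_transition_eq_zero hφ hi, abs_neg, abs_mul, abs_mul, abs_div, abs_of_pos hα,
      abs_div, abs_of_pos hdual, abs_of_pos hL, mul_one, neg_neg]
    have hQ0 : 0 ≤ Q := (abs_nonneg _).trans hQ
    exact mul_le_mul (div_le_div_of_nonneg_left hdual.le (by positivity) hLt.le)
      (mul_le_mul_of_nonneg_left (div_le_div_of_nonneg_right hQ (abs_nonneg _)) hα.le)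
      (by positivity) (by positivity)
  · have hK : 0 ≤ K := by
      have h1 := hP.delta_pos hφ (i - 1)
      have h2 := hP.delta_pos hφ (i + 1)
      positivity
    linarith [mul_le_mul_of_nonneg_left ht.2.le hK]

/-- If the maximal time is finite, then a segment of zero curvature vanishes. -/
lemma IsUniqueMaximalElasticFlow.exists_tendsto_length_zero (hφ : IsAnisotropy φ) (hα : 0 < α)
    (hP : P.IsAdmissible φ) (hΓ : IsUniqueMaximalElasticFlow φ α P T Γ) :
    ∃ i, P.transition i = 0 ∧ Tendsto (fun t => (Γ t).length i) (𝓝[<] T) (𝓝 0) := by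
  have hflow := hΓ.1.1
  have hT : 0 < T := by exact_mod_cast hflow.pos
  by_contra! hcon
  have hzero : ∀ i, P.transition i = 0 →
      ∃ l > 0, Tendsto (fun t => (Γ t).length i) (𝓝[<] T) (𝓝 l) := by
    intro i hi
    obtain ⟨l, hl⟩ := (hflow.exists_tendsto_of_transition_eq_zero hφ hα hP hi).1
    refine ⟨l, lt_of_le_of_ne ?_ ?_, hl⟩
    · exact ge_of_tendsto' hl fun t => ((Γ t).length_pos i).le
    · rintro rfl; exact hcon i hi hl
  have hheight : ∀ i, ∃ l, Tendsto (fun t => signedHeight P (Γ t) i) (𝓝[<] T) (𝓝 l) := by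
    intro i
    by_cases hi : P.transition i = 0
    · obtain ⟨l, hl, hlim⟩ := hzero i hi
      exact hflow.exists_tendsto_signedHeight_of_length_pos hφ hα hP hi hl hlim
    · exact hflow.exists_tendsto_signedHeight_of_ne hφ hα hP hi
  choose l hl using hheight
  obtain ⟨i, a, ha, hlim⟩ := hΓ.exists_tendsto_length_nonpos (hP.sin_ne_zero hφ) hl
  by_cases hi : P.transition i = 0
  · obtain ⟨l, hl, hlim'⟩ := hzero i hi
    have := tendsto_nhds_unique hlim hlim'
    linarith
  · obtain ⟨d, hd, hdle⟩ := hflow.exists_forall_le_length hφ hα hP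
    have : d ≤ a := by
      refine ge_of_tendsto hlim ?_
      filter_upwards [Ioo_mem_nhdsLT hT] with t ht
        using hdle t ht.1.le (by exact_mod_cast ht.2) i hi
    linarith

end FiniteTime

end ClosedPolygon

/-! ### Piecewise affine paths -/

section Interp

variable {E : Type*} [NormedAddCommGroup E] [NormedSpace ℝ E]

/-- The continuous map that is affine between consecutive integers and extends `v`. -/
def interp (v : ℤ → E) (x : ℝ) : E := AffineMap.lineMap (v ⌊x⌋) (v (⌊x⌋ + 1)) (Int.fract x)

lemma interp_eq (v : ℤ → E) {i : ℤ} {x : ℝ} (h1 : (i : ℝ) ≤ x) (h2 : x ≤ i + 1) :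
    interp v x = AffineMap.lineMap (v i) (v (i + 1)) (x - i) := by
  rcases h2.lt_or_eq with h2 | rfl
  · have : ⌊x⌋ = i := Int.floor_eq_iff.2 ⟨h1, h2⟩
    rw [interp, Int.fract, this]
  · have hf : ⌊(i : ℝ) + 1⌋ = i + 1 := by exact_mod_cast Int.floor_intCast (R := ℝ) (i + 1)
    rw [interp, Int.fract, hf]
    simp

lemma interp_intCast (v : ℤ → E) (i : ℤ) : interp v i = v i := by
  rw [interp_eq v le_rfl (by linarith : (i : ℝ) ≤ i + 1), sub_self, AffineMap.lineMap_apply_zero]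

lemma interp_add_natCast {v : ℤ → E} {n : ℕ} {c : E} (hv : ∀ i, v (i + n) = v i + c) (x : ℝ) :
    interp v (x + n) = interp v x + c := by
  have h1 : ⌊x + n⌋ = ⌊x⌋ + n := Int.floor_add_natCast x n
  rw [interp, interp, h1, Int.fract_add_natCast, add_right_comm, hv, hv]
  simp only [AffineMap.lineMap_apply, vsub_eq_sub, vadd_eq_add, add_sub_add_right_eq_sub]
  abel

lemma continuous_interp (v : ℤ → E) : Continuous (interp v) := by
  refine continuous_iff_continuousAt.2 fun x => ?_
  set i := ⌊x⌋
  have h1 : (i : ℝ) ≤ x := Int.floor_le x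
  have h2 : x < i + 1 := Int.lt_floor_add_one x
  have hc : Continuous fun y : ℝ => if y ≤ (i : ℝ)
      then AffineMap.lineMap (v (i - 1)) (v (i - 1 + 1)) (y - ((i - 1 : ℤ) : ℝ))
      else AffineMap.lineMap (v i) (v (i + 1)) (y - i) := by
    refine Continuous.if_le ?_ ?_ continuous_id continuous_const ?_
    · exact AffineMap.lineMap_continuous.comp (by fun_prop)
    · exact AffineMap.lineMap_continuous.comp (by fun_prop)
    · rintro y rfl; simp
  refine hc.continuousAt.congr ?_
  filter_upwards [Ioo_mem_nhds (by linarith : (i : ℝ) - 1 < x) h2] with y hy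
  split_ifs with h
  · exact (interp_eq v (by push_cast; linarith [hy.1]) (by push_cast; linarith)).symm
  · exact (interp_eq v (not_le.1 h).le hy.2.le).symm

lemma interp_mem_Icc {σ : ℤ → ℝ} (hσ : Monotone σ) (x : ℝ) :
    interp σ x ∈ Set.Icc (σ ⌊x⌋) (σ (⌊x⌋ + 1)) :=
  (convex_Icc _ _).lineMap_mem ⟨le_rfl, hσ (by lia)⟩ ⟨hσ (by lia), le_rfl⟩
    ⟨Int.fract_nonneg x, (Int.fract_lt_one x).le⟩

lemma monotone_interp {σ : ℤ → ℝ} (hσ : Monotone σ) : Monotone (interp σ) := by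
  intro x y hxy
  rcases (Int.floor_mono hxy).eq_or_lt with h | h
  · have hf : Int.fract x ≤ Int.fract y := by rw [Int.fract, Int.fract, h]; linarith
    have hstep : σ ⌊y⌋ ≤ σ (⌊y⌋ + 1) := hσ (by lia)
    rw [interp, interp, h, AffineMap.lineMap_apply_ring', AffineMap.lineMap_apply_ring']
    nlinarith
  · exact (interp_mem_Icc hσ x).2.trans ((hσ (by lia)).trans (interp_mem_Icc hσ y).1)

/-- `interp w` is affine on the cells `[k, k + 1]`, so that it commutes with the interpolation of
points of a single cell. -/
lemma interp_lineMap (w : ℤ → E) {k : ℤ} {a b s : ℝ} (ha : a ∈ Set.Icc (k : ℝ) (k + 1))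
    (hb : b ∈ Set.Icc (k : ℝ) (k + 1)) (hs : s ∈ Set.Icc (0 : ℝ) 1) :
    interp w (AffineMap.lineMap a b s) = AffineMap.lineMap (interp w a) (interp w b) s := by
  have hm := (convex_Icc (k : ℝ) (k + 1)).lineMap_mem ha hb hs
  rw [interp_eq w hm.1 hm.2, interp_eq w ha.1 ha.2, interp_eq w hb.1 hb.2]
  simp only [AffineMap.lineMap_apply, vsub_eq_sub, vadd_eq_add, smul_eq_mul]
  module

lemma dist_lineMap_lineMap_lt {a b c d : E} {s ε : ℝ} (hs : s ∈ Set.Icc (0 : ℝ) 1)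
    (h1 : dist a c < ε) (h2 : dist b d < ε) :
    dist (AffineMap.lineMap a b s) (AffineMap.lineMap c d s) < ε := by
  have h := (convex_ball (0 : E) ε).lineMap_mem (x := a - c) (y := b - d)
    (by simpa [dist_eq_norm] using h1) (by simpa [dist_eq_norm] using h2) hs
  rw [mem_ball_zero_iff] at h
  have heq : AffineMap.lineMap a b s - AffineMap.lineMap c d s =
      AffineMap.lineMap (a - c) (b - d) s := by
    simp only [AffineMap.lineMap_apply, vsub_eq_sub, vadd_eq_add]
    module
  rwa [dist_eq_norm, heq]

end Interp

lemma map_add_intCast_mul {f : ℝ → ℝ} {c d : ℝ} (hc : c ≠ 0) (hf : ∀ x, f (x + c) = f x + d)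
    (x : ℝ) (k : ℤ) : f (x + k * c) = f x + k * d := by
  have hp : Function.Periodic (fun x => f x - d / c * x) c := fun x => by
    simp only [hf]; field_simp; ring
  have := (hp.int_mul k) x
  have h2 : d / c * (x + k * c) = d / c * x + k * d := by field_simp
  linarith

lemma surjective_of_map_add {f : ℝ → ℝ} {c d : ℝ} (hc : 0 < c) (hd : 0 < d) (hcont : Continuous f)
    (hmono : Monotone f) (hf : ∀ x, f (x + c) = f x + d) : Function.Surjective f := by
  have key := fun k : ℤ => map_add_intCast_mul hc.ne' hf 0 k
  refine hcont.surjective (tendsto_atTop_atTop_of_monotone hmono fun b => ?_)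
    (tendsto_atBot_atBot_of_monotone hmono fun b => ?_)
  · refine ⟨0 + ⌈(b - f 0) / d⌉ * c, ?_⟩
    rw [key]
    have := (div_le_iff₀ hd).1 (Int.le_ceil ((b - f 0) / d))
    linarith
  · refine ⟨0 + ⌊(b - f 0) / d⌋ * c, ?_⟩
    rw [key]
    have := (le_div_iff₀ hd).1 (Int.floor_le ((b - f 0) / d))
    linarith

namespace ClosedPolygon

/-! ### Uniform closeness of closed curves -/

section UniformlyClose

variable {P Q R : ClosedPolygon} {ε : ℝ}

lemma path_eq_interp (P : ClosedPolygon) : P.path = interp P.vertex := rfl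

lemma continuous_path (P : ClosedPolygon) : Continuous P.path := continuous_interp _

lemma path_intCast (P : ClosedPolygon) (i : ℤ) : P.path i = P.vertex i := interp_intCast _ i

lemma path_add_n (P : ClosedPolygon) (x : ℝ) : P.path (x + P.n) = P.path x := by
  have := interp_add_natCast (v := P.vertex) (n := P.n) (c := 0) (by simp [P.periodic]) x
  simpa [path_eq_interp] using this

lemma path_eq (P : ClosedPolygon) {i : ℤ} {x : ℝ} (h1 : (i : ℝ) ≤ x) (h2 : x ≤ i + 1) :
    P.path x = P.vertex i + ((x - i) * P.length i) • P.tangent i := by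
  rw [path_eq_interp, interp_eq _ h1 h2, P.vertex_succ, AffineMap.lineMap_apply, vsub_eq_sub,
    vadd_eq_add, add_sub_cancel_left, smul_smul, add_comm]

lemma path_sub_path (P : ClosedPolygon) {i : ℤ} {x y : ℝ} (hx : x ∈ Set.Icc (i : ℝ) (i + 1))
    (hy : y ∈ Set.Icc (i : ℝ) (i + 1)) :
    P.path y - P.path x = ((y - x) * P.length i) • P.tangent i := by
  rw [P.path_eq hx.1 hx.2, P.path_eq hy.1 hy.2, add_sub_add_left_eq_sub, ← sub_smul]
  congr 1; ring

lemma range_path (P : ClosedPolygon) : Set.range P.path = P.trace := by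
  ext y
  simp only [trace, Set.mem_iUnion, segment_eq_image_lineMap, Set.mem_range, Set.mem_image]
  constructor
  · rintro ⟨x, rfl⟩
    exact ⟨⌊x⌋, Int.fract x, ⟨Int.fract_nonneg x, (Int.fract_lt_one x).le⟩, rfl⟩
  · rintro ⟨i, s, hs, rfl⟩
    refine ⟨i + s, ?_⟩
    rw [path_eq_interp, interp_eq (i := i) _ (by linarith [hs.1]) (by linarith [hs.2]),
      add_sub_cancel_left]

lemma isClosed_trace (P : ClosedPolygon) : IsClosed P.trace := by
  have hn : (0 : ℝ) < P.n := by exact_mod_cast P.n_pos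
  have h := Function.Periodic.image_Icc (f := P.path) P.path_add_n hn 0
  rw [← P.range_path, ← h]
  exact (isCompact_Icc.image P.continuous_path).isClosed

/-- Closeness of two polygons from a monotone correspondence `σ` of the vertices of the first one
with points of the second one. -/
lemma uniformlyClose_of_vertices (σ : ℤ → ℝ) (hσ : Monotone σ)
    (hper : ∀ i, σ (i + R.n) = σ i + Q.n)
    (hcell : ∀ i, ∃ k : ℤ, (k : ℝ) ≤ σ i ∧ σ (i + 1) ≤ k + 1)
    (hdist : ∀ i, dist (R.vertex i) (Q.path (σ i)) < ε) : UniformlyClose ε R Q := by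
  refine ⟨interp σ, continuous_interp σ, monotone_interp hσ, interp_add_natCast hper, fun x => ?_⟩
  obtain ⟨k, hk1, hk2⟩ := hcell ⌊x⌋
  have hs : Int.fract x ∈ Set.Icc (0 : ℝ) 1 := ⟨Int.fract_nonneg x, (Int.fract_lt_one x).le⟩
  have hstep : σ ⌊x⌋ ≤ σ (⌊x⌋ + 1) := hσ (by lia)
  rw [path_eq_interp Q, interp.eq_1 σ, interp_lineMap _ ⟨hk1, hstep.trans hk2⟩
    ⟨hk1.trans hstep, hk2⟩ hs]
  exact dist_lineMap_lineMap_lt hs (hdist _) (hdist _)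

lemma SameCurve.uniformlyClose (h : SameCurve P Q) (hQ : UniformlyClose ε Q R) :
    UniformlyClose ε P R := by
  obtain ⟨hn, k, hk⟩ := h
  obtain ⟨ρ, hc, hm, hp, hd⟩ := hQ
  have hpath : ∀ x, P.path x = Q.path (x + k) := fun x => by
    simp only [path, Int.floor_add_intCast, Int.fract_add_intCast, hk, add_right_comm]
  exact ⟨fun x => ρ (x + k), by fun_prop, fun x y hxy => hm (by linarith), fun x => by
    simp only [hn, add_right_comm x, hp], fun x => by rw [hpath]; exact hd _⟩

lemma kuratowskiTendsto_of_uniformlyClose {A : ℝ → ClosedPolygon} {l : Filter ℝ}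
    (h : ∀ ε > 0, ∀ᶠ t in l, UniformlyClose ε (A t) P) :
    KuratowskiTendsto (fun t => (A t).trace) l P.trace := by
  refine ⟨fun x hx => ?_, fun x hx ε hε => ?_⟩
  · rw [← P.isClosed_trace.closure_eq, Metric.mem_closure_iff]
    intro ε hε
    obtain ⟨t, ⟨y, hy, hyx⟩, ρ, -, -, -, hρ⟩ :=
      ((hx (ε / 2) (by linarith)).and_eventually (h (ε / 2) (by linarith))).exists
    replace hy : y ∈ (A t).trace := hy
    rw [← range_path] at hy
    obtain ⟨u, rfl⟩ := hy
    refine ⟨P.path (ρ u), by rw [← range_path]; exact ⟨_, rfl⟩, ?_⟩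
    calc dist x (P.path (ρ u)) ≤ dist x ((A t).path u) + dist ((A t).path u) (P.path (ρ u)) :=
          dist_triangle _ _ _
      _ < ε := by rw [dist_comm x]; linarith [hρ u]
  · rw [← range_path] at hx
    obtain ⟨s, rfl⟩ := hx
    filter_upwards [h ε hε] with t ⟨ρ, hc, hm, hp, hd⟩
    obtain ⟨u, rfl⟩ := surjective_of_map_add (by exact_mod_cast (A t).n_pos)
      (by exact_mod_cast P.n_pos) hc hm hp s
    exact ⟨(A t).path u, by rw [← range_path]; exact ⟨_, rfl⟩, hd u⟩

end UniformlyClose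

/-! ### Closed polygons with corners are determined by their uniform limits -/

/-- Two closed polygons run through by a common parameter: `f` and `g` are monotone, translate a
period `c` to the periods of `P` and `Q`, and are normalized by the condition that the sum of their
increments is the increment of the parameter. -/
structure Reparam (P Q : ClosedPolygon) (c : ℝ) (f g : ℝ → ℝ) : Prop where
  monotone_left : Monotone f
  monotone_right : Monotone g
  add_eq : ∀ s s', (f s' - f s) + (g s' - g s) = s' - s
  left_add : ∀ s, f (s + c) = f s + P.n
  right_add : ∀ s, g (s + c) = g s + Q.n

section Reparam

variable {P Q : ClosedPolygon} {c : ℝ} {f g : ℝ → ℝ}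

lemma Reparam.symm (h : Reparam P Q c f g) : Reparam Q P c g f :=
  ⟨h.2, h.1, fun s s' => by rw [add_comm]; exact h.3 s s', h.5, h.4⟩

lemma Reparam.continuous_left (h : Reparam P Q c f g) : Continuous f := by
  refine (LipschitzWith.of_dist_le_mul (K := 1) fun x y => ?_).continuous
  wlog hxy : x ≤ y generalizing x y
  · rw [dist_comm, dist_comm x]; exact this y x (le_of_not_ge hxy)
  have h1 := h.monotone_left hxy
  have h2 := h.monotone_right hxy
  have h3 := h.add_eq x y
  rw [Real.dist_eq, Real.dist_eq, abs_of_nonpos (by linarith), abs_of_nonpos (by linarith)]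
  simp
  linarith

lemma Reparam.pos (h : Reparam P Q c f g) : 0 < c := by
  have h1 := h.add_eq 0 (0 + c)
  rw [h.left_add, h.right_add] at h1
  have h2 : (0 : ℝ) < P.n := by exact_mod_cast P.n_pos
  have h3 : (0 : ℝ) < Q.n := by exact_mod_cast Q.n_pos
  linarith

lemma Reparam.surjective_left (h : Reparam P Q c f g) : Function.Surjective f :=
  surjective_of_map_add h.pos (by exact_mod_cast P.n_pos) h.continuous_left h.monotone_left
    h.left_add

/-- Neither polygon stops, and hence neither parametrization does. -/
lemma Reparam.strictMono_left (h : Reparam P Q c f g) (heq : ∀ s, P.path (f s) = Q.path (g s)) :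
    StrictMono f := by
  refine h.monotone_left.strictMono_of_injective ?_
  intro s s' hss
  wlog hlt : s < s' generalizing s s'
  · rcases (not_lt.1 hlt).lt_or_eq with hlt | hlt
    · exact (this hss.symm hlt).symm
    · exact hlt.symm
  exfalso
  set k := ⌊g s⌋
  have hk1 : (k : ℝ) ≤ g s := Int.floor_le _
  have hk2 : g s < k + 1 := Int.lt_floor_add_one _
  -- A parameter slightly larger than `s`, for which `g` is in the same cell.
  set r := min s' (s + (k + 1 - g s))
  have hr1 : s < r := lt_min hlt (by linarith)
  have hr2 : r ≤ s' := min_le_left _ _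
  have hfr : f r = f s := le_antisymm ((h.monotone_left hr2).trans hss.ge) (h.monotone_left hr1.le)
  have hgr : g r = g s + (r - s) := by have := h.add_eq s r; linarith
  have hgr' : g r ≤ k + 1 := by
    have := min_le_right s' (s + (k + 1 - g s)); linarith
  have h1 := Q.path_sub_path (i := k) (x := g s) (y := g r) ⟨hk1, hk2.le⟩ ⟨by linarith, hgr'⟩
  rw [← heq, ← heq, hfr, sub_self] at h1
  have h2 := congrArg norm h1
  rw [norm_zero, norm_smul, norm_tangent, mul_one, Real.norm_eq_abs, eq_comm, abs_eq_zero,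
    mul_eq_zero] at h2
  rcases h2 with h2 | h2
  · linarith
  · exact (Q.length_pos k).ne' h2

/-- A corner of one polygon cannot be an interior point of a segment of the other one. -/
lemma Reparam.exists_intCast_right (h : Reparam P Q c f g)
    (heq : ∀ s, P.path (f s) = Q.path (g s)) {i : ℤ} (hi : Real.sin (P.angle i) ≠ 0) {s : ℝ}
    (hs : f s = i) : ∃ j : ℤ, g s = j := by
  by_contra! hcon
  set j := ⌊g s⌋
  have hj1 : (j : ℝ) < g s := lt_of_le_of_ne (Int.floor_le _) (hcon j).symm
  have hj2 : g s < j + 1 := Int.lt_floor_add_one _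
  have hmono := h.strictMono_left heq
  have hev : ∀ᶠ r in 𝓝 s, g r ∈ Set.Ioo (j : ℝ) (j + 1) ∧ f r ∈ Set.Ioo ((i : ℝ) - 1) (i + 1) :=
    (h.symm.continuous_left.continuousAt.eventually (Ioo_mem_nhds hj1 hj2)).and
      (h.continuous_left.continuousAt.eventually
        (Ioo_mem_nhds (by rw [hs]; linarith) (by rw [hs]; linarith)))
  obtain ⟨δ, hδ, hball⟩ := Metric.eventually_nhds_iff.1 hev
  have hin : ∀ r, f r ∈ Set.Icc ((i : ℝ) - 1) (i + 1) → g r ∈ Set.Ioo (j : ℝ) (j + 1) →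
      ∃ b : ℝ, P.path (f r) - P.path (f s) = b • Q.tangent j := fun r _ hg => by
    rw [heq, heq]
    exact ⟨_, Q.path_sub_path ⟨hj1.le, hj2.le⟩ ⟨hg.1.le, hg.2.le⟩⟩
  obtain ⟨hg1, hf1⟩ := hball (y := s - δ / 2) (by
    rw [Real.dist_eq, abs_lt]; constructor <;> linarith)
  obtain ⟨hg2, hf2⟩ := hball (y := s + δ / 2) (by
    rw [Real.dist_eq, abs_lt]; constructor <;> linarith)
  have hl1 := hmono (show s - δ / 2 < s by linarith)
  have hl2 := hmono (show s < s + δ / 2 by linarith)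
  rw [hs] at hl1 hl2
  obtain ⟨b1, hb1⟩ := hin _ ⟨hf1.1.le, hf1.2.le⟩ hg1
  obtain ⟨b2, hb2⟩ := hin _ ⟨hf2.1.le, hf2.2.le⟩ hg2
  rw [hs] at hb1 hb2
  rw [P.path_sub_path (i := i - 1) (by push_cast; constructor <;> linarith)
    (by push_cast; exact ⟨hf1.1.le, by linarith⟩)] at hb1
  rw [P.path_sub_path (i := i) ⟨le_rfl, by linarith⟩ ⟨hl2.le, hf2.2.le⟩] at hb2
  set a1 := (f (s - δ / 2) - i) * P.length (i - 1)
  set a2 := (f (s + δ / 2) - i) * P.length i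
  have ha1 : a1 ≠ 0 := (mul_neg_of_neg_of_pos (by linarith) (P.length_pos _)).ne
  have ha2 : a2 ≠ 0 := (mul_pos (by linarith) (P.length_pos _)).ne'
  have ht1 : P.tangent (i - 1) = (a1⁻¹ * b1) • Q.tangent j := by
    rw [mul_smul, ← hb1, smul_smul, inv_mul_cancel₀ ha1, one_smul]
  have ht2 : P.tangent i = (a2⁻¹ * b2) • Q.tangent j := by
    rw [mul_smul, ← hb2, smul_smul, inv_mul_cancel₀ ha2, one_smul]
  apply hi
  rw [sin_angle, normal, ht1, ht2, inner_plane]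
  simp
  ring

lemma Reparam.sameCurve (h : Reparam P Q c f g) (heq : ∀ s, P.path (f s) = Q.path (g s))
    (hP : ∀ i, Real.sin (P.angle i) ≠ 0) (hQ : ∀ i, Real.sin (Q.angle i) ≠ 0) : SameCurve P Q := by
  have hf := h.strictMono_left heq
  have hg := h.symm.strictMono_left fun s => (heq s).symm
  choose s hs using fun i : ℤ => h.surjective_left (i : ℝ)
  choose k hk using fun i : ℤ => h.exists_intCast_right heq (hP i) (hs i)
  have hsucc : ∀ i, k (i + 1) = k i + 1 := by
    intro i
    have hlt : s i < s (i + 1) := hf.lt_iff_lt.1 (by rw [hs, hs]; push_cast; linarith)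
    have hklt : k i < k (i + 1) := by
      have := hg hlt; rw [hk, hk] at this; exact_mod_cast this
    by_contra hne
    -- Otherwise `Q` has a vertex strictly between, which would be a vertex of `P`.
    obtain ⟨t, ht⟩ := h.symm.surjective_left ((k i + 1 : ℤ) : ℝ)
    obtain ⟨m, hm⟩ := h.symm.exists_intCast_right (fun s => (heq s).symm) (hQ _) ht
    have h1 : s i < t := hg.lt_iff_lt.1 (by rw [hk, ht]; push_cast; linarith)
    have h2 : t < s (i + 1) := hg.lt_iff_lt.1 (by rw [hk, ht]; exact_mod_cast (by lia))
    have h3 := hf h1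
    have h4 := hf h2
    rw [hs, hm] at h3 h4
    have h3' : i < m := by exact_mod_cast h3
    have h4' : m < i + 1 := by exact_mod_cast h4
    lia
  have hlin : ∀ i, k i = i + k 0 := by
    intro i
    induction i with
    | zero => simp
    | succ i ih => rw [hsucc, ih]; ring
    | pred i ih => have := hsucc (-i - 1); rw [sub_add_cancel, ih] at this; lia
  refine ⟨?_, k 0, fun i => ?_⟩
  · have h1 : s (P.n : ℤ) = s 0 + c := hf.injective (by
      rw [h.left_add, hs, hs]; simp)
    have h2 := hk (P.n : ℤ)
    rw [h1, h.right_add, hk, hlin P.n] at h2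
    have h3 : k 0 + (Q.n : ℤ) = (P.n : ℤ) + k 0 := by exact_mod_cast h2
    lia
  · have := heq (s i)
    rwa [hs, hk, path_intCast, path_intCast, hlin] at this

end Reparam

/-- Two polygons that are close to a common third one are close in a common parametrization. -/
lemma exists_reparam {P Q R : ClosedPolygon} {ε : ℝ} (h1 : UniformlyClose ε R P)
    (h2 : UniformlyClose ε R Q) : ∃ f g, Reparam P Q (P.n + Q.n) f g ∧
      f 0 ∈ Set.Icc (0 : ℝ) P.n ∧ g 0 ∈ Set.Icc (0 : ℝ) Q.n ∧
      ∀ s, dist (P.path (f s)) (Q.path (g s)) < 2 * ε := by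
  obtain ⟨ρ, hc, hm, hp, hd⟩ := h1
  obtain ⟨ρ', hc', hm', hp', hd'⟩ := h2
  have hnR : (0 : ℝ) < R.n := by exact_mod_cast R.n_pos
  have hnP : (0 : ℝ) < P.n := by exact_mod_cast P.n_pos
  have hnQ : (0 : ℝ) < Q.n := by exact_mod_cast Q.n_pos
  have hadd : ∀ x, (ρ + ρ') (x + R.n) = (ρ + ρ') x + (P.n + Q.n) := fun x => by
    simp only [Pi.add_apply, hp, hp']; ring
  have hsurj := surjective_of_map_add hnR (by linarith) (hc.add hc') (hm.add hm') hadd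
  choose x hx using hsurj
  simp only [Pi.add_apply] at hx hadd
  have hlt : ∀ a b, a < b → x a ≤ x b := fun a b hab => by
    by_contra hlt
    have e1 := hm (not_le.1 hlt).le
    have e2 := hm' (not_le.1 hlt).le
    have := hx a; have := hx b
    linarith
  have hmono : Monotone x := fun a b hab => by
    rcases hab.eq_or_lt with rfl | hab
    exacts [le_rfl, hlt a b hab]
  -- The sum of two monotone functions determines both.
  have hdet : ∀ y z, ρ y + ρ' y = ρ z + ρ' z → ρ y = ρ z ∧ ρ' y = ρ' z := by
    intro y z hyz
    rcases le_total y z with hle | hle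
    · have e1 := hm hle; have e2 := hm' hle; constructor <;> linarith
    · have e1 := hm hle; have e2 := hm' hle; constructor <;> linarith
  have hshift : ∀ s, ρ (x (s + (P.n + Q.n))) = ρ (x s) + P.n ∧
      ρ' (x (s + (P.n + Q.n))) = ρ' (x s) + Q.n := fun s => by
    have := hdet (x (s + (P.n + Q.n))) (x s + R.n) (by rw [hx, hadd, hx])
    rw [hp, hp'] at this
    exact this
  set a : ℤ := ⌊ρ (x 0) / P.n⌋
  set b : ℤ := ⌊ρ' (x 0) / Q.n⌋
  have hPper : ∀ y, P.path (y - a * P.n) = P.path y := fun y =>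
    (show Function.Periodic P.path P.n from P.path_add_n).sub_int_mul_eq a
  have hQper : ∀ y, Q.path (y - b * Q.n) = Q.path y := fun y =>
    (show Function.Periodic Q.path Q.n from Q.path_add_n).sub_int_mul_eq b
  refine ⟨fun s => ρ (x s) - a * P.n, fun s => ρ' (x s) - b * Q.n, ⟨?_, ?_, ?_, ?_, ?_⟩, ?_, ?_, ?_⟩
  · exact fun s s' hss => sub_le_sub_right (hm (hmono hss)) _
  · exact fun s s' hss => sub_le_sub_right (hm' (hmono hss)) _
  · intro s s'
    have := hx s; have := hx s'
    linarith
  · intro s; simp only [hshift]; ring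
  · intro s; simp only [hshift]; ring
  · have e1 := (le_div_iff₀ hnP).1 (Int.floor_le (ρ (x 0) / P.n))
    have e2 := (div_le_iff₀ hnP).1 (Int.lt_floor_add_one (ρ (x 0) / P.n)).le
    constructor <;> linarith
  · have e1 := (le_div_iff₀ hnQ).1 (Int.floor_le (ρ' (x 0) / Q.n))
    have e2 := (div_le_iff₀ hnQ).1 (Int.lt_floor_add_one (ρ' (x 0) / Q.n)).le
    constructor <;> linarith
  · intro s
    rw [hPper, hQper]
    calc dist (P.path (ρ (x s))) (Q.path (ρ' (x s)))
        ≤ dist (R.path (x s)) (P.path (ρ (x s))) + dist (R.path (x s)) (Q.path (ρ' (x s))) :=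
          dist_triangle_left _ _ _
      _ < 2 * ε := by linarith [hd (x s), hd' (x s)]

/-- Uniform limits up to reparametrization are unique among polygons with a corner at every
vertex. -/
lemma sameCurve_of_uniformlyClose {P Q : ClosedPolygon} (hP : ∀ i, Real.sin (P.angle i) ≠ 0)
    (hQ : ∀ i, Real.sin (Q.angle i) ≠ 0)
    (h : ∀ ε > 0, ∃ R, UniformlyClose ε R P ∧ UniformlyClose ε R Q) : SameCurve P Q := by
  have hex : ∀ k : ℕ, ∃ f g, Reparam P Q (P.n + Q.n) f g ∧
      f 0 ∈ Set.Icc (0 : ℝ) P.n ∧ g 0 ∈ Set.Icc (0 : ℝ) Q.n ∧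
      ∀ s, dist (P.path (f s)) (Q.path (g s)) < 2 * (1 / ((k : ℝ) + 1)) := fun k => by
    obtain ⟨R, h1, h2⟩ := h (1 / ((k : ℝ) + 1)) (by positivity)
    exact exists_reparam h1 h2
  choose f g hfg hf0 hg0 hdist using hex
  -- The pointwise limit along an ultrafilter exists, as `f k s` is within `|s|` of `f k 0`.
  set 𝒰 := hyperfilter ℕ
  have hlim : ∀ (u : ℕ → ℝ) (a b : ℝ), (∀ k, u k ∈ Set.Icc a b) →
      ∃ l, Tendsto u (𝒰 : Filter ℕ) (𝓝 l) := by
    intro u a b hu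
    obtain ⟨l, -, hl⟩ := (isCompact_Icc (a := a) (b := b)).ultrafilter_le_nhds (𝒰.map u)
      (by rw [le_principal_iff]; exact Filter.mem_map.2 (univ_mem' hu))
    exact ⟨l, hl⟩
  have hbound : ∀ {P Q : ClosedPolygon} {c : ℝ} {f g : ℝ → ℝ}, Reparam P Q c f g →
      f 0 ∈ Set.Icc (0 : ℝ) P.n → ∀ s : ℝ, f s ∈ Set.Icc (-|s|) (P.n + |s|) := by
    intro P Q c f g hr h0 s
    have e := hr.add_eq 0 s
    rcases le_total 0 s with hs | hs
    · have e1 := hr.monotone_left hs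
      have e2 := hr.monotone_right hs
      rw [abs_of_nonneg hs]
      constructor <;> linarith [h0.1, h0.2]
    · have e1 := hr.monotone_left hs
      have e2 := hr.monotone_right hs
      rw [abs_of_nonpos hs]
      constructor <;> linarith [h0.1, h0.2]
  choose F hF using fun s => hlim (fun k => f k s) _ _ fun k => hbound (hfg k) (hf0 k) s
  choose G hG using fun s => hlim (fun k => g k s) _ _ fun k => hbound (hfg k).symm (hg0 k) s
  have hFG : Reparam P Q (P.n + Q.n) F G := by
    refine ⟨fun s s' hss => ?_, fun s s' hss => ?_, fun s s' => ?_, fun s => ?_, fun s => ?_⟩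
    · exact le_of_tendsto_of_tendsto' (hF s) (hF s') fun k => (hfg k).monotone_left hss
    · exact le_of_tendsto_of_tendsto' (hG s) (hG s') fun k => (hfg k).monotone_right hss
    · refine tendsto_nhds_unique (((hF s').sub (hF s)).add ((hG s').sub (hG s))) ?_
      exact tendsto_const_nhds.congr fun k => ((hfg k).add_eq s s').symm
    · exact tendsto_nhds_unique (hF _) (((hF s).add_const _).congr fun k =>
        ((hfg k).left_add s).symm)
    · exact tendsto_nhds_unique (hG _) (((hG s).add_const _).congr fun k =>
        ((hfg k).right_add s).symm)
  refine hFG.sameCurve (fun s => ?_) hP hQ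
  have h1 : Tendsto (fun k => dist (P.path (f k s)) (Q.path (g k s))) (𝒰 : Filter ℕ)
      (𝓝 (dist (P.path (F s)) (Q.path (G s)))) :=
    ((P.continuous_path.tendsto _).comp (hF s)).dist ((Q.continuous_path.tendsto _).comp (hG s))
  have h2 : Tendsto (fun k : ℕ => 2 * (1 / ((k : ℝ) + 1))) (𝒰 : Filter ℕ) (𝓝 (2 * 0)) :=
    (tendsto_one_div_add_atTop_nhds_zero_nat.mono_left
      (by rw [← Nat.cofinite_eq_atTop]; exact hyperfilter_le_cofinite)).const_mul 2
  rw [mul_zero] at h2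
  exact dist_le_zero.1 (le_of_tendsto_of_tendsto' h1 h2 fun k => (hdist k s).le)

end ClosedPolygon

/-! ### Sums and enumerations over the integers -/

section Integers

variable {A : Type*} [AddCommGroup A]

/-- The sequence that vanishes at `0` and has the increments `f`. -/
def intPrimitive (f : ℤ → A) : ℤ → A
  | Int.ofNat n => ∑ j ∈ Finset.range n, f j
  | Int.negSucc n => -∑ j ∈ Finset.range (n + 1), f (Int.negSucc j)

lemma intPrimitive_natCast (f : ℤ → A) (n : ℕ) :
    intPrimitive f n = ∑ j ∈ Finset.range n, f j := rfl

lemma intPrimitive_zero (f : ℤ → A) : intPrimitive f 0 = 0 := by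
  simpa using intPrimitive_natCast f 0

lemma intPrimitive_succ (f : ℤ → A) (i : ℤ) :
    intPrimitive f (i + 1) = intPrimitive f i + f i := by
  rcases i with n | n
  · exact Finset.sum_range_succ (fun j : ℕ => f j) n
  · rcases n with _ | n
    · have : intPrimitive f (Int.negSucc 0) = -f (Int.negSucc 0) := by simp [intPrimitive]
      rw [this, neg_add_cancel]
      exact intPrimitive_zero f
    · have h1 : intPrimitive f (Int.negSucc (n + 1)) =
          intPrimitive f (Int.negSucc n) - f (Int.negSucc (n + 1)) := by
        change -_ = -_ - _
        rw [Finset.sum_range_succ, neg_add, sub_eq_add_neg]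
      rw [h1, sub_add_cancel]
      rfl

lemma intPrimitive_add_period {f : ℤ → A} {n : ℕ} (hf : ∀ i, f (i + n) = f i) (i : ℤ) :
    intPrimitive f (i + n) = intPrimitive f i + intPrimitive f n := by
  induction i with
  | zero => simp [intPrimitive_zero]
  | succ i ih =>
    rw [add_right_comm, intPrimitive_succ, intPrimitive_succ, ih, hf]; abel
  | pred i ih =>
    have h1 := intPrimitive_succ f (-(i : ℤ) - 1 + n)
    have h2 := intPrimitive_succ f (-(i : ℤ) - 1)
    rw [sub_add_cancel] at h2
    rw [show -(i : ℤ) - 1 + n + 1 = -i + n by ring, ih, hf, h2] at h1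
    refine add_right_cancel (b := f (-(i : ℤ) - 1)) ?_
    rw [← h1]; abel

lemma monotone_intPrimitive {f : ℤ → ℝ} (hf : ∀ i, 0 ≤ f i) : Monotone (intPrimitive f) :=
  monotone_int_of_le_succ fun i => by rw [intPrimitive_succ]; linarith [hf i]

/-- `κ` counts the elements of the `n`-periodic set `B`, and `e` enumerates them in increasing order,
with `n'` elements per period. -/
structure IsEnumeration (B : ℤ → Prop) (n n' : ℕ) (κ e : ℤ → ℤ) : Prop where
  pos : 0 < n'
  le_iff : ∀ k i, e k ≤ i ↔ k ≤ κ i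
  count_succ : ∀ i, B (i + 1) → κ (i + 1) = κ i + 1
  count_succ_of_not : ∀ i, ¬B (i + 1) → κ (i + 1) = κ i
  count_add : ∀ i, κ (i + n) = κ i + n'

lemma exists_isEnumeration {B : ℤ → Prop} {n : ℕ} (hn : 0 < n) (hB : ∀ i, B (i + n) ↔ B i)
    (hne : ∃ i, B i) : ∃ n' κ e, IsEnumeration B n n' κ e := by
  classical
  set κ : ℤ → ℤ := fun i => intPrimitive (fun j => if B (j + 1) then (1 : ℤ) else 0) i with hκ
  have hsucc : ∀ i, κ (i + 1) = κ i + if B (i + 1) then 1 else 0 := fun i => intPrimitive_succ _ i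
  have hmono : Monotone κ := monotone_int_of_le_succ fun i => by
    rw [hsucc]; split_ifs <;> lia
  have hper : ∀ i, κ (i + n) = κ i + κ n := fun i =>
    intPrimitive_add_period (f := fun j => if B (j + 1) then (1 : ℤ) else 0)
      (n := n) (fun i => by simp only [add_right_comm i (n : ℤ) 1, hB]) i
  have hpos : 0 < κ n := by
    obtain ⟨i, hi⟩ := hne
    have h1 := hsucc (i - 1)
    rw [sub_add_cancel, if_pos hi] at h1
    have h2 := hper (i - 1)
    have h3 : κ i ≤ κ (i - 1 + n) := hmono (by lia)
    lia
  have hper' : ∀ (k : ℤ) i, κ (i + k * n) = κ i + k * κ n := by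
    intro k
    induction k with
    | zero => simp
    | succ k ih => intro i; rw [add_mul, one_mul, ← add_assoc, hper, ih]; ring
    | pred k ih =>
      intro i
      have h1 := hper (i + (-k - 1) * n)
      rw [show i + (-(k : ℤ) - 1) * n + n = i + -k * n by ring, ih] at h1
      lia
  have h0 : κ 0 = 0 := intPrimitive_zero _
  have hex : ∀ k, ∃ lb, k ≤ κ lb ∧ ∀ z, k ≤ κ z → lb ≤ z := fun k => by
    refine Int.exists_least_of_bdd ⟨-(|k| + 1) * n, fun z hz => ?_⟩ ⟨|k| * n, ?_⟩
    · by_contra hlt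
      have h1 := hmono (not_le.1 hlt).le
      have h2 := hper' (-(|k| + 1)) 0
      rw [zero_add, h0, zero_add] at h2
      have h3 := neg_abs_le k
      nlinarith [abs_nonneg k]
    · have h2 := hper' |k| 0
      rw [zero_add, h0, zero_add] at h2
      have h3 := le_abs_self k
      nlinarith [abs_nonneg k]
  choose e he1 he2 using hex
  refine ⟨(κ n).toNat, κ, e, ⟨by lia, fun k i => ⟨fun h => (he1 k).trans (hmono h), he2 k i⟩,
    fun i hi => by rw [hsucc, if_pos hi], fun i hi => by rw [hsucc, if_neg hi, add_zero],
    fun i => by rw [hper, Int.toNat_of_nonneg hpos.le]⟩⟩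

namespace IsEnumeration

variable {B : ℤ → Prop} {n n' : ℕ} {κ e : ℤ → ℤ}

lemma count_le_succ (h : IsEnumeration B n n' κ e) (i : ℤ) :
    κ i ≤ κ (i + 1) ∧ κ (i + 1) ≤ κ i + 1 := by
  by_cases hB : B (i + 1)
  · rw [h.count_succ i hB]; lia
  · rw [h.count_succ_of_not i hB]; lia

lemma count_enum (h : IsEnumeration B n n' κ e) (k : ℤ) : κ (e k) = k := by
  have h1 := (h.le_iff k (e k)).1 le_rfl
  have h2 := (h.le_iff k (e k - 1)).not.1 (by lia)
  have h3 := h.count_le_succ (e k - 1)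
  rw [sub_add_cancel] at h3
  lia

lemma enum_mem (h : IsEnumeration B n n' κ e) (k : ℤ) : B (e k) := by
  by_contra hB
  have h1 := h.count_succ_of_not (e k - 1)
  rw [sub_add_cancel] at h1
  have h2 := (h.le_iff k (e k - 1)).2 (by rw [← h1 hB, h.count_enum])
  lia

lemma enum_add (h : IsEnumeration B n n' κ e) (k : ℤ) : e (k + n') = e k + n := by
  apply le_antisymm
  · rw [h.le_iff, h.count_add, h.count_enum]
  · have h1 := h.count_add (e (k + n') - n)
    rw [sub_add_cancel, h.count_enum] at h1
    have := (h.le_iff k (e (k + n') - n)).2 (by lia)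
    lia

lemma enum_count_le (h : IsEnumeration B n n' κ e) (i : ℤ) : e (κ i) ≤ i := (h.le_iff _ _).2 le_rfl

lemma lt_enum_count_succ (h : IsEnumeration B n n' κ e) (i : ℤ) : i < e (κ i + 1) := by
  by_contra hle
  have := (h.le_iff _ _).1 (not_lt.1 hle)
  lia

lemma enum_count_of_mem (h : IsEnumeration B n n' κ e) {i : ℤ} (hi : B i) : e (κ i) = i := by
  have h1 := h.enum_count_le i
  have h2 := h.count_succ (i - 1)
  rw [sub_add_cancel] at h2
  have h3 := h.lt_enum_count_succ (i - 1)
  rw [← h2 hi] at h3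
  lia

lemma count_pred_enum (h : IsEnumeration B n n' κ e) (k : ℤ) : κ (e k - 1) = k - 1 := by
  have h2 := h.count_succ (e k - 1)
  rw [sub_add_cancel, h.count_enum] at h2
  have := h2 (h.enum_mem k)
  lia

lemma lt_of_exists_not (h : IsEnumeration B n n' κ e) (hne : ∃ i, ¬B i) (hn : 0 < n) : n' < n := by
  obtain ⟨i, hi⟩ := hne
  have h1 := h.count_succ_of_not (i - 1)
  rw [sub_add_cancel] at h1
  have h2 := h.count_add (i - 1)
  have h3 : ∀ m : ℕ, κ (i + m) ≤ κ i + m := fun m => by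
    induction m with
    | zero => simp
    | succ m ih =>
      have := (h.count_le_succ (i + m)).2
      rw [show i + ((m + 1 : ℕ) : ℤ) = i + m + 1 by push_cast; ring]
      push_cast; lia
  have h4 := h3 (n - 1)
  rw [show i + ((n - 1 : ℕ) : ℤ) = i - 1 + n by lia, h2, h1 hi] at h4
  lia

end IsEnumeration

end Integers

namespace ClosedPolygon

/-! ### Merging the segments between which others vanish -/

/-- The segments `S i` with `Van i` of the polygon `P` are removed, and the segments next to them
are merged if they are parallel. The segments of the new polygon are labelled so that its `k`-th segment
comes from those `S i` for which `κ i = k`. The first of them is `S (e k)`, and it does not vanish.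
The last field says that two such classes are not separated by a single vanishing segment, as the
neighbours of a segment of zero curvature are parallel. -/
structure IsMerging (P : ClosedPolygon) (Van : ℤ → Prop) (n' : ℕ) (κ e : ℤ → ℤ) : Prop where
  pos : 0 < n'
  lt : n' < P.n
  le_iff : ∀ k i, e k ≤ i ↔ k ≤ κ i
  enum_add : ∀ k, e (k + n') = e k + P.n
  count_add : ∀ i, κ (i + P.n) = κ i + n'
  count_enum : ∀ k, κ (e k) = k
  not_van : ∀ k, ¬Van (e k)
  normal_eq : ∀ i, ¬Van i → P.normal i = P.normal (e (κ i))
  normal_pred : ∀ k, P.normal (e k - 1) = P.normal (e (k - 1))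
  van_pred : ∀ k, Van (e k - 1) → Van (e k - 1 - 1)

/-- Along a run of vanishing segments the normals alternate, as these have zero curvature. -/
lemma IsAdmissible.exists_isMerging {φ : Plane → ℝ} (hφ : IsAnisotropy φ) {P : ClosedPolygon}
    (hP : P.IsAdmissible φ) {Van : ℤ → Prop} (hper : ∀ i, Van (i + P.n) ↔ Van i)
    (hzero : ∀ i, Van i → P.transition i = 0) (hvan : ∃ i, Van i)
    (hne : ∃ i j, ¬Van i ∧ ¬Van j ∧ P.normal i ≠ P.normal j) :
    ∃ n' κ e, IsMerging P Van n' κ e := by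
  obtain ⟨n₁, κ₁, e₁, h₁⟩ := exists_isEnumeration (B := fun i => ¬Van i) P.n_pos
    (fun i => not_congr (hper i)) ⟨_, hne.choose_spec.choose_spec.1⟩
  -- The last segment up to `S i` that does not vanish.
  set g : ℤ → ℤ := fun i => e₁ (κ₁ i) with hg
  have hgi : ∀ i, ¬Van i → g i = i := fun i hi => h₁.enum_count_of_mem hi
  have hgs : ∀ i, Van (i + 1) → g (i + 1) = g i := fun i hi => by
    simp only [hg]; rw [h₁.count_succ_of_not i (not_not.2 hi)]
  have hgn : ∀ i, ¬Van (g i) := fun i => h₁.enum_mem _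
  have hgle : ∀ i, g i ≤ i := h₁.enum_count_le
  have hgper : ∀ i, g (i + P.n) = g i + P.n := fun i => by
    simp only [hg]; rw [h₁.count_add, h₁.enum_add]
  have hadj : ∀ i, P.normal i ≠ P.normal (i + 1) := fun i => by
    simpa using (hP (i + 1)).2.2.1
  have halt : ∀ i, P.normal (g i) = P.normal i ∨ P.normal (g i) = P.normal (i + 1) := by
    intro i
    have : ∀ r, ¬Van r → ∀ j, r ≤ j → P.normal (g j) = P.normal j ∨
        P.normal (g j) = P.normal (j + 1) := by
      intro r hr j hj
      induction j, hj using Int.leInduction with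
      | base => left; rw [hgi r hr]
      | succ j hj ih =>
        by_cases hv : Van (j + 1)
        · rw [hgs j hv]
          rcases ih with ih | ih
          · right
            have := hP.normal_succ_eq_normal_pred hφ (hzero _ hv)
            rw [add_sub_cancel_right] at this
            rw [ih, this]
          · exact Or.inl ih
        · left; rw [hgi _ hv]
    exact this (g i) (hgn i) i (hgle i)
  set B : ℤ → Prop := fun r => ¬Van r ∧ P.normal (g (r - 1)) ≠ P.normal r with hBdef
  have hBn : ∀ i, ¬B (i + 1) → P.normal (g (i + 1)) = P.normal (g i) := by
    intro i hi
    by_cases hv : Van (i + 1)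
    · rw [hgs i hv]
    · rw [hgi _ hv]
      simp only [hBdef, add_sub_cancel_right, not_and, not_not] at hi
      exact (hi hv).symm
  have hBper : ∀ i, B (i + P.n) ↔ B i := fun i => by
    simp only [hBdef]
    rw [hper, P.normal_periodic, add_sub_right_comm, hgper, P.normal_periodic]
  have hBne : ∃ r, B r := by
    by_contra! hcon
    have hconst : ∀ i, P.normal (g i) = P.normal (g 0) := by
      intro i
      induction i with
      | zero => rfl
      | succ i ih => rw [hBn i (hcon _), ih]
      | pred i ih =>
        have := hBn (-i - 1) (hcon _)
        rw [sub_add_cancel] at this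
        rw [← this, ih]
    obtain ⟨i, j, hi, hj, hij⟩ := hne
    apply hij
    rw [← hgi i hi, ← hgi j hj, hconst, hconst j]
  obtain ⟨n', κ, e, h⟩ := exists_isEnumeration P.n_pos hBper hBne
  have hclass : ∀ k i, e k ≤ i → κ i = k → P.normal (g i) = P.normal (e k) := by
    intro k i hi
    induction i, hi using Int.leInduction with
    | base => intro _; rw [hgi _ (h.enum_mem k).1]
    | succ i hi ih =>
      intro hk
      have h1 := (h.le_iff k i).1 hi
      have h2 := (h.count_le_succ i).1
      have hik : κ i = k := by lia
      rw [hBn i fun hB => ?_, ih hik]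
      have := h.count_succ i hB
      lia
  have hpred : ∀ k, P.normal (g (e k - 1)) = P.normal (e k - 1) := fun k => by
    rcases halt (e k - 1) with h1 | h1
    · exact h1
    · rw [sub_add_cancel] at h1
      exact absurd h1 (h.enum_mem k).2
  refine ⟨n', κ, e, h.pos, h.lt_of_exists_not ?_ P.n_pos, h.le_iff, h.enum_add, h.count_add,
    h.count_enum, fun k => (h.enum_mem k).1, fun i hi => ?_,
    fun k => ?_, fun k hk => ?_⟩
  · obtain ⟨i, hi⟩ := hvan
    exact ⟨i, fun hB => hB.1 hi⟩
  · rw [← hclass _ i (h.enum_count_le i) rfl, hgi i hi]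
  · rw [← hpred, hclass (k - 1) _ _ (h.count_pred_enum k)]
    rw [h.le_iff, h.count_pred_enum]
  · by_contra hv
    have h1 := hpred k
    have h2 := hgs (e k - 1 - 1)
    rw [sub_add_cancel] at h2
    rw [h2 hk, hgi _ hv] at h1
    have h3 := hadj (e k - 1 - 1)
    rw [sub_add_cancel] at h3
    exact h3 h1

/-! ### The turning of the Cahn-Hoffman field -/

section Turning

variable {φ : Plane → ℝ} {P : ClosedPolygon}

/-- The angle of `y` relative to the direction `ν`. -/
def relAngle (ν y : Plane) : ℝ := Complex.arg ⟨inner ℝ ν y, inner ℝ (perp ν) y⟩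

lemma arg_eq_relAngle_sub {ν a b : Plane} (hν : ‖ν‖ = 1) (ha : 0 < inner ℝ ν a)
    (hb : 0 < inner ℝ ν b) :
    Complex.arg ⟨inner ℝ a b, inner ℝ (perp a) b⟩ = relAngle ν b - relAngle ν a := by
  set z : ℂ := ⟨inner ℝ ν a, inner ℝ (perp ν) a⟩ with hz
  set w : ℂ := ⟨inner ℝ ν b, inner ℝ (perp ν) b⟩ with hw
  have hz' : |Complex.arg z| < Real.pi / 2 := Complex.abs_arg_lt_pi_div_two_iff.2 (Or.inl ha)
  have hw' : |Complex.arg w| < Real.pi / 2 := Complex.abs_arg_lt_pi_div_two_iff.2 (Or.inl hb)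
  have hz0 : z ≠ 0 := fun h => ha.ne' (congrArg Complex.re h)
  have hw0 : w ≠ 0 := fun h => hb.ne' (congrArg Complex.re h)
  have hconj : Complex.arg ((starRingEnd ℂ) z) = -Complex.arg z := by
    rw [Complex.arg_conj, if_neg]
    intro h
    rw [h, abs_of_pos Real.pi_pos] at hz'
    linarith [Real.pi_pos]
  have hprod : (⟨inner ℝ a b, inner ℝ (perp a) b⟩ : ℂ) = w * (starRingEnd ℂ) z := by
    rw [norm_eq_one_iff_coord] at hν
    apply Complex.ext
    · simp only [hz, hw, Complex.mul_re, Complex.conj_re, Complex.conj_im, inner_plane,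
        perp_apply_zero, perp_apply_one]
      linear_combination (-(a 0 * b 0 + a 1 * b 1)) * hν
    · simp only [hz, hw, Complex.mul_im, Complex.conj_re, Complex.conj_im, inner_plane,
        perp_apply_zero, perp_apply_one]
      linear_combination (-(a 0 * b 1 - a 1 * b 0)) * hν
  rw [abs_lt] at hz' hw'
  rw [hprod, Complex.arg_mul hw0 ((map_ne_zero _).2 hz0), hconj]
  · rfl
  · rw [hconj]; constructor <;> linarith [hz'.1, hz'.2, hw'.1, hw'.2]

lemma IsAdmissible.turning_eq (hφ : IsAnisotropy φ) (hP : P.IsAdmissible φ) (i : ℤ) :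
    P.turning φ i = relAngle (P.normal i) (P.cahnHoffman φ (i + 1)) -
      relAngle (P.normal i) (P.cahnHoffman φ i) := by
  have h := dual_normal_pos hφ P i
  refine arg_eq_relAngle_sub (P.norm_normal i) ?_ ?_
  · rw [(hP.cahnHoffman_mem i).2.2]; exact h
  · rw [(hP.cahnHoffman_succ_mem i).2]; exact h

lemma cahnHoffman_periodic (i : ℤ) : P.cahnHoffman φ (i + P.n) = P.cahnHoffman φ i := by
  rw [cahnHoffman, cahnHoffman, add_sub_right_comm, normal_periodic, normal_periodic]

lemma turning_periodic (i : ℤ) : P.turning φ (i + P.n) = P.turning φ i := by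
  rw [turning, turning, cahnHoffman_periodic, add_right_comm, cahnHoffman_periodic]

/-- Merging does not change the index: within a class the Cahn-Hoffman field runs in a single facet,
which is seen from the origin under an angle smaller than `π`. -/
lemma IsMerging.index_eq (hφ : IsAnisotropy φ) (hP : P.IsAdmissible φ) {Van : ℤ → Prop} {n' : ℕ}
    {κ e : ℤ → ℤ} (h : IsMerging P Van n' κ e) (hzero : ∀ i, Van i → P.transition i = 0)
    {Q : ClosedPolygon} (hQ : Q.IsAdmissible φ) (hn : Q.n = n')
    (hnormal : ∀ k, Q.normal k = P.normal (e k)) : Q.index φ = P.index φ := by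
  have hN : ∀ k, Q.cahnHoffman φ k = P.cahnHoffman φ (e k) := fun k => by
    rw [cahnHoffman, cahnHoffman, hnormal, hnormal, h.normal_pred]
  set Ψ := intPrimitive (P.turning φ) with hΨ
  have hclass : ∀ k i, e k ≤ i → i ≤ e (k + 1) → Ψ i - Ψ (e k) =
      relAngle (P.normal (e k)) (P.cahnHoffman φ i) -
        relAngle (P.normal (e k)) (P.cahnHoffman φ (e k)) := by
    intro k i hi
    induction i, hi using Int.leInduction with
    | base => intro _; rw [sub_self, sub_self]
    | succ i hi ih =>
      intro hle
      have ih' := ih (by lia)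
      have hκ : κ i = k := by
        have h1 := (h.le_iff k i).1 hi
        have h2 := (h.le_iff (k + 1) i).not.1 (by lia)
        lia
      have hstep : P.turning φ i = relAngle (P.normal (e k)) (P.cahnHoffman φ (i + 1)) -
          relAngle (P.normal (e k)) (P.cahnHoffman φ i) := by
        rw [hP.turning_eq hφ]
        by_cases hv : Van i
        · rw [(hP.cahnHoffman_succ_eq_iff hφ i).2 (hzero i hv), sub_self, sub_self]
        · rw [h.normal_eq i hv, hκ]
      rw [hΨ, intPrimitive_succ, ← hΨ, hstep]
      linarith
  have hturn : ∀ k : ℕ, Q.turning φ k = Ψ (e ((k + 1 : ℕ) : ℤ)) - Ψ (e (k : ℤ)) := fun k => by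
    rw [hQ.turning_eq hφ, hN, hN, hnormal]
    push_cast
    refine (hclass k _ ?_ le_rfl).symm
    rw [h.le_iff, h.count_enum]
    lia
  rw [index, index, Finset.sum_congr rfl fun k _ => hturn k,
    Finset.sum_range_sub (fun k : ℕ => Ψ (e (k : ℤ))), hn]
  have h1 := h.enum_add 0
  rw [zero_add] at h1
  rw [h1, hΨ, intPrimitive_add_period turning_periodic, intPrimitive_natCast, Nat.cast_zero,
    add_sub_cancel_left]

end Turning

end ClosedPolygon

namespace ClosedPolygon

/-! ### The limit curve when segments vanish -/

section LimitPolygon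

variable {φ : Plane → ℝ} {P : ClosedPolygon} {Van : ℤ → Prop} {l : Filter ℝ}
  {Γ : ℝ → ClosedPolygon}

open Classical in
/-- The length of `S i`, counted as zero if `S i` is to vanish. -/
def survivingLength (R : ClosedPolygon) (Van : ℤ → Prop) (i : ℤ) : ℝ :=
  if Van i then 0 else R.length i

/-- The surviving length between `vertex 0` and `vertex i`. -/
def arcLength (R : ClosedPolygon) (Van : ℤ → Prop) : ℤ → ℝ := intPrimitive (R.survivingLength Van)

lemma survivingLength_nonneg (R : ClosedPolygon) (Van : ℤ → Prop) (i : ℤ) :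
    0 ≤ R.survivingLength Van i := by
  unfold survivingLength; split_ifs
  exacts [le_rfl, (R.length_pos i).le]

lemma monotone_arcLength (R : ClosedPolygon) (Van : ℤ → Prop) : Monotone (R.arcLength Van) :=
  monotone_intPrimitive (R.survivingLength_nonneg Van)

lemma arcLength_succ_of_not {R : ClosedPolygon} {i : ℤ} (hi : ¬Van i) :
    R.arcLength Van (i + 1) = R.arcLength Van i + R.length i := by
  rw [arcLength, intPrimitive_succ, survivingLength, if_neg hi]

lemma arcLength_succ_of_van {R : ClosedPolygon} {i : ℤ} (hi : Van i) :
    R.arcLength Van (i + 1) = R.arcLength Van i := by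
  rw [arcLength, intPrimitive_succ, survivingLength, if_pos hi, add_zero]

lemma arcLength_add_period {R : ClosedPolygon} (hper : ∀ i, Van (i + R.n) ↔ Van i) (i : ℤ) :
    R.arcLength Van (i + R.n) = R.arcLength Van i + R.arcLength Van R.n :=
  intPrimitive_add_period (fun i => by
    rw [survivingLength, survivingLength, R.length_periodic]
    split_ifs <;> simp_all) i

/-- Up to vanishing errors, the curve is straight as long as the surviving segments are parallel. -/
lemma tendsto_vertex_sub_arcLength (hpar : ∀ᶠ t in l, Parallel P (Γ t))
    (hlen : ∀ i, Van i → Tendsto (fun t => (Γ t).length i) l (𝓝 0)) {r i : ℤ} {τ : Plane}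
    (hri : r ≤ i) (hτ : ∀ j, r ≤ j → j < i → ¬Van j → P.tangent j = τ) :
    Tendsto (fun t => (Γ t).vertex i - (Γ t).vertex r -
      ((Γ t).arcLength Van i - (Γ t).arcLength Van r) • τ) l (𝓝 0) := by
  induction i, hri using Int.leInduction with
  | base => simp [tendsto_const_nhds]
  | succ i hi ih =>
    have ih' := ih fun j h1 h2 => hτ j h1 (by lia)
    by_cases hv : Van i
    · have h1 := ih'.add ((hlen i hv).smul_const (P.tangent i))
      rw [zero_smul, add_zero] at h1
      refine h1.congr' ?_
      filter_upwards [hpar] with t ht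
      rw [arcLength_succ_of_van hv, (Γ t).vertex_succ, ht.tangent_eq]
      abel
    · refine ih'.congr' ?_
      filter_upwards [hpar] with t ht
      rw [arcLength_succ_of_not hv, (Γ t).vertex_succ, ← ht.tangent_eq, hτ i hi (by lia) hv]
      module

/-- The segments of a closed polygon cannot all have zero curvature, as they would have only two
directions. -/
lemma IsAdmissible.exists_transition_ne_zero (hφ : IsAnisotropy φ) (hP : P.IsAdmissible φ) :
    ∃ i, P.transition i ≠ 0 := by
  by_contra! hcon
  have hτ : ∀ i, P.tangent (i + 1) = P.tangent (i - 1) := fun i =>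
    perp_injective (hP.normal_succ_eq_normal_pred hφ (hcon i))
  have hcase : ∀ i, (P.tangent i = P.tangent 0 ∧ P.tangent (i + 1) = P.tangent 1) ∨
      (P.tangent i = P.tangent 1 ∧ P.tangent (i + 1) = P.tangent 0) := by
    intro i
    induction i with
    | zero => exact Or.inl ⟨rfl, by rw [zero_add]⟩
    | succ i ih =>
      have := hτ ((i : ℤ) + 1)
      rw [add_sub_cancel_right] at this
      rw [this]
      exact ih.symm.imp And.symm And.symm
    | pred i ih =>
      have := hτ (-(i : ℤ))
      rw [sub_add_cancel, ← this]
      exact ih.symm.imp And.symm And.symm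
  -- The curve advances in the direction of the bisector of the two tangents.
  set w := P.tangent 0 + P.tangent 1 with hw
  have hcos : -1 < inner ℝ (P.tangent 0) (P.tangent 1) := by
    have h1 := P.cos_angle 1
    rw [sub_self, real_inner_comm] at h1
    have h2 := hP.sin_ne_zero hφ 1
    have h3 := Real.sin_sq_add_cos_sq (P.angle 1)
    rw [← neg_eq_iff_eq_neg.2 h1, neg_lt_neg_iff]
    have : 0 < Real.sin (P.angle 1) ^ 2 := by positivity
    nlinarith
  have hpos : ∀ i, 0 < inner ℝ (P.tangent i) w := by
    have h0 : 0 < inner ℝ (P.tangent 0) w := by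
      rw [hw, inner_add_right, inner_tangent_tangent]; linarith
    have h1 : 0 < inner ℝ (P.tangent 1) w := by
      rw [hw, inner_add_right, inner_tangent_tangent, real_inner_comm]; linarith
    intro i
    rcases hcase i with ⟨h, -⟩ | ⟨h, -⟩ <;> rw [h] <;> assumption
  have hmono : StrictMono fun i => inner ℝ (P.vertex i) w := strictMono_int_of_lt_succ fun i => by
    rw [P.vertex_succ, inner_add_left, real_inner_smul_left]
    linarith [mul_pos (P.length_pos i) (hpos i)]
  have := hmono (show (0 : ℤ) < 0 + P.n by have := P.n_pos; lia)
  simp only [P.periodic, lt_irrefl] at this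

/-- If some segments of zero curvature of a family of parallel polygons vanish, then the curves
converge to a polygon with fewer segments, provided that the other lengths are bounded below and the
heights converge, possibly except that of the first segment in each run of vanishing ones. -/
theorem IsAdmissible.exists_limit_polygon [l.NeBot] (hφ : IsAnisotropy φ) (hP : P.IsAdmissible φ)
    (hpar : ∀ᶠ t in l, Parallel P (Γ t)) (hper : ∀ i, Van (i + P.n) ↔ Van i)
    (hzero : ∀ i, Van i → P.transition i = 0) (hvan : ∃ i, Van i)
    (hlen : ∀ i, Van i → Tendsto (fun t => (Γ t).length i) l (𝓝 0)) {d : ℝ} (hd : 0 < d)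
    (hdle : ∀ i, ¬Van i → ∀ᶠ t in l, d ≤ (Γ t).length i)
    (hheight : ∀ i, (¬Van i ∨ Van (i - 1)) →
      ∃ a, Tendsto (fun t => signedHeight P (Γ t) i) l (𝓝 a)) :
    ∃ Q : ClosedPolygon, Q.n < P.n ∧ Q.IsAdmissible φ ∧ Q.index φ = P.index φ ∧
      ∀ ε > 0, ∀ᶠ t in l, UniformlyClose ε (Γ t) Q := by
  have hs := hP.sin_ne_zero hφ
  obtain ⟨s, hsurv⟩ : ∃ s, ¬Van s := by
    obtain ⟨s, hs⟩ := hP.exists_transition_ne_zero hφ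
    exact ⟨s, fun h => hs (hzero s h)⟩
  have hvper : ∀ t, Parallel P (Γ t) → ∀ i, (Γ t).vertex (i + P.n) = (Γ t).vertex i :=
    fun t ht i => by rw [ht.1]; exact (Γ t).periodic i
  -- The surviving segments are not all parallel, as the curve is closed.
  have hne : ∃ i j, ¬Van i ∧ ¬Van j ∧ P.normal i ≠ P.normal j := by
    by_contra! hcon
    have h1 := tendsto_vertex_sub_arcLength (r := s) (i := s + P.n) (τ := P.tangent s) hpar hlen
      (by lia) fun j _ _ hj => perp_injective (hcon j s hj hsurv)
    have h2 : Tendsto (fun t => (Γ t).arcLength Van (s + P.n) - (Γ t).arcLength Van s) l (𝓝 0) := by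
      have h3 := (h1.inner (𝕜 := ℝ) (tendsto_const_nhds (x := P.tangent s))).neg
      rw [inner_zero_left, neg_zero] at h3
      refine h3.congr' ?_
      filter_upwards [hpar] with t ht
      rw [hvper t ht, sub_self, zero_sub, inner_neg_left, neg_neg, real_inner_smul_left,
        inner_tangent_tangent, mul_one]
    have h4 : d ≤ 0 := by
      refine ge_of_tendsto h2 ?_
      filter_upwards [hdle s hsurv] with t ht
      have h5 := (Γ t).monotone_arcLength Van (show s + 1 ≤ s + P.n by have := P.n_pos; lia)
      rw [arcLength_succ_of_not hsurv] at h5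
      linarith
    linarith
  obtain ⟨n', κ, e, h⟩ := hP.exists_isMerging hφ hper hzero hvan hne
  have hclass : ∀ i, e (κ i) ≤ i := fun i => (h.le_iff _ _).2 le_rfl
  have hclass' : ∀ i, i + 1 ≤ e (κ i + 1) := fun i => by
    have := (h.le_iff (κ i + 1) i).not.2 (by lia)
    lia
  have heq : ∀ k i, e k ≤ i → i < e (k + 1) → κ i = k := fun k i h1 h2 => by
    have h3 := (h.le_iff k i).1 h1
    have h4 := (h.le_iff (k + 1) i).not.1 (by lia)
    lia
  have hestep : ∀ k, e k + 1 ≤ e (k + 1) := fun k => by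
    have := hclass' (e k); rwa [h.count_enum] at this
  have htan : ∀ k j, e k ≤ j → j < e (k + 1) → ¬Van j → P.tangent j = P.tangent (e k) :=
    fun k j h1 h2 hj => perp_injective (by
      have := h.normal_eq j hj; rwa [heq k j h1 h2] at this)
  -- The vertices between different classes converge.
  have hlimit : ∀ k, ∃ q, Tendsto (fun t => (Γ t).vertex (e k)) l (𝓝 q) := by
    intro k
    obtain ⟨a, ha⟩ := hheight (e k) (Or.inl (h.not_van k))
    obtain ⟨b, hb⟩ := hheight (e k - 1) (by
      by_cases hv : Van (e k - 1)
      exacts [Or.inr (h.van_pred k hv), Or.inl hv])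
    refine ⟨_, Tendsto.congr' ?_ (tendsto_const_nhds (x := P.vertex (e k)) |>.add
      ((ha.smul_const (P.normal (e k))).add
        (((hb.add (ha.const_mul (Real.cos (P.angle (e k))))).div_const
          (Real.sin (P.angle (e k)))).smul_const (P.tangent (e k)))))⟩
    filter_upwards [hpar] with t ht
    rw [ht.vertex_eq hs, heightDisp]
  choose q hq using hlimit
  have hqper : ∀ k, q (k + n') = q k := fun k => by
    refine tendsto_nhds_unique (hq (k + n')) ((hq k).congr' ?_)
    filter_upwards [hpar] with t ht
    rw [h.enum_add, hvper t ht]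
  set Λ : ℤ → ℝ → ℝ := fun k t => (Γ t).arcLength Van (e (k + 1)) -
    (Γ t).arcLength Van (e k) with hΛ
  set lam : ℤ → ℝ := fun k => inner ℝ (q (k + 1) - q k) (P.tangent (e k)) with hlam
  have hΛτ : ∀ k, Tendsto (fun t => Λ k t • P.tangent (e k)) l (𝓝 (q (k + 1) - q k)) := fun k => by
    have h1 := tendsto_vertex_sub_arcLength hpar hlen (by linarith [hestep k]) (htan k)
    have h2 := ((hq (k + 1)).sub (hq k)).sub h1
    rw [sub_zero] at h2
    exact h2.congr fun t => sub_sub_cancel _ _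
  have hΛlim : ∀ k, Tendsto (Λ k) l (𝓝 (lam k)) := fun k => by
    refine ((hΛτ k).inner (𝕜 := ℝ) (tendsto_const_nhds (x := P.tangent (e k)))).congr fun t => ?_
    rw [real_inner_smul_left, inner_tangent_tangent, mul_one]
  have hqstep : ∀ k, q (k + 1) = q k + lam k • P.tangent (e k) := fun k => by
    rw [← sub_eq_iff_eq_add']
    exact tendsto_nhds_unique (hΛτ k) ((hΛlim k).smul_const _)
  have hΛpos : ∀ k t, 0 < Λ k t := fun k t => by
    have h1 := (Γ t).monotone_arcLength Van (hestep k)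
    rw [arcLength_succ_of_not (h.not_van k)] at h1
    have := (Γ t).length_pos (e k)
    simp only [hΛ]
    linarith
  have hlampos : ∀ k, 0 < lam k := fun k => by
    refine hd.trans_le (ge_of_tendsto (hΛlim k) ?_)
    filter_upwards [hdle _ (h.not_van k)] with t ht
    have h1 := (Γ t).monotone_arcLength Van (hestep k)
    rw [arcLength_succ_of_not (h.not_van k)] at h1
    simp only [hΛ]
    linarith
  set Q : ClosedPolygon :=
    { n := n'
      n_pos := h.pos
      vertex := q
      periodic := hqper
      nondegenerate := fun k hk => by
        have h1 := hqstep k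
        rw [← hk, left_eq_add, smul_eq_zero] at h1
        rcases h1 with h1 | h1
        · exact (hlampos k).ne' h1
        · have := P.norm_tangent (e k)
          rw [h1, norm_zero] at this
          exact zero_ne_one this } with hQdef
  have hQ : ∀ k, Q.tangent k = P.tangent (e k) ∧ Q.length k = lam k := fun k =>
    tangent_eq_of_vertex_succ (hlampos k) (P.norm_tangent _) (hqstep k)
  have hQnormal : ∀ k, Q.normal k = P.normal (e k) := fun k => congrArg perp (hQ k).1
  have hQadm : Q.IsAdmissible φ := fun k => by
    rw [hQnormal, hQnormal, ← h.normal_pred]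
    exact hP (e k)
  refine ⟨Q, h.lt, hQadm, h.index_eq hφ hP hzero hQadm rfl hQnormal, fun ε hε => ?_⟩
  -- `vertex i` corresponds to the point of `Q` that divides its segment in the ratio of the
  -- surviving lengths.
  set σ : ℝ → ℤ → ℝ := fun t i =>
    κ i + ((Γ t).arcLength Van i - (Γ t).arcLength Van (e (κ i))) / Λ (κ i) t with hσ
  have hσ0 : ∀ t i, (κ i : ℝ) ≤ σ t i := fun t i => by
    have := (Γ t).monotone_arcLength Van (hclass i)
    have := div_nonneg (sub_nonneg.2 this) (hΛpos (κ i) t).le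
    simp only [hσ]
    linarith
  have hσsucc : ∀ t i, σ t (i + 1) =
      κ i + ((Γ t).arcLength Van (i + 1) - (Γ t).arcLength Van (e (κ i))) / Λ (κ i) t := by
    intro t i
    by_cases hi : i + 1 < e (κ i + 1)
    · simp only [hσ, heq (κ i) (i + 1) (by linarith [hclass i]) hi]
    · have h1 : e (κ i + 1) = i + 1 := le_antisymm (not_lt.1 hi) (hclass' i)
      have h2 : κ (i + 1) = κ i + 1 := by rw [← h1, h.count_enum]
      have h3 : (Γ t).arcLength Van (i + 1) - (Γ t).arcLength Van (e (κ i)) = Λ (κ i) t := by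
        simp only [hΛ, h1]
      rw [h3, div_self (hΛpos _ t).ne']
      simp only [hσ]
      rw [h2, h1, sub_self, zero_div]
      push_cast; ring
  have hσ1 : ∀ t i, σ t (i + 1) ≤ κ i + 1 := fun t i => by
    rw [hσsucc]
    have h1 := (Γ t).monotone_arcLength Van (hclass' i)
    have h2 : ((Γ t).arcLength Van (i + 1) - (Γ t).arcLength Van (e (κ i))) / Λ (κ i) t ≤ 1 := by
      rw [div_le_one (hΛpos _ t)]; simp only [hΛ]; linarith
    linarith
  have hσmono : ∀ t, Monotone (σ t) := fun t => monotone_int_of_le_succ fun i => by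
    rw [hσsucc]
    have h1 := (Γ t).monotone_arcLength Van (show i ≤ i + 1 by lia)
    have := div_le_div_of_nonneg_right
      (sub_le_sub_right h1 ((Γ t).arcLength Van (e (κ i)))) (hΛpos (κ i) t).le
    simp only [hσ]
    linarith
  have hpathσ : ∀ t i, Q.path (σ t i) = q (κ i) +
      (((Γ t).arcLength Van i - (Γ t).arcLength Van (e (κ i))) / Λ (κ i) t * lam (κ i)) •
        P.tangent (e (κ i)) := fun t i => by
    rw [Q.path_eq (hσ0 t i) ((hσmono t (show i ≤ i + 1 by lia)).trans (hσ1 t i)), (hQ _).1,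
      (hQ _).2]
    simp only [hσ, add_sub_cancel_left, hQdef]
  have hσper : ∀ t, Parallel P (Γ t) → ∀ i, σ t (i + P.n) = σ t i + n' := fun t ht i => by
    have hA : ∀ j, (Γ t).arcLength Van (j + P.n) = (Γ t).arcLength Van j +
        (Γ t).arcLength Van P.n := fun j => by
      have := arcLength_add_period (R := Γ t) (Van := Van) (by rw [← ht.1]; exact hper) j
      rwa [← ht.1] at this
    have hΛper : Λ (κ i + n') t = Λ (κ i) t := by
      simp only [hΛ]
      rw [add_right_comm, h.enum_add, h.enum_add, hA, hA]; ring
    simp only [hσ]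
    rw [h.count_add, hΛper, h.enum_add, hA, hA, add_sub_add_right_eq_sub]
    push_cast; ring
  have hconv : ∀ i, Tendsto (fun t => dist ((Γ t).vertex i) (Q.path (σ t i))) l (𝓝 0) := by
    intro i
    set k := κ i with hk
    have h1 := (tendsto_vertex_sub_arcLength (r := e k) (i := i) (τ := P.tangent (e k)) hpar hlen
      (hclass i) fun j hj1 hj2 => htan k j hj1 (by linarith [hclass' i])).norm
    have h2 := ((hq k).sub_const (q k)).norm
    have h3 := ((hΛlim k).sub_const (lam k)).abs
    have h4 := (h1.add h2).add h3
    simp only [norm_zero, sub_self, abs_zero, add_zero] at h4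
    refine squeeze_zero (fun t => dist_nonneg) (fun t => ?_) h4
    set a := (Γ t).arcLength Van i - (Γ t).arcLength Van (e k)
    have ha0 : 0 ≤ a := sub_nonneg.2 ((Γ t).monotone_arcLength Van (hclass i))
    have ha1 : a ≤ Λ k t := by
      simp only [a, hΛ]
      linarith [(Γ t).monotone_arcLength Van (show i ≤ e (k + 1) by linarith [hclass' i])]
    have hΛ0 := hΛpos k t
    rw [dist_eq_norm, hpathσ]
    have hsplit : (Γ t).vertex i - (q k + (a / Λ k t * lam k) • P.tangent (e k)) =
        ((Γ t).vertex i - (Γ t).vertex (e k) - a • P.tangent (e k)) +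
          ((Γ t).vertex (e k) - q k) + (a / Λ k t * (Λ k t - lam k)) • P.tangent (e k) := by
      rw [mul_sub, div_mul_cancel₀ _ hΛ0.ne']
      module
    rw [hsplit]
    refine (norm_add₃_le).trans (add_le_add le_rfl ?_)
    rw [norm_smul, norm_tangent, mul_one, Real.norm_eq_abs, abs_mul, abs_of_nonneg (by positivity)]
    exact mul_le_of_le_one_left (abs_nonneg _) ((div_le_one hΛ0).2 ha1)
  have hev : ∀ᶠ t in l, ∀ j : ZMod P.n,
      dist ((Γ t).vertex (j.val : ℤ)) (Q.path (σ t (j.val : ℤ))) < ε :=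
    eventually_all.2 fun j => (hconv _).eventually (gt_mem_nhds hε)
  filter_upwards [hpar, hev] with t ht hclose
  refine uniformlyClose_of_vertices (σ t) (hσmono t) (fun i => ?_)
    (fun i => ⟨κ i, hσ0 t i, hσ1 t i⟩) fun i => ?_
  · rw [← ht.1]; exact hσper t ht i
  · have hdper : ∀ i, dist ((Γ t).vertex (i + P.n)) (Q.path (σ t (i + P.n))) =
        dist ((Γ t).vertex i) (Q.path (σ t i)) := fun i => by
      rw [hvper t ht, hσper t ht]
      exact congrArg _ (Q.path_add_n _)
    have := hclose (i : ZMod P.n)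
    rwa [apply_zmod_val_of_periodic
      (f := fun i => dist ((Γ t).vertex i) (Q.path (σ t i))) hdper] at this

end LimitPolygon

/-- At a finite maximal time the flow converges to an admissible polygon with fewer segments. -/
lemma IsUniqueMaximalElasticFlow.exists_limit_polygon {φ : Plane → ℝ} {α : ℝ} {P : ClosedPolygon}
    {T : ℝ} {Γ : ℝ → ClosedPolygon} (hφ : IsAnisotropy φ) (hα : 0 < α) (hP : P.IsAdmissible φ)
    (hΓ : IsUniqueMaximalElasticFlow φ α P T Γ) :
    ∃ Q : ClosedPolygon, Q.n < P.n ∧ Q.IsAdmissible φ ∧ Q.index φ = P.index φ ∧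
      ∀ ε > 0, ∀ᶠ t : ℝ in 𝓝[<] T, UniformlyClose ε (Γ t) Q := by
  have hflow := hΓ.1.1
  have hT : 0 < T := by exact_mod_cast hflow.pos
  have hin : ∀ᶠ t : ℝ in 𝓝[<] T, 0 ≤ t ∧ (t : EReal) < (T : EReal) := by
    filter_upwards [Ioo_mem_nhdsLT hT] with t ht using ⟨ht.1.le, by exact_mod_cast ht.2⟩
  have hpar : ∀ᶠ t : ℝ in 𝓝[<] T, Parallel P (Γ t) :=
    hin.mono fun t ht => hflow.parallel t ht.1 ht.2
  set Van : ℤ → Prop := fun i =>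
    P.transition i = 0 ∧ Tendsto (fun t => (Γ t).length i) (𝓝[<] T) (𝓝 0) with hVan
  have hper : ∀ i, Van (i + P.n) ↔ Van i := fun i => by
    simp only [hVan, P.transition_periodic]
    refine and_congr_right fun _ => tendsto_congr' (hpar.mono fun t ht => ?_)
    rw [ht.1]; exact (Γ t).length_periodic i
  obtain ⟨d, hd, hdle⟩ := hflow.exists_forall_le_length hφ hα hP
  have hsurv : ∀ i, P.transition i = 0 → ¬Van i →
      ∃ a > 0, Tendsto (fun t => (Γ t).length i) (𝓝[<] T) (𝓝 a) := by
    intro i hi hv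
    obtain ⟨a, ha⟩ := (hflow.exists_tendsto_of_transition_eq_zero hφ hα hP hi).1
    refine ⟨a, lt_of_le_of_ne (ge_of_tendsto' ha fun t => ((Γ t).length_pos i).le) ?_, ha⟩
    rintro rfl
    exact hv ⟨hi, ha⟩
  -- A common positive lower bound for the surviving lengths, by periodicity.
  have hlow : ∀ i, ∃ b > 0, ¬Van i → ∀ᶠ t : ℝ in 𝓝[<] T, b ≤ (Γ t).length i := by
    intro i
    by_cases hv : Van i
    · exact ⟨1, one_pos, fun h => absurd hv h⟩
    by_cases hi : P.transition i = 0
    · obtain ⟨a, ha, hlim⟩ := hsurv i hi hv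
      exact ⟨a / 2, by linarith, fun _ =>
        (hlim.eventually (lt_mem_nhds (half_lt_self ha))).mono fun t ht => le_of_lt ht⟩
    · exact ⟨d, hd, fun _ => hin.mono fun t ht => hdle t ht.1 ht.2 i hi⟩
  choose b hb hble using hlow
  obtain ⟨j, hj⟩ := Finite.exists_min (fun j : ZMod P.n => b (j.val : ℤ))
  refine hP.exists_limit_polygon hφ hpar hper (fun i hi => hi.1)
    (hΓ.exists_tendsto_length_zero hφ hα hP) (fun i hi => hi.2) (hb (j.val : ℤ)) (fun i hi => ?_)
    fun i hi => ?_
  · have hvper : ∀ i, ¬Van (i + P.n) ↔ ¬Van i := fun i => not_congr (hper i)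
    have h1 : ¬Van (((i : ZMod P.n).val : ℕ) : ℤ) := by
      rw [apply_zmod_val_of_periodic (f := Van) fun i => propext (hper i)]; exact hi
    filter_upwards [hble _ h1, hpar] with t ht ht'
    rw [apply_zmod_val_of_periodic (f := (Γ t).length) fun i => by
      rw [ht'.1]; exact (Γ t).length_periodic i] at ht
    exact (hj _).trans ht
  · rcases hi with hi | hi
    · by_cases hz : P.transition i = 0
      · obtain ⟨a, ha, hlim⟩ := hsurv i hz hi
        exact hflow.exists_tendsto_signedHeight_of_length_pos hφ hα hP hz ha hlim
      · exact hflow.exists_tendsto_signedHeight_of_ne hφ hα hP hz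
    · have := (hflow.exists_tendsto_of_transition_eq_zero hφ hα hP hi.1).2.2
      rwa [sub_add_cancel] at this

end ClosedPolygon

namespace ClosedPolygon

/-! ### Relabelled flows -/

/-- The polygon `P` with its labels shifted by `k`. -/
def shift (P : ClosedPolygon) (k : ℤ) : ClosedPolygon where
  n := P.n
  n_pos := P.n_pos
  vertex i := P.vertex (i + k)
  periodic i := by rw [add_right_comm, P.periodic]
  nondegenerate i := by rw [add_right_comm]; exact P.nondegenerate _

section Shift

variable {φ : Plane → ℝ} {α : ℝ} {P Q : ClosedPolygon} {k : ℤ}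

lemma SameCurve.exists_eq_shift (h : SameCurve Q P) : ∃ k, Q = P.shift k := by
  obtain ⟨hn, k, hk⟩ := h
  exact ⟨k, ext_of_vertex hn hk⟩

lemma shift_shift_neg (P : ClosedPolygon) (k : ℤ) : (P.shift k).shift (-k) = P :=
  ext_of_vertex rfl fun i => congrArg P.vertex (neg_add_cancel_right i k)

lemma shift_neg_shift (P : ClosedPolygon) (k : ℤ) : (P.shift (-k)).shift k = P :=
  ext_of_vertex rfl fun i => congrArg P.vertex (add_neg_cancel_right i k)

lemma length_shift (i : ℤ) : (P.shift k).length i = P.length (i + k) := by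
  rw [length, length, ← add_right_comm]; rfl

lemma tangent_shift (i : ℤ) : (P.shift k).tangent i = P.tangent (i + k) := by
  rw [tangent, tangent, length_shift, ← add_right_comm]; rfl

lemma normal_shift (i : ℤ) : (P.shift k).normal i = P.normal (i + k) :=
  congrArg perp (tangent_shift i)

lemma angle_shift (i : ℤ) : (P.shift k).angle i = P.angle (i + k) := by
  rw [angle, angle, tangent_shift, tangent_shift, sub_add_eq_add_sub]

lemma transition_shift (i : ℤ) : (P.shift k).transition i = P.transition (i + k) := by
  rw [transition, transition, angle_shift, angle_shift, add_right_comm]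

lemma signedHeight_shift (i : ℤ) :
    signedHeight (P.shift k) (Q.shift k) i = signedHeight P Q (i + k) := by
  rw [signedHeight, signedHeight, normal_shift]; rfl

lemma velocity_shift (i : ℤ) : (P.shift k).velocity φ α i = P.velocity φ α (i + k) := by
  simp only [velocity, delta, normal_shift, transition_shift, length_shift, angle_shift,
    sub_add_eq_add_sub, add_right_comm i 1 k]

lemma IsElasticFlow.shift {T : EReal} {Γ : ℝ → ClosedPolygon} (hΓ : IsElasticFlow φ α P T Γ)
    (k : ℤ) : IsElasticFlow φ α (P.shift k) T (fun t => (Γ t).shift k) where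
  pos := hΓ.pos
  parallel t h0 hT := ⟨(hΓ.parallel t h0 hT).1, fun i => by
    rw [normal_shift, normal_shift, (hΓ.parallel t h0 hT).2]⟩
  continuousOn i := by simpa only [signedHeight_shift] using hΓ.continuousOn (i + k)
  contDiffOn i := by simpa only [signedHeight_shift] using hΓ.contDiffOn (i + k)
  initial i := by rw [signedHeight_shift, hΓ.initial]
  ode i t h0 hT := by
    simpa only [signedHeight_shift, velocity_shift] using hΓ.ode (i + k) t h0 hT

/-- The maximal flow depends on the initial curve only, not on its labels. -/
lemma IsUniqueMaximalElasticFlow.sameCurve {T T' : EReal} {Γ Γ' : ℝ → ClosedPolygon}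
    (hΓ : IsUniqueMaximalElasticFlow φ α P T Γ) (hΓ' : IsMaximalElasticFlow φ α Q T' Γ')
    (h : SameCurve Q P) :
    T' = T ∧ ∀ t : ℝ, 0 ≤ t → (t : EReal) < T → SameCurve (Γ' t) (Γ t) := by
  obtain ⟨k, rfl⟩ := h.exists_eq_shift
  have h1 := hΓ'.1.shift (-k)
  rw [shift_shift_neg] at h1
  obtain ⟨hle, heq⟩ := hΓ.2 T' _ h1
  have heq' : ∀ t : ℝ, 0 ≤ t → (t : EReal) < T' → (Γ t).shift k = Γ' t := fun t h0 hT => by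
    rw [← heq t h0 hT, shift_neg_shift]
  have hT : T' = T := hle.antisymm (hΓ'.2 T _ (hΓ.1.1.shift k) heq')
  refine ⟨hT, fun t h0 ht => ?_⟩
  rw [← heq' t h0 (hT ▸ ht)]
  exact ⟨rfl, k, fun i => rfl⟩

end Shift

/-! ### Restarting the flow -/

section Restart

variable {φ : Plane → ℝ} {α : ℝ} {P : ClosedPolygon}

lemma IsElasticFlow.congr {T : EReal} {Γ Γ' : ℝ → ClosedPolygon} (hΓ : IsElasticFlow φ α P T Γ)
    (h : ∀ t : ℝ, 0 ≤ t → (t : EReal) < T → Γ' t = Γ t) : IsElasticFlow φ α P T Γ' where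
  pos := hΓ.pos
  parallel t h0 hT := h t h0 hT ▸ hΓ.parallel t h0 hT
  continuousOn i := (hΓ.continuousOn i).congr fun t ht => by rw [h t ht.1 ht.2]
  contDiffOn i := (hΓ.contDiffOn i).congr fun t ht => by rw [h t ht.1.le ht.2]
  initial i := by rw [h 0 le_rfl (by exact_mod_cast hΓ.pos), hΓ.initial]
  ode i t h0 hT := by
    rw [h t h0.le hT]
    refine (hΓ.ode i t h0 hT).congr_of_eventuallyEq ?_
    filter_upwards [(isOpen_setOf_coe_lt T).mem_nhds ⟨h0, hT⟩] with s hs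
    rw [h s hs.1.le hs.2]

lemma IsUniqueMaximalElasticFlow.congr {T : EReal} {Γ Γ' : ℝ → ClosedPolygon}
    (hΓ : IsUniqueMaximalElasticFlow φ α P T Γ)
    (h : ∀ t : ℝ, 0 ≤ t → (t : EReal) < T → Γ' t = Γ t) :
    IsUniqueMaximalElasticFlow φ α P T Γ' :=
  ⟨⟨hΓ.1.1.congr h, fun T' Γ'' h' _ => (hΓ.2 T' Γ'' h').1⟩, fun T' Γ'' h' =>
    ⟨(hΓ.2 T' Γ'' h').1, fun t h0 hT => by
      rw [(hΓ.2 T' Γ'' h').2 t h0 hT, h t h0 (hT.trans_le (hΓ.2 T' Γ'' h').1)]⟩⟩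

lemma IsElasticFlow.eventually_uniformlyClose {T : EReal} {Γ : ℝ → ClosedPolygon}
    (hs : ∀ i, Real.sin (P.angle i) ≠ 0) (hΓ : IsElasticFlow φ α P T Γ) {s : ℝ} (h0 : 0 ≤ s)
    (hT : (s : EReal) < T) {ε : ℝ} (hε : 0 < ε) :
    ∀ᶠ t in 𝓝[Set.Ici 0] s, UniformlyClose ε (Γ t) (Γ s) := by
  have hin : ∀ᶠ t : ℝ in 𝓝[Set.Ici 0] s, t ∈ {t : ℝ | 0 ≤ t ∧ (t : EReal) < T} := by
    filter_upwards [self_mem_nhdsWithin, mem_nhdsWithin_of_mem_nhds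
      ((isOpen_lt continuous_coe_real_ereal continuous_const).mem_nhds hT)] with t h1 h2
      using ⟨h1, h2⟩
  have hh : ∀ i, Tendsto (fun t => signedHeight P (Γ t) i) (𝓝[Set.Ici 0] s)
      (𝓝 (signedHeight P (Γ s) i)) := fun i =>
    (hΓ.continuousOn i s ⟨h0, hT⟩).mono_left (nhdsWithin_le_iff.2 hin)
  have hv : ∀ i, Tendsto (fun t => (Γ t).vertex i) (𝓝[Set.Ici 0] s) (𝓝 ((Γ s).vertex i)) := by
    intro i
    rw [(hΓ.parallel s h0 hT).vertex_eq hs]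
    refine Tendsto.congr' (hin.mono fun t ht => ((hΓ.parallel t ht.1 ht.2).vertex_eq hs i).symm) ?_
    exact tendsto_const_nhds.add (((hh i).smul_const _).add ((((hh (i - 1)).add
      ((hh i).const_mul _)).div_const _).smul_const _))
  have hev : ∀ᶠ t in 𝓝[Set.Ici 0] s, ∀ j : ZMod P.n,
      dist ((Γ t).vertex (j.val : ℤ)) ((Γ s).vertex (j.val : ℤ)) < ε :=
    eventually_all.2 fun j => Metric.tendsto_nhds.1 (hv _) ε hε
  have hsn := (hΓ.parallel s h0 hT).1
  filter_upwards [hin, hev] with t ht hclose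
  have htn := (hΓ.parallel t ht.1 ht.2).1
  refine uniformlyClose_of_vertices (fun i => (i : ℝ)) (fun i j hij => Int.cast_le.2 hij)
    (fun i => ?_) (fun i => ⟨i, le_rfl, by push_cast; rfl⟩) fun i => ?_
  · rw [← htn, hsn]; push_cast; rfl
  · have hper : ∀ i : ℤ, dist ((Γ t).vertex (i + P.n)) ((Γ s).vertex (i + P.n)) =
        dist ((Γ t).vertex i) ((Γ s).vertex i) := fun i => by
      congr 1
      · rw [htn, periodic]
      · rw [hsn, periodic]
    have := hclose (i : ZMod P.n)
    rw [apply_zmod_val_of_periodic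
      (f := fun i => dist ((Γ t).vertex i) ((Γ s).vertex i)) hper] at this
    rwa [path_intCast]

lemma exists_eq_coe_of_time_lt {m : ℕ} {T : ℕ → EReal} (h0 : T 0 = 0)
    (hlt : ∀ i ≤ m, T i < T (i + 1)) : ∀ i ≤ m, ∃ r : ℝ, 0 ≤ r ∧ T i = r := by
  have hnonneg : ∀ i ≤ m, 0 ≤ T i := by
    intro i
    induction i with
    | zero => exact fun _ => h0.ge
    | succ i ih => exact fun hi => (ih (by lia)).trans (hlt i (by lia)).le
  intro i hi
  have h1 : T i ≠ ⊥ := (EReal.bot_lt_zero.trans_le (hnonneg i hi)).ne'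
  have h2 : T i ≠ ⊤ := ((hlt i hi).trans_le le_top).ne
  exact ⟨(T i).toReal, EReal.toReal_nonneg (hnonneg i hi), (EReal.coe_toReal h2 h1).symm⟩

lemma exists_time_le_lt {m : ℕ} {T : ℕ → EReal} (h0 : T 0 = 0) (hlast : T (m + 1) = ⊤) {t : ℝ}
    (ht : 0 ≤ t) : ∃ i ≤ m, T i ≤ t ∧ (t : EReal) < T (i + 1) := by
  classical
  have hex : ∃ i, (t : EReal) < T (i + 1) := ⟨m, by rw [hlast]; exact EReal.coe_lt_top t⟩
  refine ⟨Nat.find hex, Nat.find_min' hex (by rw [hlast]; exact EReal.coe_lt_top t), ?_,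
    Nat.find_spec hex⟩
  rcases hk : Nat.find hex with _ | k
  · rw [h0]; exact_mod_cast ht
  · exact not_lt.1 (Nat.find_min hex (m := k) (by lia))

/-- Every maximal flow is continued with the limit curve at its maximal time; this ends after
finitely many steps, as the number of segments decreases. -/
theorem IsAdmissible.exists_restartedFlow (hφ : IsAnisotropy φ) (hα : 0 < α)
    (hP : P.IsAdmissible φ) :
    ∃ (m : ℕ) (T : ℕ → EReal) (Γ : ℝ → ClosedPolygon), m < P.n ∧ Γ 0 = P ∧ T 0 = 0 ∧
      (∀ i ≤ m, T i < T (i + 1)) ∧ T (m + 1) = ⊤ ∧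
      (∀ t, 0 ≤ t → (Γ t).IsAdmissible φ ∧ (Γ t).index φ = P.index φ) ∧
      (∀ s, 0 ≤ s → ∀ ε > 0, ∀ᶠ t in 𝓝[Set.Ici 0] s, UniformlyClose ε (Γ t) (Γ s)) ∧
      ∀ i ≤ m, IsUniqueMaximalElasticFlow φ α (Γ (T i).toReal) (T (i + 1) - T i)
        (fun s => Γ ((T i).toReal + s)) := by
  induction hN : P.n using Nat.strong_induction_on generalizing P with
  | _ N ih =>
  subst hN
  have hs := hP.sin_ne_zero hφ
  obtain ⟨T, A, hA⟩ := exists_isUniqueMaximalElasticFlow φ α hs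
  have hflow := hA.1.1
  have hA0 := hflow.apply_zero hs
  rcases eq_or_ne T ⊤ with rfl | hT
  · refine ⟨0, fun i => if i = 0 then 0 else ⊤, A, P.n_pos, hA0, rfl, ?_, rfl, fun t ht => ?_,
      fun s hs0 ε hε => ?_, ?_⟩
    · intro i hi
      obtain rfl := Nat.le_zero.1 hi
      simp
    · have hpar := hflow.parallel t ht (EReal.coe_lt_top t)
      exact ⟨hpar.isAdmissible hP, (hpar.index_eq φ).symm⟩
    · exact hflow.eventually_uniformlyClose hs hs0 (EReal.coe_lt_top s) hε
    · intro i hi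
      obtain rfl := Nat.le_zero.1 hi
      simpa [hA0] using hA
  obtain ⟨τ, rfl⟩ : ∃ τ : ℝ, T = τ :=
    ⟨T.toReal, (EReal.coe_toReal hT (EReal.bot_lt_zero.trans hflow.pos).ne').symm⟩
  have hτ : 0 < τ := by exact_mod_cast hflow.pos
  obtain ⟨Q, hQn, hQ, hQi, hclose⟩ := hA.exists_limit_polygon hφ hα hP
  obtain ⟨m, S, B, hm, hB0, hS0, hSlt, hSlast, hBadm, hBcont, hBflow⟩ := ih Q.n hQn hQ rfl
  have hcoe := exists_eq_coe_of_time_lt hS0 hSlt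
  set Γ : ℝ → ClosedPolygon := fun t => if t < τ then A t else B (t - τ) with hΓ
  have hΓA : ∀ t, t < τ → Γ t = A t := fun t ht => if_pos ht
  have hΓB : ∀ t, τ ≤ t → Γ t = B (t - τ) := fun t ht => if_neg (not_lt.2 ht)
  have hlt : ∀ {x y : EReal}, x < y → τ + x < τ + y := fun h =>
    EReal.add_lt_add_left_coe h τ
  refine ⟨m + 1, fun i => Nat.casesOn i 0 fun j => τ + S j, Γ, by lia, by rw [hΓA 0 hτ, hA0], rfl,
    ?_, ?_, fun t ht => ?_, fun s hs0 ε hε => ?_, ?_⟩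
  · rintro (_ | i) hi
    · simpa [hS0] using hτ
    · exact hlt (hSlt i (by lia))
  · simp [hSlast]
  · rcases lt_or_ge t τ with h | h
    · have hpar := hflow.parallel t ht (by exact_mod_cast h)
      rw [hΓA t h]
      exact ⟨hpar.isAdmissible hP, (hpar.index_eq φ).symm⟩
    · rw [hΓB t h, ← hQi]
      exact hBadm _ (sub_nonneg.2 h)
  · rcases lt_or_ge s τ with h | h
    · rw [hΓA s h]
      filter_upwards [hflow.eventually_uniformlyClose hs hs0 (by exact_mod_cast h) hε,
        mem_nhdsWithin_of_mem_nhds (Iio_mem_nhds h)] with t h1 h2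
      rwa [hΓA t h2]
    · have h1 : ∀ᶠ t in 𝓝 s, τ ≤ t → UniformlyClose ε (Γ t) (Γ s) := by
        have h2 := hBcont (s - τ) (sub_nonneg.2 h) ε hε
        rw [eventually_nhdsWithin_iff] at h2
        have h3 : Tendsto (fun t => t - τ) (𝓝 s) (𝓝 (s - τ)) :=
          (continuous_id.sub continuous_const).tendsto s
        filter_upwards [h3.eventually h2] with t ht hτt
        rw [hΓB t hτt, hΓB s h]
        exact ht (sub_nonneg.2 hτt)
      have h2 : ∀ᶠ t in 𝓝 s, t < τ → UniformlyClose ε (Γ t) (Γ s) := by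
        rcases h.eq_or_lt with rfl | h
        · have h3 := hclose ε hε
          rw [eventually_nhdsWithin_iff] at h3
          filter_upwards [h3] with t ht hτt
          rw [hΓA t hτt, hΓB _ le_rfl, sub_self, hB0]
          exact ht hτt
        · filter_upwards [Ioi_mem_nhds h] with t ht hτt
          exact absurd hτt (not_lt.2 (le_of_lt ht))
      refine mem_nhdsWithin_of_mem_nhds ?_
      filter_upwards [h1, h2] with t h3 h4 using (le_or_gt τ t).elim h3 h4
  · rintro (_ | i) hi
    · change IsUniqueMaximalElasticFlow φ α (Γ (0 : EReal).toReal) (τ + S 0 - 0)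
        fun s => Γ ((0 : EReal).toReal + s)
      simp only [EReal.toReal_zero, zero_add, hS0, add_zero, sub_zero, hΓA 0 hτ, hA0]
      exact hA.congr fun t _ ht => hΓA t (by exact_mod_cast ht)
    · obtain ⟨r, hr, hSr⟩ := hcoe i (by lia)
      have h1 := hBflow i (by lia)
      simp only [hSr, EReal.toReal_coe] at h1 ⊢
      have h2 : ((τ : EReal) + S (i + 1)) - (τ + r) = S (i + 1) - r := by
        induction S (i + 1) with
        | bot => simp
        | top => rw [EReal.coe_add_top, ← EReal.coe_add, EReal.top_sub_coe, EReal.top_sub_coe]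
        | coe x => norm_cast; ring
      rw [h2, ← EReal.coe_add, EReal.toReal_coe, hΓB _ (by linarith), add_sub_cancel_left]
      refine h1.congr fun t ht _ => ?_
      rw [hΓB _ (by linarith)]
      congr 1; ring

lemma kuratowskiContinuous_of_uniformlyClose {Γ : ℝ → ClosedPolygon}
    (h : ∀ s, 0 ≤ s → ∀ ε > 0, ∀ᶠ t in 𝓝[Set.Ici 0] s, UniformlyClose ε (Γ t) (Γ s)) :
    KuratowskiContinuous Γ := fun s hs =>
  ⟨kuratowskiTendsto_of_uniformlyClose (h s hs), h s hs⟩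

/-- The flow determines the restarted flow up to the labels: on each interval by the uniqueness of
maximal flows, and at the restarting times because curves without straight angles that are uniform
limits of the same curves agree. -/
theorem IsRestartedFlow.unique (hφ : IsAnisotropy φ) {m m' : ℕ} {T T' : ℕ → EReal}
    {Γ Γ' : ℝ → ClosedPolygon} (hΓ : IsRestartedFlow φ α P m T Γ)
    (hmax : ∀ i ≤ m, IsUniqueMaximalElasticFlow φ α (Γ (T i).toReal) (T (i + 1) - T i)
      (fun s => Γ ((T i).toReal + s)))
    (h0 : Γ 0 = P) (hΓ' : IsRestartedFlow φ α P m' T' Γ') :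
    m' = m ∧ (∀ i ≤ m + 1, T' i = T i) ∧ ∀ t : ℝ, 0 ≤ t → SameCurve (Γ' t) (Γ t) := by
  have hcoe := exists_eq_coe_of_time_lt hΓ.time_zero hΓ.time_lt
  -- One stage of the flow, given that both families agree when it starts.
  have hstage : ∀ i ≤ m, i ≤ m' → T' i = T i →
      SameCurve (Γ' (T i).toReal) (Γ (T i).toReal) → T' (i + 1) = T (i + 1) ∧
        ∀ t : ℝ, T i ≤ t → (t : EReal) < T (i + 1) → SameCurve (Γ' t) (Γ t) := by
    intro i hi hi' hT hsame
    obtain ⟨r, -, hr⟩ := hcoe i hi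
    have h1 := hΓ'.maximal i hi'
    have h2 := hmax i hi
    rw [hT] at h1
    rw [hr] at h1 h2 hsame
    simp only [EReal.toReal_coe] at h1 h2 hsame
    obtain ⟨h3, h4⟩ := h2.sameCurve h1 hsame
    refine ⟨?_, fun t ht1 ht2 => ?_⟩
    · have := congrArg (· + (r : EReal)) h3
      simpa only [EReal.sub_add_cancel] using this
    · rw [hr] at ht1
      have h5 : ((t - r : ℝ) : EReal) < T (i + 1) - r := by
        rw [EReal.coe_sub]
        exact EReal.sub_lt_sub_of_lt_of_le ht2 le_rfl (by simp) (by simp)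
      have := h4 (t - r) (sub_nonneg.2 (by exact_mod_cast ht1)) h5
      rwa [add_sub_cancel] at this
  have hstart : ∀ i ≤ m, i ≤ m' ∧ T' i = T i ∧ SameCurve (Γ' (T i).toReal) (Γ (T i).toReal) := by
    intro i
    induction i with
    | zero =>
      refine fun _ => ⟨Nat.zero_le _, by rw [hΓ.time_zero, hΓ'.time_zero], ?_⟩
      rw [hΓ.time_zero, EReal.toReal_zero, h0]
      exact hΓ'.initial
    | succ i ih =>
      intro hi
      obtain ⟨h1, h2, h3⟩ := ih (by lia)
      obtain ⟨h4, h5⟩ := hstage i (by lia) h1 h2 h3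
      obtain ⟨s, hs, hTs⟩ := hcoe (i + 1) hi
      obtain ⟨r, hr, hTr⟩ := hcoe i (by lia)
      have hrs : r < s := by
        have := hΓ.time_lt i (by lia)
        rw [hTs, hTr] at this
        exact_mod_cast this
      refine ⟨Nat.lt_of_le_of_ne h1 ?_, h4, ?_⟩
      · rintro rfl
        rw [hΓ'.time_last, hTs] at h4
        exact absurd h4.symm (EReal.coe_ne_top s)
      · rw [hTs, EReal.toReal_coe]
        refine sameCurve_of_uniformlyClose ((hΓ'.admissible s hs).sin_ne_zero hφ)
          ((hΓ.admissible s hs).sin_ne_zero hφ) fun ε hε => ?_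
        have hle : 𝓝[<] s ≤ 𝓝[Set.Ici 0] s := by
          refine nhdsWithin_le_iff.2 ?_
          filter_upwards [Ioo_mem_nhdsLT (hr.trans_lt hrs)] with t ht using ht.1.le
        obtain ⟨t, ⟨h6, h7⟩, h8⟩ := ((((hΓ.continuous s hs).2 ε hε).filter_mono hle).and
          (((hΓ'.continuous s hs).2 ε hε).filter_mono hle) |>.and (Ioo_mem_nhdsLT hrs)).exists
        refine ⟨Γ' t, h7, (h5 t ?_ ?_).uniformlyClose h6⟩
        · rw [hTr]; exact_mod_cast h8.1.le
        · rw [hTs]; exact_mod_cast h8.2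
  have hm : m' = m := by
    obtain ⟨h1, h2, h3⟩ := hstart m le_rfl
    by_contra hne
    have h4 := hΓ'.time_lt (m + 1) (by lia)
    rw [(hstage m le_rfl h1 h2 h3).1, hΓ.time_last] at h4
    exact not_top_lt h4
  refine ⟨hm, fun i hi => ?_, fun t ht => ?_⟩
  · rcases hi.eq_or_lt with rfl | hi
    · obtain ⟨h1, h2, h3⟩ := hstart m le_rfl
      exact (hstage m le_rfl h1 h2 h3).1
    · exact (hstart i (by lia)).2.1
  · obtain ⟨i, hi, h1, h2⟩ := exists_time_le_lt hΓ.time_zero hΓ.time_last ht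
    obtain ⟨h3, h4, h5⟩ := hstart i hi
    exact (hstage i hi h3 h4 h5).2 t h1 h2

/-- At the end of a stage of a restarted flow a segment of zero curvature vanishes. -/
lemma IsUniqueMaximalElasticFlow.exists_vanishing_segment (hφ : IsAnisotropy φ) (hα : 0 < α)
    {Γ : ℝ → ClosedPolygon} {r s : ℝ} (hP : (Γ r).IsAdmissible φ)
    (h : IsUniqueMaximalElasticFlow φ α (Γ r) (s - r : ℝ) (fun u => Γ (r + u))) :
    ∃ j : ℤ, (∀ t, r ≤ t → t < s → (Γ t).curvature φ j = 0) ∧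
      Tendsto (fun t => (Γ t).length j) (𝓝[<] s) (𝓝 0) := by
  obtain ⟨j, hj, hlim⟩ := h.exists_tendsto_length_zero hφ hα hP
  refine ⟨j, fun t h1 h2 => ?_, ?_⟩
  · have hpar := h.1.1.parallel (t - r) (sub_nonneg.2 h1) (by exact_mod_cast sub_lt_sub_right h2 r)
    rw [add_sub_cancel] at hpar
    rw [(hpar.isAdmissible hP).curvature_eq_zero_iff hφ, ← hpar.transition_eq, hj]
  · have hsub : Tendsto (fun t => t - r) (𝓝[<] s) (𝓝[<] (s - r)) :=
      tendsto_nhdsWithin_iff.2 ⟨((continuous_id.sub continuous_const).tendsto s).mono_left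
        nhdsWithin_le_nhds, eventually_nhdsWithin_of_forall fun t ht => sub_lt_sub_right ht r⟩
    refine (hlim.comp hsub).congr fun t => ?_
    rw [Function.comp_apply, add_sub_cancel]

/-- In a stage of a restarted flow the segments of nonzero curvature do not become short. -/
lemma IsElasticFlow.exists_le_length_of_curvature_ne_zero (hφ : IsAnisotropy φ) (hα : 0 < α)
    {Γ : ℝ → ClosedPolygon} {r s : ℝ} (hP : (Γ r).IsAdmissible φ)
    (h : IsElasticFlow φ α (Γ r) (s - r : ℝ) (fun u => Γ (r + u))) :
    ∃ d > 0, ∀ t, r ≤ t → t < s → ∀ j, (Γ t).curvature φ j ≠ 0 → d ≤ (Γ t).length j := by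
  obtain ⟨d, hd, hdle⟩ := h.exists_forall_le_length hφ hα hP
  refine ⟨d, hd, fun t h1 h2 j hj => ?_⟩
  have hlt : ((t - r : ℝ) : EReal) < (s - r : ℝ) := by exact_mod_cast sub_lt_sub_right h2 r
  have hpar := h.parallel (t - r) (sub_nonneg.2 h1) hlt
  have hle := hdle (t - r) (sub_nonneg.2 h1) hlt j
  rw [add_sub_cancel] at hpar hle
  rw [Ne, (hpar.isAdmissible hP).curvature_eq_zero_iff hφ, ← hpar.transition_eq] at hj
  exact hle hj

end Restart

end ClosedPolygon

end

theorem theorem4p2 (φ : Plane → ℝ) (hφ : IsCrystalline φ) (α : ℝ) (hα : 0 < α)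
    (Γ₀ : ClosedPolygon) (hΓ₀ : Γ₀.IsAdmissible φ) :
    ∃ (m : ℕ) (T : ℕ → EReal) (Γ : ℝ → ClosedPolygon),
      m < Γ₀.n ∧
      ClosedPolygon.IsRestartedFlow φ α Γ₀ m T Γ ∧
      (∀ i ≤ m, ClosedPolygon.IsUniqueMaximalElasticFlow φ α (Γ (T i).toReal) (T (i + 1) - T i)
        (fun s => Γ ((T i).toReal + s))) ∧
      (∀ i < m, ∃ j : ℤ,
        (∀ t : ℝ, T i ≤ (t : EReal) → (t : EReal) < T (i + 1) → (Γ t).curvature φ j = 0) ∧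
        Filter.Tendsto (fun t => (Γ t).length j)
          (nhdsWithin (T (i + 1)).toReal (Set.Iio (T (i + 1)).toReal)) (nhds 0)) ∧
      (∀ i < m, ∃ d : ℝ, 0 < d ∧
        ∀ t : ℝ, T i ≤ (t : EReal) → (t : EReal) < T (i + 1) →
          ∀ j : ℤ, (Γ t).curvature φ j ≠ 0 → d ≤ (Γ t).length j) ∧
      (∀ t : ℝ, 0 ≤ t → (Γ t).index φ = Γ₀.index φ) ∧
      (∀ (m' : ℕ) (T' : ℕ → EReal) (Γ' : ℝ → ClosedPolygon),
        ClosedPolygon.IsRestartedFlow φ α Γ₀ m' T' Γ' →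
          m' = m ∧ (∀ i ≤ m + 1, T' i = T i) ∧
            ∀ t : ℝ, 0 ≤ t → ClosedPolygon.SameCurve (Γ' t) (Γ t)) := by
  obtain ⟨m, T, Γ, hm, h0, hT0, hlt, hlast, hadm, hcont, hflow⟩ :=
    hΓ₀.exists_restartedFlow hφ.anisotropy hα
  have hΓ : ClosedPolygon.IsRestartedFlow φ α Γ₀ m T Γ :=
    ⟨hT0, hlt, hlast, h0 ▸ ⟨rfl, 0, fun i => by rw [add_zero]⟩, fun t ht => (hadm t ht).1,
      ClosedPolygon.kuratowskiContinuous_of_uniformlyClose hcont, fun i hi => (hflow i hi).1⟩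
  have hstage : ∀ i < m, ∃ r s : ℝ, 0 ≤ r ∧ T i = r ∧ T (i + 1) = s ∧
      ClosedPolygon.IsUniqueMaximalElasticFlow φ α (Γ r) (s - r : ℝ) (fun u => Γ (r + u)) := by
    intro i hi
    obtain ⟨r, hr, hTr⟩ := ClosedPolygon.exists_eq_coe_of_time_lt hT0 hlt i hi.le
    obtain ⟨s, -, hTs⟩ := ClosedPolygon.exists_eq_coe_of_time_lt hT0 hlt (i + 1) hi
    have h := hflow i hi.le
    rw [hTr, hTs, EReal.toReal_coe, ← EReal.coe_sub] at h
    exact ⟨r, s, hr, hTr, hTs, h⟩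
  refine ⟨m, T, Γ, hm, hΓ, hflow, fun i hi => ?_, fun i hi => ?_, fun t ht => (hadm t ht).2,
    fun m' T' Γ' hΓ' => hΓ.unique hφ.anisotropy hflow h0 hΓ'⟩
  · obtain ⟨r, s, hr, hTr, hTs, h⟩ := hstage i hi
    rw [hTr, hTs, EReal.toReal_coe]
    obtain ⟨j, hj, hlim⟩ := h.exists_vanishing_segment hφ.anisotropy hα (hadm r hr).1
    exact ⟨j, fun t h1 h2 => hj t (by exact_mod_cast h1) (by exact_mod_cast h2), hlim⟩
  · obtain ⟨r, s, hr, hTr, hTs, h⟩ := hstage i hi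
    rw [hTr, hTs]
    obtain ⟨d, hd, hdle⟩ :=
      h.1.1.exists_le_length_of_curvature_ne_zero hφ.anisotropy hα (hadm r hr).1
    exact ⟨d, hd, fun t h1 h2 => hdle t (by exact_mod_cast h1) (by exact_mod_cast h2)⟩
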